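/- **Programs.** Let $D$ be a finite set of values, which also serve as addresses, with an element $0\in D$, and let $R$ be a finite set of registers. Expressions are built from constants in $D$, registers in $R$ and functions $D^k\to D$ (extended strictly to an undefined value $\bot$). Commands are loads $r\leftarrow \mathrm{mem}[e]$, stores $\mathrm{mem}[e]\leftarrow e'$, assignments $r\leftarrow e$ and conditionals $\mathrm{assume}(e)$. A program $P=T_1\dots T_n$ ($n=|P|$) is a finite sequence of threads; a thread is an automaton with a finite set of control states, an initial state, and a set of instructions, i.e. transitions labelled with commands. **Power automaton.** A state consists of: for each thread $t$, a finite sequence $\mathit{fetched}_t$ of instructions, a set $\mathit{com}_t$ of indices of committed instructions, and a partial function $\mathit{ld}_t$ giving the store read by a load; a coherence key $\mathit{co}(s)\in\mathbb Q$ for each store $s$; and, for each thread $t$ and address $a$, the last store $\mathit{prop}(t,a)$ to $a$ propagated to $t$. A store is either an initial store $\mathit{init}_a$ (of value $0$ to address $a$) or a pair $(t,i)$, the $i$-th fetched instruction of thread $t$. Initially nothing is fetched, committed or loaded, all keys are $0$, and $\mathit{prop}(t,a)=\mathit{init}_a$. The value of an expression in the instruction $(t,i)$ is computed as follows: a register $r$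 has the value determined by the last assignment or load to $r$ fetched in $t$ before $(t,i)$ ($0$ if there is none); for an assignment this is the value of its expression there; for a load it is $\bot$ if the load has not been performed, $0$ if it read an initial store, and otherwise the value of the value argument of the store it read. $\mathrm{addr}(t,i)$ and $\mathrm{val}(t,i)$ denote the values of the address argument (of loads and stores) and of the value argument (of stores, assignments and conditionals) of $(t,i)$, and are $\top$ if there is no such argument. The address (data) dependencies of $(t,i)$ are the instructions of $t$ that define the registers used in its address (value) expression, and recursively, through assignments, those defining the registers used in these; its control dependencies are the conditionals fetched earlier in $t$. The transitions, labelled by events, are: * *Fetch* $(\mathsf f,t,i,I)$: append to $\mathit{fetched}_t$, at index $i$, an instruction $I$ of thread $t$ whose source is the destination of the last instruction fetched in $t$ (the initial control state if there is none). * *Load* $(\mathsf l,t,i,a)$, for a load $(t,i)$ not yet performed, with $\mathrm{addr}(t,i)=a\in D$. Either it reads from memory: $\mathit{ld}_t(i):=\mathit{prop}(t,a)$. Or it is an early read: if $i'<i$ is the greatest index such that $(t,i')$ is a store with $\mathrm{addr}(t,i')\in\{a,\bot\}$, and if $\mathrm{addr}(t,i')=a$, $\mathrm{val}(t,i')\neq\bot$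 and $(t,i')$ is not committed, then $\mathit{ld}_t(i):=(t,i')$. * *Commit* $(\mathsf c,t,i)$ of a fetched, uncommitted non-store, provided that all its address, data and control dependencies are committed, $\mathrm{addr}(t,i)\ne\bot\ne\mathrm{val}(t,i)$, all $(t,i')$ with $i'<i$ and $\mathrm{addr}(t,i')\in\{\mathrm{addr}(t,i),\bot\}$ are committed if $\mathrm{addr}(t,i)\ne\top$, the load has been performed if it is a load, and $\mathrm{val}(t,i)\neq0$ if it is a conditional. * *Store commit* $(\mathsf c,t,i,k,a)$ of a store with address $a$, under the same conditions, with $k\in\mathbb Q$ different from $\mathit{co}(t',i')$ for all $(t',i')$: it becomes committed and $\mathit{co}(t,i):=k$. It must be immediately followed by the propagation $(\mathsf p,t,t,i,a)$. * *Propagation* $(\mathsf p,t,t',i',a)$ to thread $t$ of a committed store $(t',i')$ with address $a$, provided that $\mathit{co}(\mathit{prop}(t,a))<\mathit{co}(t',i')$: set $\mathit{prop}(t,a):=(t',i')$. Each event is related to one instruction: $(\mathsf p,t,t',i',a)$ to $(t',i')$, the others to $(t,i)$. A state is final if (1) all fetched instructions are committed; (2) if $(t,i')$, $(t,i)$ are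 loads from the same address and $i'<i$, then $\mathit{co}(\mathit{ld}_t(i'))\le\mathit{co}(\mathit{ld}_t(i))$; and (3) if $(t,i')$ is a store and $(t,i)$ a load with the same address and $i'<i$, then $\mathit{co}(t,i')\le\mathit{co}(\mathit{ld}_t(i))$. A *Power computation* of $P$ is the event sequence of a run from the initial to a final state. An *SC computation* is a Power computation in which each instruction is executed atomically (it is a concatenation of blocks, each consisting of all events of one instruction), with each store immediately propagated, in its block, to all threads. **Traces and robustness.** The trace of a computation is read off from its final state. It is the directed graph whose nodes are the initial stores and the fetched instructions (with thread and index), with four kinds of arcs: program order (from each fetched instruction of a thread to the next one); coherence order (between stores to the same address, by increasing key, and from $\mathit{init}_a$ to every store to $a$); source order (from the store read by a load to this load); and conflict order ($x\to y$ if some $z$ has a source arc to $x$ and a coherence arc to $y$). *Happens-before* is the union of the four relations; it is cyclic if it contains a directed cycle. $P$ is *robust* if each trace of a Power computation of $P$ is the trace of an SC computation of $P$. **Normal form.** A Power computation $\tau$ is *in normal form of degree $m$* if $\tau=\tau_1\cdots\tau_m$ with possibly empty parts $\tau_j$ such that all fetch events are in $\tau_1$ and, for any two different instructions $x_1\neq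 x_2$, any parts $\tau_s,\tau_{s'}$ (possibly $s=s'$) and any events $e_j,e_j'$ related to $x_j$ ($j=1,2$) with $e_1,e_2\in\tau_s$ and $e_1',e_2'\in\tau_{s'}$, the event $e_1$ occurs before $e_2$ in $\tau_s$ if and only if $e_1'$ occurs before $e_2'$ in $\tau_{s'}$. **Theorem.** A program $P$ is robust if and only if it has no Power computation in normal form of degree $|P|+3$ whose happens-before relation is cyclic. -/

import Mathlib

/-! Programs, the Power automaton, sequential consistency, traces, robustness and normal-form
computations.  All indices (of fetched instructions, of threads) start at `0`. -/

namespace PowerModel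

universe u v w

/-- Expressions over constants from `D`, registers from `Reg` and functions on `D`.  Functions are
extended strictly to an undefined value, which is handled by the evaluation below. -/
inductive Expr (D : Type u) (Reg : Type v) : Type (max u v)
  | const (d : D)
  | reg (r : Reg)
  | app (k : ℕ) (f : (Fin k → D) → D) (args : Fin k → Expr D Reg)

/-- Commands: `r ← mem[addr]`, `mem[addr] ← val`, `r ← e`, `assume(e)`. -/
inductive Cmd (D : Type u) (Reg : Type v) : Type (max u v)
  | load (r : Reg) (addr : Expr D Reg)
  | store (addr val : Expr D Reg)
  | assign (r : Reg) (e : Expr D Reg)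
  | assume (e : Expr D Reg)

namespace Cmd

variable {D : Type u} {Reg : Type v}

def IsLoad (c : Cmd D Reg) : Prop := ∃ r e, c = load r e

def IsStore (c : Cmd D Reg) : Prop := ∃ e e', c = store e e'

def IsAssume (c : Cmd D Reg) : Prop := ∃ e, c = assume e

/-- The command is a local assignment or a load to register `r`. -/
def Defines (c : Cmd D Reg) (r : Reg) : Prop := (∃ e, c = load r e) ∨ (∃ e, c = assign r e)

/-- The address argument. -/
def addrExpr : Cmd D Reg → Option (Expr D Reg)
  | load _ e => some e
  | store e _ => some e
  | assign _ _ => none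
  | assume _ => none

/-- The value argument. -/
def valueExpr : Cmd D Reg → Option (Expr D Reg)
  | load _ _ => none
  | store _ e => some e
  | assign _ e => some e
  | assume e => some e

end Cmd

/-- An instruction: a transition of a thread automaton, labelled by a command. -/
structure Instr (D : Type u) (Reg : Type v) (Q : Type w) : Type (max u v w) where
  src : Q
  cmd : Cmd D Reg
  dst : Q

/-- A thread: an automaton over the control states `Q`, all of which are final. -/
structure Thread (D : Type u) (Reg : Type v) (Q : Type w) : Type (max u v w) where
  init : Q
  instrs : Set (Instr D Reg Q)

/-- A program: a sequence of `n` threads. -/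
abbrev Program (D : Type u) (Reg : Type v) (Q : Type w) (n : ℕ) : Type (max u v w) :=
  Fin n → Thread D Reg Q

/-- Stores: the initial store of value `0` to an address, or the `i`-th fetched instruction of
thread `t`. -/
inductive StoreId (D : Type u) (n : ℕ) : Type u
  | init (a : D)
  | st (t : Fin n) (i : ℕ)

/-- Runtime state of a thread. -/
structure ThreadState (D : Type u) (Reg : Type v) (Q : Type w) (n : ℕ) : Type (max u v w) where
  fetched : List (Instr D Reg Q)
  committed : Set ℕ
  loaded : ℕ → Option (StoreId D n)

/-- State of the running program: the runtime thread states and the storage subsystem, which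
consists of the coherence keys `co` and the last store `prop t a` to address `a` propagated to
thread `t`.  The key of a store that is not yet committed is `0`. -/
structure State (D : Type u) (Reg : Type v) (Q : Type w) (n : ℕ) : Type (max u v w) where
  thr : Fin n → ThreadState D Reg Q n
  co : StoreId D n → ℚ
  prop : Fin n → D → StoreId D n

/-- Events.  A fetch event carries the index that the fetched instruction gets.
`propagate t t' i' a`: the store `(t', i')` to address `a` is propagated to thread `t`. -/
inductive Event (D : Type u) (Reg : Type v) (Q : Type w) (n : ℕ) : Type (max u v w)
  | fetch (t : Fin n) (i : ℕ) (I : Instr D Reg Q)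
  | load (t : Fin n) (i : ℕ) (a : D)
  | commit (t : Fin n) (i : ℕ)
  | commitStore (t : Fin n) (i : ℕ) (key : ℚ) (a : D)
  | propagate (t t' : Fin n) (i' : ℕ) (a : D)

/-- Value of an argument: undefined (`bot`), no such argument (`top`), or a value. -/
inductive ArgVal (D : Type u) : Type u
  | bot
  | top
  | val (d : D)

section Semantics

variable {D : Type u} {Reg : Type v} {Q : Type w} {n : ℕ}

namespace Event

/-- The instruction (thread, index) that an event is related to. -/
def inst : Event D Reg Q n → Fin n × ℕ
  | fetch t i _ => (t, i)
  | load t i _ => (t, i)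
  | commit t i => (t, i)
  | commitStore t i _ _ => (t, i)
  | propagate _ t' i' _ => (t', i')

def IsFetch (e : Event D Reg Q n) : Prop := ∃ t i I, e = fetch t i I

end Event

namespace State

/-- The instruction at index `i` in the fetch sequence of thread `t`. -/
def instrAt (s : State D Reg Q n) (t : Fin n) (i : ℕ) : Option (Instr D Reg Q) :=
  (s.thr t).fetched[i]?

def cmdAt (s : State D Reg Q n) (t : Fin n) (i : ℕ) : Option (Cmd D Reg) :=
  (s.instrAt t i).map Instr.cmd

def IsLoad (s : State D Reg Q n) (t : Fin n) (i : ℕ) : Prop :=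
  ∃ c, s.cmdAt t i = some c ∧ c.IsLoad

def IsStore (s : State D Reg Q n) (t : Fin n) (i : ℕ) : Prop :=
  ∃ c, s.cmdAt t i = some c ∧ c.IsStore

def IsAssume (s : State D Reg Q n) (t : Fin n) (i : ℕ) : Prop :=
  ∃ c, s.cmdAt t i = some c ∧ c.IsAssume

def DefinesAt (s : State D Reg Q n) (t : Fin n) (j : ℕ) (r : Reg) : Prop :=
  ∃ c, s.cmdAt t j = some c ∧ c.Defines r

/-- `j` is the greatest index below `i` at which register `r` is defined. -/
def LastDef (s : State D Reg Q n) (t : Fin n) (i : ℕ) (r : Reg) (j : ℕ) : Prop :=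
  j < i ∧ s.DefinesAt t j r ∧ ∀ k, j < k → k < i → ¬ s.DefinesAt t k r

/-- Evaluation of the expression `e` in the `i`-th fetched instruction of thread `t`, as the least
relation closed under the evaluation rules.  An expression is undefined if it has no value. -/
inductive EvalsTo [Zero D] (s : State D Reg Q n) : Fin n → ℕ → Expr D Reg → D → Prop
  | const (t : Fin n) (i : ℕ) (d : D) : EvalsTo s t i (.const d) d
  | app (t : Fin n) (i k : ℕ) (f : (Fin k → D) → D) (args : Fin k → Expr D Reg) (vals : Fin k → D)
      (h : ∀ m, EvalsTo s t i (args m) (vals m)) : EvalsTo s t i (.app k f args) (f vals)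
  | regInit (t : Fin n) (i : ℕ) (r : Reg) (h : ∀ j, j < i → ¬ s.DefinesAt t j r) :
      EvalsTo s t i (.reg r) 0
  | regAssign (t : Fin n) (i : ℕ) (r : Reg) (j : ℕ) (e : Expr D Reg) (d : D)
      (hj : s.LastDef t i r j) (hc : s.cmdAt t j = some (.assign r e))
      (h : EvalsTo s t j e d) : EvalsTo s t i (.reg r) d
  | regLoadInit (t : Fin n) (i : ℕ) (r : Reg) (j : ℕ) (e : Expr D Reg) (a : D)
      (hj : s.LastDef t i r j) (hc : s.cmdAt t j = some (.load r e))
      (hl : (s.thr t).loaded j = some (.init a)) : EvalsTo s t i (.reg r) 0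
  | regLoad (t : Fin n) (i : ℕ) (r : Reg) (j : ℕ) (e : Expr D Reg) (t' : Fin n) (j' : ℕ)
      (c' : Cmd D Reg) (e' : Expr D Reg) (d : D)
      (hj : s.LastDef t i r j) (hc : s.cmdAt t j = some (.load r e))
      (hl : (s.thr t).loaded j = some (.st t' j'))
      (hc' : s.cmdAt t' j' = some c') (he' : c'.valueExpr = some e')
      (h : EvalsTo s t' j' e' d) : EvalsTo s t i (.reg r) d

/-- Value of an expression in the `i`-th fetched instruction of thread `t`; `none` if undefined. -/
noncomputable def evaluate [Zero D] (s : State D Reg Q n) (t : Fin n) (i : ℕ) (e : Expr D Reg) :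
    Option D :=
  open Classical in if h : ∃ d, s.EvalsTo t i e d then some h.choose else none

theorem LastDef.unique {s : State D Reg Q n} {t : Fin n} {i : ℕ} {r : Reg} {j j' : ℕ}
    (h : s.LastDef t i r j) (h' : s.LastDef t i r j') : j = j' := by
  rcases lt_trichotomy j j' with hl | hl | hl
  · exact absurd h'.2.1 (h.2.2 _ hl h'.1)
  · exact hl
  · exact absurd h.2.1 (h'.2.2 _ hl h.1)

theorem EvalsTo.unique [Zero D] {s : State D Reg Q n} {t : Fin n} {i : ℕ} {e : Expr D Reg} {d d' : D}
    (h : s.EvalsTo t i e d) (h' : s.EvalsTo t i e d') : d = d' := by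
  induction h generalizing d' with
  | const => cases h'; rfl
  | app t i k f args vals _ ih =>
    cases h' with
    | app _ _ _ _ _ vals' h' => exact congrArg f (funext fun m => ih m (h' m))
  | regInit t i r h =>
    cases h' with
    | regInit => rfl
    | regAssign _ _ _ _ _ _ hj => exact absurd hj.2.1 (h _ hj.1)
    | regLoadInit _ _ _ _ _ _ hj => exact absurd hj.2.1 (h _ hj.1)
    | regLoad _ _ _ _ _ _ _ _ _ _ hj => exact absurd hj.2.1 (h _ hj.1)
  | regAssign t i r j e d hj hc _ ih =>
    cases h' with
    | regInit _ _ _ h => exact absurd hj.2.1 (h _ hj.1)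
    | regAssign _ _ _ _ _ _ hj' hc' h' =>
      cases hj.unique hj'
      rw [hc] at hc'
      cases hc'
      exact ih h'
    | regLoadInit _ _ _ _ _ _ hj' hc' =>
      cases hj.unique hj'
      rw [hc] at hc'
      cases hc'
    | regLoad _ _ _ _ _ _ _ _ _ _ hj' hc' =>
      cases hj.unique hj'
      rw [hc] at hc'
      cases hc'
  | regLoadInit t i r j e a hj hc hl =>
    cases h' with
    | regInit => rfl
    | regAssign _ _ _ _ _ _ hj' hc' =>
      cases hj.unique hj'
      rw [hc] at hc'
      cases hc'
    | regLoadInit => rfl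
    | regLoad _ _ _ _ _ _ _ _ _ _ hj' _ hl' =>
      cases hj.unique hj'
      rw [hl] at hl'
      cases hl'
  | regLoad t i r j e t₁ j₁ c₁ e₁ d hj hc hl hc₁ he₁ _ ih =>
    cases h' with
    | regInit _ _ _ h => exact absurd hj.2.1 (h _ hj.1)
    | regAssign _ _ _ _ _ _ hj' hc' =>
      cases hj.unique hj'
      rw [hc] at hc'
      cases hc'
    | regLoadInit _ _ _ _ _ _ hj' _ hl' =>
      cases hj.unique hj'
      rw [hl] at hl'
      cases hl'
    | regLoad _ _ _ _ _ _ _ _ _ _ hj' _ hl' hc' he' h' =>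
      cases hj.unique hj'
      rw [hl] at hl'
      cases hl'
      rw [hc₁] at hc'
      cases hc'
      rw [he₁] at he'
      cases he'
      exact ih h'

theorem evaluate_eq_some_iff [Zero D] {s : State D Reg Q n} {t : Fin n} {i : ℕ} {e : Expr D Reg}
    {d : D} : s.evaluate t i e = some d ↔ s.EvalsTo t i e d := by
  classical
  unfold evaluate
  constructor
  · intro h
    split_ifs at h with hx
    rw [← Option.some.inj h]
    exact hx.choose_spec
  · intro h
    have hx : ∃ d, s.EvalsTo t i e d := ⟨d, h⟩
    rw [dif_pos hx, hx.choose_spec.unique h]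

/-- Value of an optional argument of the `i`-th fetched instruction of thread `t`. -/
noncomputable def argVal [Zero D] (s : State D Reg Q n) (t : Fin n) (i : ℕ) :
    Option (Expr D Reg) → ArgVal D
  | none => .top
  | some e =>
    match s.evaluate t i e with
    | none => .bot
    | some d => .val d

noncomputable def getAddr [Zero D] (s : State D Reg Q n) (t : Fin n) (i : ℕ) : ArgVal D :=
  s.argVal t i ((s.cmdAt t i).bind Cmd.addrExpr)

noncomputable def getValue [Zero D] (s : State D Reg Q n) (t : Fin n) (i : ℕ) : ArgVal D :=
  s.argVal t i ((s.cmdAt t i).bind Cmd.valueExpr)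

/-- `s.DependsOn t i e j`: the value of `e` in the `i`-th fetched instruction of thread `t` depends,
within this thread, on the `j`-th fetched instruction. -/
inductive DependsOn (s : State D Reg Q n) (t : Fin n) : ℕ → Expr D Reg → ℕ → Prop
  | app (i k : ℕ) (f : (Fin k → D) → D) (args : Fin k → Expr D Reg) (m : Fin k) (j : ℕ)
      (h : DependsOn s t i (args m) j) : DependsOn s t i (.app k f args) j
  | reg (i : ℕ) (r : Reg) (j : ℕ) (hj : s.LastDef t i r j) : DependsOn s t i (.reg r) j
  | regAssign (i : ℕ) (r : Reg) (j : ℕ) (e : Expr D Reg) (j' : ℕ)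
      (hj : s.LastDef t i r j) (hc : s.cmdAt t j = some (.assign r e))
      (h : DependsOn s t j e j') : DependsOn s t i (.reg r) j'

def addrDeps (s : State D Reg Q n) (t : Fin n) (i : ℕ) : Set ℕ :=
  {j | ∃ e, (s.cmdAt t i).bind Cmd.addrExpr = some e ∧ s.DependsOn t i e j}

def dataDeps (s : State D Reg Q n) (t : Fin n) (i : ℕ) : Set ℕ :=
  {j | ∃ e, (s.cmdAt t i).bind Cmd.valueExpr = some e ∧ s.DependsOn t i e j}

def ctrlDeps (s : State D Reg Q n) (t : Fin n) (i : ℕ) : Set ℕ :=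
  {j | j < i ∧ s.IsAssume t j}

/-- The common preconditions for committing the `i`-th fetched instruction of thread `t`. -/
structure CanCommit [Zero D] (s : State D Reg Q n) (t : Fin n) (i : ℕ) : Prop where
  fetched : i < (s.thr t).fetched.length
  not_committed : i ∉ (s.thr t).committed
  deps : s.addrDeps t i ∪ s.dataDeps t i ∪ s.ctrlDeps t i ⊆ (s.thr t).committed
  addr : s.getAddr t i ≠ .bot
  value : s.getValue t i ≠ .bot
  same_addr : s.getAddr t i ≠ .top →
    ∀ j, j < i → (s.getAddr t j = s.getAddr t i ∨ s.getAddr t j = .bot) →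
      j ∈ (s.thr t).committed
  load : s.IsLoad t i → (s.thr t).loaded i ≠ none
  assume : s.IsAssume t i → s.getValue t i ≠ .val 0

/-- Replacement of the runtime state of thread `t`. -/
def setThr (s : State D Reg Q n) (t : Fin n) (x : ThreadState D Reg Q n) : State D Reg Q n :=
  { s with thr := Function.update s.thr t x }

def addFetched (s : State D Reg Q n) (t : Fin n) (I : Instr D Reg Q) : State D Reg Q n :=
  s.setThr t { s.thr t with fetched := (s.thr t).fetched ++ [I] }

def setLoaded (s : State D Reg Q n) (t : Fin n) (i : ℕ) (x : StoreId D n) : State D Reg Q n :=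
  s.setThr t { s.thr t with loaded := Function.update (s.thr t).loaded i (some x) }

def addCommitted (s : State D Reg Q n) (t : Fin n) (i : ℕ) : State D Reg Q n :=
  s.setThr t { s.thr t with committed := insert i (s.thr t).committed }

noncomputable def setCo (s : State D Reg Q n) (x : StoreId D n) (key : ℚ) : State D Reg Q n :=
  open Classical in { s with co := Function.update s.co x key }

noncomputable def setProp (s : State D Reg Q n) (t : Fin n) (a : D) (x : StoreId D n) :
    State D Reg Q n :=
  open Classical in { s with prop := Function.update s.prop t (Function.update (s.prop t) a x) }

/-- The initial state. -/
def initial : State D Reg Q n where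
  thr := fun _ => { fetched := [], committed := ∅, loaded := fun _ => none }
  co := fun _ => 0
  prop := fun _ a => .init a

/-- Coherence key of the store read by the `i`-th fetched instruction (a load) of thread `t` is
`x`. -/
def LoadedKey (s : State D Reg Q n) (t : Fin n) (i : ℕ) (x : ℚ) : Prop :=
  ∃ σ, (s.thr t).loaded i = some σ ∧ s.co σ = x

/-- The final states: every fetched instruction is committed, loads agree with the coherence
order, and loads and stores in the same thread agree with the coherence order. -/
structure Final [Zero D] (s : State D Reg Q n) : Prop where
  comm : ∀ t i, i ∈ (s.thr t).committed ↔ i < (s.thr t).fetched.length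
  ld : ∀ t i i' x x', i' < i → s.IsLoad t i → s.IsLoad t i' → s.getAddr t i = s.getAddr t i' →
    s.LoadedKey t i x → s.LoadedKey t i' x' → x' ≤ x
  ld_st : ∀ t i i' x, i' < i → s.IsLoad t i → s.IsStore t i' → s.getAddr t i = s.getAddr t i' →
    s.LoadedKey t i x → s.co (.st t i') ≤ x

end State

/-- The transitions of the Power automaton of the program `P`.  That committing a store is
immediately followed by its propagation to its own thread is required in `powerComputations`. -/
inductive Trans [Zero D] (P : Program D Reg Q n) :
    State D Reg Q n → Event D Reg Q n → State D Reg Q n → Prop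
  | fetch (s : State D Reg Q n) (t : Fin n) (I : Instr D Reg Q) (hI : I ∈ (P t).instrs)
      (hsrc : I.src = (((s.thr t).fetched.getLast?).map Instr.dst).getD (P t).init) :
      Trans P s (.fetch t (s.thr t).fetched.length I) (s.addFetched t I)
  | load (s : State D Reg Q n) (t : Fin n) (i : ℕ) (a : D)
      (hload : s.IsLoad t i) (hnone : (s.thr t).loaded i = none) (ha : s.getAddr t i = .val a) :
      Trans P s (.load t i a) (s.setLoaded t i (s.prop t a))
  | early (s : State D Reg Q n) (t : Fin n) (i : ℕ) (a : D) (i' : ℕ)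
      (hload : s.IsLoad t i) (hnone : (s.thr t).loaded i = none) (ha : s.getAddr t i = .val a)
      (hlt : i' < i) (hst : s.IsStore t i')
      (hmax : ∀ j, i' < j → j < i → s.IsStore t j →
        s.getAddr t j ≠ .val a ∧ s.getAddr t j ≠ .bot)
      (ha' : s.getAddr t i' = .val a) (hv : s.getValue t i' ≠ .bot)
      (hc : i' ∉ (s.thr t).committed) :
      Trans P s (.load t i a) (s.setLoaded t i (.st t i'))
  | commit (s : State D Reg Q n) (t : Fin n) (i : ℕ) (hcan : s.CanCommit t i)
      (hst : ¬ s.IsStore t i) :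
      Trans P s (.commit t i) (s.addCommitted t i)
  | commitStore (s : State D Reg Q n) (t : Fin n) (i : ℕ) (key : ℚ) (a : D)
      (hcan : s.CanCommit t i) (hst : s.IsStore t i) (ha : s.getAddr t i = .val a)
      (hkey : ∀ t' i', s.co (.st t' i') ≠ key) :
      Trans P s (.commitStore t i key a) ((s.addCommitted t i).setCo (.st t i) key)
  | propagate (s : State D Reg Q n) (t t' : Fin n) (i' : ℕ) (a : D)
      (hst : s.IsStore t' i') (hcom : i' ∈ (s.thr t').committed) (ha : s.getAddr t' i' = .val a)
      (hlt : s.co (s.prop t a) < s.co (.st t' i')) :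
      Trans P s (.propagate t t' i' a) (s.setProp t a (.st t' i'))

/-- Sequences of transitions. -/
inductive Run [Zero D] (P : Program D Reg Q n) :
    State D Reg Q n → List (Event D Reg Q n) → State D Reg Q n → Prop
  | nil (s : State D Reg Q n) : Run P s [] s
  | cons (s : State D Reg Q n) (e : Event D Reg Q n) (s' : State D Reg Q n)
      (σ : List (Event D Reg Q n)) (s'' : State D Reg Q n)
      (h : Trans P s e s') (hr : Run P s' σ s'') : Run P s (e :: σ) s''

/-- Every commit of a store is immediately followed by its propagation to its own thread. -/
def PropagatesAtCommit (σ : List (Event D Reg Q n)) : Prop :=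
  ∀ σ₁ σ₂ t i key a, σ = σ₁ ++ Event.commitStore t i key a :: σ₂ →
    ∃ σ₃, σ₂ = Event.propagate t t i a :: σ₃

/-- `σ` labels an accepting run of the Power automaton that ends in the final state `s`. -/
def AcceptedAt [Zero D] (P : Program D Reg Q n) (σ : List (Event D Reg Q n))
    (s : State D Reg Q n) : Prop :=
  Run P State.initial σ s ∧ PropagatesAtCommit σ ∧ s.Final

/-- The Power computations of `P`. -/
def powerComputations [Zero D] (P : Program D Reg Q n) : Set (List (Event D Reg Q n)) :=
  {σ | ∃ s, AcceptedAt P σ s}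

/-- The events of one instruction executed atomically, where a store is immediately propagated to
all threads (each of them exactly once, its own one first). -/
inductive AtomicBlock : List (Event D Reg Q n) → Prop
  | load (t : Fin n) (i : ℕ) (I : Instr D Reg Q) (a : D) (hI : I.cmd.IsLoad) :
      AtomicBlock [.fetch t i I, .load t i a, .commit t i]
  | loc (t : Fin n) (i : ℕ) (I : Instr D Reg Q) (hI : ¬ I.cmd.IsLoad) (hI' : ¬ I.cmd.IsStore) :
      AtomicBlock [.fetch t i I, .commit t i]
  | store (t : Fin n) (i : ℕ) (I : Instr D Reg Q) (key : ℚ) (a : D) (others : List (Fin n))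
      (hI : I.cmd.IsStore) (hnodup : (t :: others).Nodup) (hall : ∀ t', t' ∈ t :: others) :
      AtomicBlock (.fetch t i I :: .commitStore t i key a ::
        (t :: others).map fun t' => Event.propagate t' t i a)

/-- The SC computations of `P`: the Power computations in which each instruction is executed
atomically and stores are immediately propagated to all threads. -/
def scComputations [Zero D] (P : Program D Reg Q n) : Set (List (Event D Reg Q n)) :=
  {σ | σ ∈ powerComputations P ∧
    ∃ bs : List (List (Event D Reg Q n)), (∀ b ∈ bs, AtomicBlock b) ∧ σ = bs.flatten}

/-- Nodes of traces: initial stores, and instructions with thread and serial number. -/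
inductive Node (D : Type u) (Reg : Type v) (Q : Type w) (n : ℕ) : Type (max u v w)
  | init (a : D)
  | inst (t : Fin n) (i : ℕ) (I : Instr D Reg Q)

/-- Directed graphs with four kinds of arcs: program order, coherence order, source order and
conflict order. -/
structure Trace (D : Type u) (Reg : Type v) (Q : Type w) (n : ℕ) : Type (max u v w) where
  nodes : Set (Node D Reg Q n)
  po : Node D Reg Q n → Node D Reg Q n → Prop
  co : Node D Reg Q n → Node D Reg Q n → Prop
  src : Node D Reg Q n → Node D Reg Q n → Prop
  cf : Node D Reg Q n → Node D Reg Q n → Prop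

namespace State

/-- The node `x` is the store `y`. -/
inductive NodeOfStore (s : State D Reg Q n) : Node D Reg Q n → StoreId D n → Prop
  | init (a : D) : NodeOfStore s (.init a) (.init a)
  | st (t : Fin n) (i : ℕ) (I : Instr D Reg Q) (h : s.instrAt t i = some I) :
      NodeOfStore s (.inst t i I) (.st t i)

inductive ProgramOrder (s : State D Reg Q n) : Node D Reg Q n → Node D Reg Q n → Prop
  | mk (t : Fin n) (i : ℕ) (I I' : Instr D Reg Q) (h : s.instrAt t i = some I)
      (h' : s.instrAt t (i + 1) = some I') : ProgramOrder s (.inst t i I) (.inst t (i + 1) I')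

/-- Stores to the same address are ordered by their coherence keys, after the initial store. -/
inductive CoherenceOrder [Zero D] (s : State D Reg Q n) :
    Node D Reg Q n → Node D Reg Q n → Prop
  | st (t : Fin n) (i : ℕ) (I : Instr D Reg Q) (t' : Fin n) (i' : ℕ) (I' : Instr D Reg Q)
      (h : s.instrAt t i = some I) (h' : s.instrAt t' i' = some I')
      (hst : I.cmd.IsStore) (hst' : I'.cmd.IsStore)
      (ha : s.getAddr t i = s.getAddr t' i') (hlt : s.co (.st t i) < s.co (.st t' i')) :
      CoherenceOrder s (.inst t i I) (.inst t' i' I')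
  | init (a : D) (t' : Fin n) (i' : ℕ) (I' : Instr D Reg Q)
      (h' : s.instrAt t' i' = some I') (hst' : I'.cmd.IsStore) (ha : s.getAddr t' i' = .val a) :
      CoherenceOrder s (.init a) (.inst t' i' I')

inductive SourceOrder (s : State D Reg Q n) : Node D Reg Q n → Node D Reg Q n → Prop
  | mk (x : Node D Reg Q n) (y : StoreId D n) (t' : Fin n) (i' : ℕ) (I' : Instr D Reg Q)
      (h' : s.instrAt t' i' = some I') (hl : (s.thr t').loaded i' = some y)
      (hx : s.NodeOfStore x y) : SourceOrder s x (.inst t' i' I')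

/-- The trace read off from a state. -/
def trace [Zero D] (s : State D Reg Q n) : Trace D Reg Q n where
  nodes := {x | ∃ y, s.NodeOfStore x y}
  po := s.ProgramOrder
  co := s.CoherenceOrder
  src := s.SourceOrder
  cf := fun x y => ∃ z, s.SourceOrder z x ∧ s.CoherenceOrder z y

end State

namespace Trace

def HappensBefore (T : Trace D Reg Q n) (x y : Node D Reg Q n) : Prop :=
  T.po x y ∨ T.co x y ∨ T.src x y ∨ T.cf x y

/-- The happens-before relation has a cycle. -/
def Cyclic (T : Trace D Reg Q n) : Prop := ∃ x, Relation.TransGen T.HappensBefore x x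

end Trace

/-- `T` is the trace of the computation `σ` of `P`: it is read off from the final state of an
accepting run labelled by `σ`. -/
def IsTraceOf [Zero D] (P : Program D Reg Q n) (σ : List (Event D Reg Q n))
    (T : Trace D Reg Q n) : Prop :=
  ∃ s, AcceptedAt P σ s ∧ s.trace = T

/-- The traces of the computations in `C`. -/
def traces [Zero D] (P : Program D Reg Q n) (C : Set (List (Event D Reg Q n))) :
    Set (Trace D Reg Q n) :=
  {T | ∃ σ ∈ C, IsTraceOf P σ T}

/-- Robustness against Power. -/
def Robust [Zero D] (P : Program D Reg Q n) : Prop :=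
  traces P (powerComputations P) ⊆ traces P (scComputations P)

/-- The computation `σ` has a cyclic happens-before relation. -/
def HasCyclicHB [Zero D] (P : Program D Reg Q n) (σ : List (Event D Reg Q n)) : Prop :=
  ∃ T, IsTraceOf P σ T ∧ T.Cyclic

/-- `e` occurs before `e'` in `τ`. -/
def Before (τ : List (Event D Reg Q n)) (e e' : Event D Reg Q n) : Prop :=
  ∃ τ₁ τ₂ τ₃, τ = τ₁ ++ e :: (τ₂ ++ e' :: τ₃)

/-- Normal form of degree `m`: a partition into `m` (possibly empty) parts such that all fetch
events are in the first part, and events related to two different instructions occur in the same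
order in every part. -/
def InNormalForm (m : ℕ) (σ : List (Event D Reg Q n)) : Prop :=
  ∃ τ : Fin m → List (Event D Reg Q n),
    σ = (List.ofFn τ).flatten ∧
    (∀ j : Fin m, 0 < (j : ℕ) → ∀ e ∈ τ j, ¬ e.IsFetch) ∧
    ∀ (j j' : Fin m) (e₁ e₂ e₁' e₂' : Event D Reg Q n),
      e₁.inst = e₁'.inst → e₂.inst = e₂'.inst → e₁.inst ≠ e₂.inst →
      e₁ ∈ τ j → e₂ ∈ τ j → e₁' ∈ τ j' → e₂' ∈ τ j' →
      (Before (τ j) e₁ e₂ ↔ Before (τ j') e₁' e₂')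

end Semantics

end PowerModel

/-! The proof works with *executions*: a state `g` together with a list of actions (fetch, load,
commit, propagate), each of which is enabled after the preceding ones in the sense of `Ok`.  This
condition refers only to the set of preceding actions and to `g`; thus actions can be reordered or
removed without looking at intermediate states.  Every computation gives an execution with its final
state (`AcceptedAt.execution`), and every execution is carried out by a computation with the same
trace (`Execution.acceptedAt`).  This rests on the invariant `State.Inv` of runs and on the
monotonicity of the evaluation of expressions: a value that has been computed does not change in
later states.

If the happens-before relation of an execution is acyclic, then there is a numbering of the
instructions along which it increases (`exists_ranking`), and executing the instructions atomically
in this order is possible (`Execution.exists_sc`).  Conversely, the traces of SC computations are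
acyclic (`not_cyclic_of_sc`), since their blocks give such a numbering.  Hence a program is robust if
and only if no Power computation of it has a cyclic happens-before relation.

It remains to turn a computation with a cycle into one in normal form with a cycle.  A suitable
instruction `x`, the last one of its thread, can be deleted: loads that read from it read instead the
store that was visible to their threads before (`Execution.delete`).  For `x` one takes the last
instruction of some thread that is not read by any load, or, if there is none, the last instruction
of a thread that is committed latest; at this point all addresses and all conditions of conditionals
are known independently of `x` (`AcceptedAt.exists_deletable`).  One deletes instructions as long as
a cycle remains.  In the end there are a computation with a cycle and an instruction `x` whose
deletion makes it acyclic, so all other instructions can be numbered along happens-before, up to the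
arcs at `x` (`AcceptedAt.exists_almostRanking`).

The normal form (`Execution.exists_normalForm`) consists of a part with all fetches, and one further
part for each of the remaining actions of `x`, which ends it, and for what follows.  Since `x` has at
most `n + 1` such actions, namely its commit and either a load or at most `n` propagations, there are
at most `n + 3` parts.  Within each part, actions are ordered by the numbering of the instructions.
This changes only the order of actions between two consecutive actions of `x`, in accordance with
happens-before, and therefore preserves that each action is enabled. -/

namespace PowerModel

universe u v w

/-! ### Actions, and evaluation of expressions -/

/-- An event without its data: an event of a run is determined by its action and the final state of
the run.  `prop t t' i` is the propagation of the store `(t', i)` to thread `t`. -/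
inductive Action (n : ℕ) : Type
  | fetch (t : Fin n) (i : ℕ)
  | load (t : Fin n) (i : ℕ)
  | commit (t : Fin n) (i : ℕ)
  | prop (t t' : Fin n) (i : ℕ)
deriving DecidableEq

/-- The instruction (thread, index) that an action is related to. -/
def Action.inst {n : ℕ} : Action n → Fin n × ℕ
  | fetch t i => (t, i)
  | load t i => (t, i)
  | commit t i => (t, i)
  | prop _ t' i => (t', i)

section Semantics

variable {D : Type u} {Reg : Type v} {Q : Type w} {n : ℕ}

/-- The action of an event. -/
def Event.action : Event D Reg Q n → Action n
  | fetch t i _ => .fetch t i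
  | load t i _ => .load t i
  | commit t i => .commit t i
  | commitStore t i _ _ => .commit t i
  | propagate t t' i' _ => .prop t t' i'

namespace State

/-- The number of fetched instructions of thread `t`. -/
def len (s : State D Reg Q n) (t : Fin n) : ℕ := (s.thr t).fetched.length

theorem instrAt_eq_some_of_lt {s : State D Reg Q n} {t : Fin n} {i : ℕ} (h : i < s.len t) :
    ∃ I, s.instrAt t i = some I :=
  ⟨_, List.getElem?_eq_getElem h⟩

theorem lt_len_of_instrAt {s : State D Reg Q n} {t : Fin n} {i : ℕ} {I : Instr D Reg Q}
    (h : s.instrAt t i = some I) : i < s.len t :=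
  (List.getElem?_eq_some_iff.1 h).1

theorem instrAt_eq_none_iff {s : State D Reg Q n} {t : Fin n} {i : ℕ} :
    s.instrAt t i = none ↔ s.len t ≤ i :=
  List.getElem?_eq_none_iff

theorem cmdAt_of_instrAt {s : State D Reg Q n} {t : Fin n} {i : ℕ} {I : Instr D Reg Q}
    (h : s.instrAt t i = some I) : s.cmdAt t i = some I.cmd := by
  simp [cmdAt, h]

theorem instrAt_of_cmdAt {s : State D Reg Q n} {t : Fin n} {i : ℕ} {c : Cmd D Reg}
    (h : s.cmdAt t i = some c) : ∃ I, s.instrAt t i = some I ∧ I.cmd = c := by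
  simpa [cmdAt] using h

theorem lt_len_of_cmdAt {s : State D Reg Q n} {t : Fin n} {i : ℕ} {c : Cmd D Reg}
    (h : s.cmdAt t i = some c) : i < s.len t := by
  obtain ⟨I, hI, -⟩ := instrAt_of_cmdAt h
  exact lt_len_of_instrAt hI

theorem IsLoad.lt_len {s : State D Reg Q n} {t : Fin n} {i : ℕ} (h : s.IsLoad t i) :
    i < s.len t := lt_len_of_cmdAt h.choose_spec.1

theorem IsStore.lt_len {s : State D Reg Q n} {t : Fin n} {i : ℕ} (h : s.IsStore t i) :
    i < s.len t := lt_len_of_cmdAt h.choose_spec.1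

theorem IsAssume.lt_len {s : State D Reg Q n} {t : Fin n} {i : ℕ} (h : s.IsAssume t i) :
    i < s.len t := lt_len_of_cmdAt h.choose_spec.1

theorem IsLoad.not_isStore {s : State D Reg Q n} {t : Fin n} {i : ℕ} (h : s.IsLoad t i) :
    ¬ s.IsStore t i := by
  rintro ⟨c, hc, e, e', rfl⟩
  obtain ⟨c', hc', r, e'', rfl⟩ := h
  rw [hc] at hc'
  cases hc'

theorem IsAssume.not_isStore {s : State D Reg Q n} {t : Fin n} {i : ℕ} (h : s.IsAssume t i) :
    ¬ s.IsStore t i := by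
  rintro ⟨c, hc, e₁, e₂, rfl⟩
  obtain ⟨c', hc', e, rfl⟩ := h
  rw [hc] at hc'
  cases hc'

theorem isStore_of_instrAt {s : State D Reg Q n} {t : Fin n} {i : ℕ} {I : Instr D Reg Q}
    (h : s.instrAt t i = some I) : s.IsStore t i ↔ I.cmd.IsStore := by
  simp [IsStore, cmdAt_of_instrAt h]

theorem isLoad_of_instrAt {s : State D Reg Q n} {t : Fin n} {i : ℕ} {I : Instr D Reg Q}
    (h : s.instrAt t i = some I) : s.IsLoad t i ↔ I.cmd.IsLoad := by
  simp [IsLoad, cmdAt_of_instrAt h]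

section Args

variable [Zero D]

theorem argVal_eq_val_iff {s : State D Reg Q n} {t : Fin n} {i : ℕ} {o : Option (Expr D Reg)}
    {d : D} : s.argVal t i o = .val d ↔ ∃ e, o = some e ∧ s.EvalsTo t i e d := by
  cases o with
  | none => simp [argVal]
  | some e =>
    cases h : s.evaluate t i e with
    | none =>
      simp only [argVal, h, Option.some.injEq, reduceCtorEq, false_iff]
      rintro ⟨e', rfl, h'⟩
      rw [← evaluate_eq_some_iff, h] at h'
      cases h'
    | some d' =>
      simp only [argVal, h, Option.some.injEq, ArgVal.val.injEq]
      rw [evaluate_eq_some_iff] at h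
      constructor
      · rintro rfl
        exact ⟨e, rfl, h⟩
      · rintro ⟨e', rfl, h'⟩
        exact h.unique h'

theorem argVal_eq_top_iff {s : State D Reg Q n} {t : Fin n} {i : ℕ} {o : Option (Expr D Reg)} :
    s.argVal t i o = .top ↔ o = none := by
  cases o with
  | none => simp [argVal]
  | some e => cases h : s.evaluate t i e <;> simp [argVal, h]

theorem argVal_ne_bot_iff {s : State D Reg Q n} {t : Fin n} {i : ℕ} {o : Option (Expr D Reg)} :
    s.argVal t i o ≠ .bot ↔ ∀ e, o = some e → ∃ d, s.EvalsTo t i e d := by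
  constructor
  · rintro h e rfl
    cases h' : s.argVal t i (some e) with
    | bot => exact absurd h' h
    | top => simp [argVal_eq_top_iff] at h'
    | val d =>
      obtain ⟨e', he, hd⟩ := argVal_eq_val_iff.1 h'
      cases he
      exact ⟨d, hd⟩
  · intro h h'
    cases o with
    | none => simp [argVal] at h'
    | some e =>
      obtain ⟨d, hd⟩ := h e rfl
      have := argVal_eq_val_iff.2 ⟨e, rfl, hd⟩
      rw [this] at h'
      cases h'

theorem getAddr_eq_top_iff {s : State D Reg Q n} {t : Fin n} {i : ℕ} :
    s.getAddr t i = .top ↔ (s.cmdAt t i).bind Cmd.addrExpr = none :=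
  argVal_eq_top_iff

theorem IsStore.getAddr_ne_top {s : State D Reg Q n} {t : Fin n} {i : ℕ} (h : s.IsStore t i) :
    s.getAddr t i ≠ .top := by
  obtain ⟨c, hc, r, e, rfl⟩ := h
  simp [getAddr_eq_top_iff, hc, Cmd.addrExpr]

end Args

/-- Below the bounds `K`, `s` and `s'` have the same commands. -/
structure SameCmd (K : Fin n → ℕ) (s s' : State D Reg Q n) : Prop where
  cmd : ∀ t i, i < K t → s.cmdAt t i = s'.cmdAt t i

namespace SameCmd

variable {K : Fin n → ℕ} {s s' : State D Reg Q n}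

theorem definesAt_iff (h : SameCmd K s s') {t : Fin n} {i : ℕ} (hi : i < K t) (r : Reg) :
    s.DefinesAt t i r ↔ s'.DefinesAt t i r := by
  simp [DefinesAt, h.cmd t i hi]

theorem lastDef_iff (h : SameCmd K s s') {t : Fin n} {i : ℕ} (hi : i ≤ K t) (r : Reg) (j : ℕ) :
    s.LastDef t i r j ↔ s'.LastDef t i r j := by
  unfold LastDef
  refine and_congr_right fun hj => and_congr (h.definesAt_iff (by omega) r) ?_
  exact forall_congr' fun k => imp_congr_right fun _ => imp_congr_right fun hk =>
    not_congr (h.definesAt_iff (by omega) r)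

theorem dependsOn (h : SameCmd K s s') {t : Fin n} {i : ℕ} {e : Expr D Reg} {j : ℕ}
    (he : s.DependsOn t i e j) (hi : i ≤ K t) : s'.DependsOn t i e j := by
  induction he with
  | app i k f args m j _ ih => exact .app _ _ _ _ m _ (ih hi)
  | reg i r j hj => exact .reg _ _ _ ((h.lastDef_iff hi _ _).1 hj)
  | regAssign i r j e j' hj hc _ ih =>
    have := hj.1
    exact .regAssign _ _ j e _ ((h.lastDef_iff hi _ _).1 hj)
      (by rw [← h.cmd _ _ (by omega), hc]) (ih (by omega))

theorem dependsOn' (h : SameCmd K s s') {t : Fin n} {i : ℕ} {e : Expr D Reg} {j : ℕ}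
    (he : s'.DependsOn t i e j) (hi : i ≤ K t) : s.DependsOn t i e j := by
  induction he with
  | app i k f args m j _ ih => exact .app _ _ _ _ m _ (ih hi)
  | reg i r j hj => exact .reg _ _ _ ((h.lastDef_iff hi _ _).2 hj)
  | regAssign i r j e j' hj hc _ ih =>
    have := hj.1
    exact .regAssign _ _ j e _ ((h.lastDef_iff hi _ _).2 hj)
      (by rw [h.cmd _ _ (by omega), hc]) (ih (by omega))

theorem addrDeps_eq (h : SameCmd K s s') {t : Fin n} {i : ℕ} (hi : i < K t) :
    s.addrDeps t i = s'.addrDeps t i := by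
  unfold addrDeps
  rw [h.cmd t i hi]
  ext j
  exact exists_congr fun e => and_congr_right fun _ =>
    ⟨fun x => h.dependsOn x hi.le, fun x => h.dependsOn' x hi.le⟩

theorem dataDeps_eq (h : SameCmd K s s') {t : Fin n} {i : ℕ} (hi : i < K t) :
    s.dataDeps t i = s'.dataDeps t i := by
  unfold dataDeps
  rw [h.cmd t i hi]
  ext j
  exact exists_congr fun e => and_congr_right fun _ =>
    ⟨fun x => h.dependsOn x hi.le, fun x => h.dependsOn' x hi.le⟩

theorem isLoad_iff (h : SameCmd K s s') {t : Fin n} {i : ℕ} (hi : i < K t) :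
    s.IsLoad t i ↔ s'.IsLoad t i := by
  simp [IsLoad, h.cmd t i hi]

theorem isStore_iff (h : SameCmd K s s') {t : Fin n} {i : ℕ} (hi : i < K t) :
    s.IsStore t i ↔ s'.IsStore t i := by
  simp [IsStore, h.cmd t i hi]

theorem isAssume_iff (h : SameCmd K s s') {t : Fin n} {i : ℕ} (hi : i < K t) :
    s.IsAssume t i ↔ s'.IsAssume t i := by
  simp [IsAssume, h.cmd t i hi]

theorem ctrlDeps_eq (h : SameCmd K s s') {t : Fin n} {i : ℕ} (hi : i < K t) :
    s.ctrlDeps t i = s'.ctrlDeps t i := by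
  ext j
  exact and_congr_right fun hj => h.isAssume_iff (by omega)

end SameCmd

/-- Below the bounds `K`, which are closed under reading, `s` and `s'` have the same commands, and
the loads performed in `s` read from the same stores in `s'`. -/
structure Emb (K : Fin n → ℕ) (s s' : State D Reg Q n) : Prop extends SameCmd K s s' where
  ld : ∀ t i y, i < K t → (s.thr t).loaded i = some y → (s'.thr t).loaded i = some y
  bound : ∀ t i t' j, i < K t → (s.thr t).loaded i = some (.st t' j) → j < K t'

namespace Emb

variable {K : Fin n → ℕ} {s s' : State D Reg Q n}

/-- A value that has been computed stays the same when more loads have been performed. -/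
theorem evalsTo [Zero D] (h : Emb K s s') {t : Fin n} {i : ℕ} {e : Expr D Reg} {d : D}
    (he : s.EvalsTo t i e d) (hi : i ≤ K t) : s'.EvalsTo t i e d := by
  induction he with
  | const => exact .const _ _ _
  | app t i k f args vals _ ih => exact .app _ _ _ _ _ _ fun m => ih m hi
  | regInit t i r hr =>
    exact .regInit _ _ _ fun j hj => by
      rw [← h.definesAt_iff (by omega)]
      exact hr j hj
  | regAssign t i r j e d hj hc _ ih =>
    have := hj.1
    exact .regAssign _ _ _ j e _ ((h.lastDef_iff hi _ _).1 hj)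
      (by rw [← h.cmd _ _ (by omega), hc]) (ih (by omega))
  | regLoadInit t i r j e a hj hc hl =>
    have := hj.1
    exact .regLoadInit _ _ _ j e a ((h.lastDef_iff hi _ _).1 hj)
      (by rw [← h.cmd _ _ (by omega), hc]) (h.ld _ _ _ (by omega) hl)
  | regLoad t i r j e t' j' c' e' d hj hc hl hc' he' _ ih =>
    have := hj.1
    have hb := h.bound _ _ _ _ (by omega) hl
    exact .regLoad _ _ _ j e t' j' c' e' _ ((h.lastDef_iff hi _ _).1 hj)
      (by rw [← h.cmd _ _ (by omega), hc]) (h.ld _ _ _ (by omega) hl)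
      (by rw [← h.cmd _ _ hb, hc']) he' (ih hb.le)

theorem argVal_eq [Zero D] (h : Emb K s s') {t : Fin n} {i : ℕ} (hi : i < K t)
    {o : Option (Expr D Reg)} (hb : s.argVal t i o ≠ .bot) : s'.argVal t i o = s.argVal t i o := by
  cases o with
  | none => rfl
  | some e =>
    obtain ⟨d, hd⟩ := argVal_ne_bot_iff.1 hb e rfl
    rw [argVal_eq_val_iff.2 ⟨e, rfl, hd⟩, argVal_eq_val_iff.2 ⟨e, rfl, h.evalsTo hd hi.le⟩]

theorem getAddr_eq [Zero D] (h : Emb K s s') {t : Fin n} {i : ℕ} (hi : i < K t)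
    (hb : s.getAddr t i ≠ .bot) : s'.getAddr t i = s.getAddr t i := by
  unfold getAddr at hb ⊢
  rw [← h.cmd t i hi]
  exact h.argVal_eq hi hb

theorem getValue_eq [Zero D] (h : Emb K s s') {t : Fin n} {i : ℕ} (hi : i < K t)
    (hb : s.getValue t i ≠ .bot) : s'.getValue t i = s.getValue t i := by
  unfold getValue at hb ⊢
  rw [← h.cmd t i hi]
  exact h.argVal_eq hi hb

end Emb

theorem DependsOn.lt {s : State D Reg Q n} {t : Fin n} {i : ℕ} {e : Expr D Reg} {j : ℕ}
    (h : s.DependsOn t i e j) : j < i := by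
  induction h with
  | app _ _ _ _ _ _ _ ih => exact ih
  | reg _ _ _ hj => exact hj.1
  | regAssign _ _ _ _ _ hj _ _ ih => exact ih.trans hj.1

theorem lt_of_mem_addrDeps {s : State D Reg Q n} {t : Fin n} {i j : ℕ} (h : j ∈ s.addrDeps t i) :
    j < i := by
  obtain ⟨e, -, h⟩ := h
  exact h.lt

theorem lt_of_mem_dataDeps {s : State D Reg Q n} {t : Fin n} {i j : ℕ} (h : j ∈ s.dataDeps t i) :
    j < i := by
  obtain ⟨e, -, h⟩ := h
  exact h.lt

/-- Below an evaluated expression all loads have been performed. -/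
theorem EvalsTo.loaded_ne_none [Zero D] {s : State D Reg Q n} {t : Fin n} {i : ℕ} {e : Expr D Reg}
    {d : D} (h : s.EvalsTo t i e d) {j : ℕ} (hj : s.DependsOn t i e j) (hl : s.IsLoad t j) :
    (s.thr t).loaded j ≠ none := by
  induction h generalizing j with
  | const => cases hj
  | app t i k f args vals _ ih =>
    cases hj with
    | app _ _ _ _ m _ h => exact ih m h hl
  | regInit t i r h =>
    cases hj with
    | reg _ _ _ hj => exact absurd hj.2.1 (h _ hj.1)
    | regAssign _ _ _ _ _ hj => exact absurd hj.2.1 (h _ hj.1)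
  | regAssign t i r j e d hj' hc _ ih =>
    cases hj with
    | reg _ _ _ hj =>
      cases hj.unique hj'
      obtain ⟨c, hc', r, e', rfl⟩ := hl
      rw [hc] at hc'
      cases hc'
    | regAssign _ _ _ _ _ hj hc' h =>
      cases hj.unique hj'
      rw [hc] at hc'
      cases hc'
      exact ih h hl
  | regLoadInit t i r j e a hj' hc hl' =>
    cases hj with
    | reg _ _ _ hj =>
      cases hj.unique hj'
      simp [hl']
    | regAssign _ _ _ _ _ hj hc' h =>
      cases hj.unique hj'
      rw [hc] at hc'
      cases hc'
  | regLoad t i r j e t' j' c' e' d hj' hc hl' =>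
    cases hj with
    | reg _ _ _ hj =>
      cases hj.unique hj'
      simp [hl']
    | regAssign _ _ _ _ _ hj hc' h =>
      cases hj.unique hj'
      rw [hc] at hc'
      cases hc'

/-- The stores read by the performed loads have a defined value. -/
def SourcesDefined [Zero D] (s : State D Reg Q n) : Prop :=
  ∀ t i t' j, (s.thr t).loaded i = some (.st t' j) →
    ∃ c e d, s.cmdAt t' j = some c ∧ c.valueExpr = some e ∧ s.EvalsTo t' j e d

/-- An expression has a value as soon as the loads it depends on have been performed. -/
theorem SourcesDefined.exists_evalsTo [Zero D] {s : State D Reg Q n} (hs : s.SourcesDefined)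
    {t : Fin n} {i : ℕ} {e : Expr D Reg}
    (h : ∀ j, s.DependsOn t i e j → s.IsLoad t j → (s.thr t).loaded j ≠ none) :
    ∃ d, s.EvalsTo t i e d := by
  induction i using Nat.strong_induction_on generalizing e with
  | _ i IH =>
  induction e with
  | const d => exact ⟨d, .const _ _ _⟩
  | app k f args ih =>
    choose vals hv using fun m => ih m fun j hj hl => h j (.app _ _ _ _ m _ hj) hl
    exact ⟨_, .app _ _ _ _ _ _ hv⟩
  | reg r =>
    by_cases hr : ∀ j, j < i → ¬ s.DefinesAt t j r
    · exact ⟨0, .regInit _ _ _ hr⟩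
    push Not at hr
    obtain ⟨j, hj⟩ : ∃ j, s.LastDef t i r j := by
      classical
      obtain ⟨j, hj, hjr⟩ := hr
      have hne : ((Finset.range i).filter fun j => s.DefinesAt t j r).Nonempty :=
        ⟨j, by simp [hj, hjr]⟩
      have hm := Finset.max'_mem _ hne
      simp only [Finset.mem_filter, Finset.mem_range] at hm
      refine ⟨_, hm.1, hm.2, fun k hk hki hkr => ?_⟩
      have := Finset.le_max' _ k (show k ∈ (Finset.range i).filter fun j => s.DefinesAt t j r by
        simp [hki, hkr])
      omega
    obtain ⟨c, hc, hcr⟩ := hj.2.1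
    rcases hcr with ⟨e, rfl⟩ | ⟨e, rfl⟩
    · have hl := h j (.reg _ _ _ hj) ⟨_, hc, r, e, rfl⟩
      obtain ⟨y, hy⟩ := Option.ne_none_iff_exists'.1 hl
      cases y with
      | init a => exact ⟨0, .regLoadInit _ _ _ j e a hj hc hy⟩
      | st t' j' =>
        obtain ⟨c', e', d, hc', he', hd⟩ := hs _ _ _ _ hy
        exact ⟨d, .regLoad _ _ _ j e t' j' c' e' d hj hc hy hc' he' hd⟩
    · obtain ⟨d, hd⟩ := IH j hj.1 fun k hk hl => h k (.regAssign _ _ j e _ hj hc hk) hl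
      exact ⟨d, .regAssign _ _ _ j e d hj hc hd⟩

end State

end Semantics

/-! ### The invariant of runs -/

section Semantics

variable {D : Type u} {Reg : Type v} {Q : Type w} {n : ℕ}

namespace State

/-- `s` is a partial version of `g`: what has been fetched, loaded, committed and assigned a key in
`s` is the same in `g`. -/
structure Le (s g : State D Reg Q n) : Prop where
  instr : ∀ t i I, s.instrAt t i = some I → g.instrAt t i = some I
  ld : ∀ t i y, (s.thr t).loaded i = some y → (g.thr t).loaded i = some y
  com : ∀ t i, i ∈ (s.thr t).committed → i ∈ (g.thr t).committed
  co : ∀ t i, i ∈ (s.thr t).committed → g.co (.st t i) = s.co (.st t i)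
  co_init : ∀ a, g.co (.init a) = s.co (.init a)

theorem Le.refl (s : State D Reg Q n) : Le s s :=
  ⟨fun _ _ _ h => h, fun _ _ _ h => h, fun _ _ h => h, fun _ _ _ => rfl, fun _ => rfl⟩

theorem Le.trans {s₁ s₂ s₃ : State D Reg Q n} (h : Le s₁ s₂) (h' : Le s₂ s₃) : Le s₁ s₃ :=
  ⟨fun _ _ _ x => h'.instr _ _ _ (h.instr _ _ _ x), fun _ _ _ x => h'.ld _ _ _ (h.ld _ _ _ x),
    fun _ _ x => h'.com _ _ (h.com _ _ x),
    fun _ _ x => (h'.co _ _ (h.com _ _ x)).trans (h.co _ _ x),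
    fun a => (h'.co_init a).trans (h.co_init a)⟩

theorem Le.len_le {s g : State D Reg Q n} (h : Le s g) (t : Fin n) : s.len t ≤ g.len t := by
  by_contra hlt
  obtain ⟨I, hI⟩ := instrAt_eq_some_of_lt (not_le.1 hlt)
  exact absurd (lt_len_of_instrAt (h.instr _ _ _ hI)) (lt_irrefl _)

theorem Le.cmdAt {s g : State D Reg Q n} (h : Le s g) {t : Fin n} {i : ℕ} (hi : i < s.len t) :
    s.cmdAt t i = g.cmdAt t i := by
  obtain ⟨I, hI⟩ := instrAt_eq_some_of_lt hi
  rw [cmdAt_of_instrAt hI, cmdAt_of_instrAt (h.instr _ _ _ hI)]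

theorem Le.isLoad {s g : State D Reg Q n} (hle : Le s g) {t : Fin n} {i : ℕ} (h : s.IsLoad t i) :
    g.IsLoad t i := by
  obtain ⟨c, hc, h'⟩ := h
  exact ⟨c, by rw [← hle.cmdAt (lt_len_of_cmdAt hc), hc], h'⟩

theorem Le.isStore {s g : State D Reg Q n} (hle : Le s g) {t : Fin n} {i : ℕ} (h : s.IsStore t i) :
    g.IsStore t i := by
  obtain ⟨c, hc, h'⟩ := h
  exact ⟨c, by rw [← hle.cmdAt (lt_len_of_cmdAt hc), hc], h'⟩

variable [Zero D]

/-- The store `y` is the initial store to `a` or a store to `a` that has been propagated to thread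
`t` by the actions in `S`, and no store to `a` propagated to `t` has a greater key.  Keys of
propagated stores are positive, so if `y` is the initial store then there are no such stores. -/
structure IsLast (g : State D Reg Q n) (S : Set (Action n)) (t : Fin n) (a : D)
    (y : StoreId D n) : Prop where
  mem : y = .init a ∨
    ∃ t' i, y = .st t' i ∧ .prop t t' i ∈ S ∧ g.getAddr t' i = .val a
  max : ∀ t' i, .prop t t' i ∈ S → g.getAddr t' i = .val a → g.co (.st t' i) ≤ g.co y

/-- The path condition on the sequences of fetched instructions. -/
def FollowsPaths (P : Program D Reg Q n) (s : State D Reg Q n) : Prop :=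
  ∀ t i I, s.instrAt t i = some I → I ∈ (P t).instrs ∧
    I.src = ((((s.thr t).fetched.take i).getLast?).map Instr.dst).getD (P t).init

/-- The invariant of a run that has performed the actions in `S` and arrived in the state `s`. -/
structure Inv (P : Program D Reg Q n) (S : Set (Action n)) (s : State D Reg Q n) : Prop where
  mem_fetch : ∀ t i, .fetch t i ∈ S ↔ i < s.len t
  mem_commit : ∀ t i, .commit t i ∈ S ↔ i ∈ (s.thr t).committed
  mem_load : ∀ t i, .load t i ∈ S ↔ (s.thr t).loaded i ≠ none
  paths : s.FollowsPaths P
  ld : ∀ t i y, (s.thr t).loaded i = some y → s.IsLoad t i ∧ ∃ a, s.getAddr t i = .val a ∧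
    (y = .init a ∨ ∃ t' j, y = .st t' j ∧ s.IsStore t' j ∧ s.getAddr t' j = .val a ∧
      s.getValue t' j ≠ .bot)
  com_lt : ∀ t i, i ∈ (s.thr t).committed → i < s.len t
  com_addr : ∀ t i, i ∈ (s.thr t).committed → s.getAddr t i ≠ .bot
  com_val : ∀ t i, i ∈ (s.thr t).committed → s.getValue t i ≠ .bot
  com_ld : ∀ t i, i ∈ (s.thr t).committed → s.IsLoad t i → (s.thr t).loaded i ≠ none
  com_assume : ∀ t i, i ∈ (s.thr t).committed → s.IsAssume t i → s.getValue t i ≠ .val 0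
  co_init : ∀ a, s.co (.init a) = 0
  co_zero : ∀ t i, (i ∉ (s.thr t).committed ∨ ¬ s.IsStore t i) → s.co (.st t i) = 0
  co_ne : ∀ t i, i ∈ (s.thr t).committed → s.IsStore t i → s.co (.st t i) ≠ 0
  co_inj : ∀ t i t' i', i ∈ (s.thr t).committed → s.IsStore t i → i' ∈ (s.thr t').committed →
    s.IsStore t' i' → s.co (.st t i) = s.co (.st t' i') → t = t' ∧ i = i'
  prop_mem : ∀ t t' i, .prop t t' i ∈ S → s.IsStore t' i ∧ i ∈ (s.thr t').committed ∧
    (∃ a, s.getAddr t' i = .val a) ∧ 0 < s.co (.st t' i)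
  prop_last : ∀ t a, s.IsLast S t a (s.prop t a)

theorem inv_initial (P : Program D Reg Q n) : Inv P ∅ (initial : State D Reg Q n) where
  mem_fetch := by simp [initial, len]
  mem_commit := by simp [initial]
  mem_load := by simp [initial]
  paths := by simp [initial, FollowsPaths, instrAt]
  ld := by simp [initial]
  com_lt := by simp [initial]
  com_addr := by simp [initial]
  com_val := by simp [initial]
  com_ld := by simp [initial]
  com_assume := by simp [initial]
  co_init := by simp [initial]
  co_zero := by simp [initial]
  co_ne := by simp [initial]
  co_inj := by simp [initial]
  prop_mem := by simp
  prop_last t a := ⟨Or.inl rfl, by simp⟩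

namespace Inv

variable {P : Program D Reg Q n} {S : Set (Action n)} {s g : State D Reg Q n}

theorem ld_lt (h : Inv P S s) {t : Fin n} {i : ℕ} {t' : Fin n} {j : ℕ}
    (hl : (s.thr t).loaded i = some (.st t' j)) : j < s.len t' := by
  obtain ⟨-, a, -, h | ⟨t₁, j₁, h, hst, -⟩⟩ := h.ld _ _ _ hl
  · cases h
  · cases h
    exact hst.lt_len

theorem sourcesDefined (h : Inv P S s) : s.SourcesDefined := by
  intro t i t' j hl
  obtain ⟨-, a, -, h | ⟨t₁, j₁, h, hst, -, hv⟩⟩ := h.ld _ _ _ hl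
  · cases h
  · cases h
    obtain ⟨c, hc, e, e', rfl⟩ := hst
    have hce : ((s.cmdAt t' j).bind Cmd.valueExpr) = some e' := by simp [hc, Cmd.valueExpr]
    obtain ⟨d, hd⟩ := argVal_ne_bot_iff.1 hv e' hce
    exact ⟨_, e', d, hc, rfl, hd⟩

theorem emb (h : Inv P S s) (hle : Le s g) : Emb s.len s g where
  cmd _ _ hi := hle.cmdAt hi
  ld _ _ _ _ hl := hle.ld _ _ _ hl
  bound _ _ _ _ _ hl := h.ld_lt hl

theorem getAddr_eq_val (h : Inv P S s) (hle : Le s g) {t : Fin n} {i : ℕ} {a : D}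
    (ha : s.getAddr t i = .val a) : g.getAddr t i = .val a := by
  have hi : i < s.len t := by
    obtain ⟨e, he, -⟩ := argVal_eq_val_iff.1 ha
    obtain ⟨c, hc, -⟩ := Option.bind_eq_some_iff.1 he
    exact lt_len_of_cmdAt hc
  rw [← ha]
  exact (h.emb hle).getAddr_eq hi (by simp [ha])

theorem isStore_iff (h : Inv P S s) (hle : Le s g) {t : Fin n} {i : ℕ} (hi : i < s.len t) :
    s.IsStore t i ↔ g.IsStore t i :=
  (h.emb hle).isStore_iff hi

/-- The store that is visible to a thread does not depend on the state in which keys and addresses are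
taken: later states agree with `s` on the propagated stores. -/
theorem isLast_mono (h : Inv P S s) (hle : Le s g) {t : Fin n} {a : D} {y : StoreId D n}
    (hy : s.IsLast S t a y) : g.IsLast S t a y := by
  have hco : g.co y = s.co y := by
    rcases hy.mem with rfl | ⟨t', i, rfl, hm, -⟩
    · exact hle.co_init a
    · exact hle.co _ _ (h.prop_mem _ _ _ hm).2.1
  constructor
  · rcases hy.mem with rfl | ⟨t', i, rfl, hm, ha⟩
    · exact Or.inl rfl
    · exact Or.inr ⟨t', i, rfl, hm, h.getAddr_eq_val hle ha⟩
  · intro t' i hm ha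
    obtain ⟨hst, hc, ⟨a', ha'⟩, -⟩ := h.prop_mem _ _ _ hm
    have := h.getAddr_eq_val hle ha'
    rw [ha] at this
    cases this
    rw [hle.co _ _ hc, hco]
    exact hy.max _ _ hm ha'

end Inv

end State

open State

variable [Zero D]

/-- Transitions only add information. -/
theorem Trans.le {P : Program D Reg Q n} {s s' : State D Reg Q n} {e : Event D Reg Q n}
    (h : Trans P s e s') : Le s s' := by
  cases h with
  | fetch t I hI hsrc =>
    refine ⟨fun t' i J hJ => ?_, fun t' i y hy => ?_, fun t' i hi => ?_, fun _ _ _ => rfl,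
      fun _ => rfl⟩
    · by_cases ht : t' = t
      · subst ht
        have := lt_len_of_instrAt hJ
        simp only [instrAt, addFetched, setThr, Function.update_self] at hJ ⊢
        rw [List.getElem?_append_left this, hJ]
      · simpa [instrAt, addFetched, setThr, ht] using hJ
    all_goals by_cases ht : t' = t
    all_goals first | subst ht | skip
    all_goals simp_all [addFetched, setThr]
  | load t i a hload hnone ha =>
    refine ⟨fun t' i J hJ => ?_, fun t' i' y hy => ?_, fun t' i hi => ?_, fun _ _ _ => rfl,
      fun _ => rfl⟩
    · by_cases ht : t' = t
      · subst ht
        simpa [instrAt, setLoaded, setThr] using hJ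
      · simpa [instrAt, setLoaded, setThr, ht] using hJ
    · by_cases ht : t' = t
      · subst ht
        by_cases hi : i' = i
        · subst hi
          simp [hnone] at hy
        · simpa [setLoaded, setThr, hi] using hy
      · simpa [setLoaded, setThr, ht] using hy
    · by_cases ht : t' = t
      · subst ht
        simpa [setLoaded, setThr] using hi
      · simpa [setLoaded, setThr, ht] using hi
  | early t i a i' hload hnone ha hlt hst hmax ha' hv hc =>
    refine ⟨fun t' i J hJ => ?_, fun t' i' y hy => ?_, fun t' i hi => ?_, fun _ _ _ => rfl,
      fun _ => rfl⟩
    · by_cases ht : t' = t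
      · subst ht
        simpa [instrAt, setLoaded, setThr] using hJ
      · simpa [instrAt, setLoaded, setThr, ht] using hJ
    · by_cases ht : t' = t
      · subst ht
        by_cases hi : i' = i
        · subst hi
          simp [hnone] at hy
        · simpa [setLoaded, setThr, hi] using hy
      · simpa [setLoaded, setThr, ht] using hy
    · by_cases ht : t' = t
      · subst ht
        simpa [setLoaded, setThr] using hi
      · simpa [setLoaded, setThr, ht] using hi
  | commit t i hcan hst =>
    refine ⟨fun t' i J hJ => ?_, fun t' i' y hy => ?_, fun t' i hi => ?_, fun _ _ _ => rfl,
      fun _ => rfl⟩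
    all_goals by_cases ht : t' = t
    all_goals first | subst ht | skip
    all_goals simp_all [addCommitted, setThr, instrAt]
  | commitStore t i key a hcan hst ha hkey =>
    refine ⟨fun t' i J hJ => ?_, fun t' i' y hy => ?_, fun t' i hi => ?_, fun t' i' hi => ?_,
      fun _ => ?_⟩
    · by_cases ht : t' = t
      · subst ht
        simpa [instrAt, addCommitted, setThr, setCo] using hJ
      · simpa [instrAt, addCommitted, setThr, setCo, ht] using hJ
    · by_cases ht : t' = t
      · subst ht
        simpa [addCommitted, setThr, setCo] using hy
      · simpa [addCommitted, setThr, setCo, ht] using hy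
    · by_cases ht : t' = t
      · subst ht
        simp [addCommitted, setThr, setCo, hi]
      · simpa [addCommitted, setThr, setCo, ht] using hi
    · have hne : StoreId.st t' i' ≠ StoreId.st (D := D) t i := by
        rintro ⟨⟩
        exact hcan.not_committed hi
      simp [setCo, hne, addCommitted, setThr]
    · simp [setCo, addCommitted, setThr]
  | propagate t t' i' a hst hcom ha hlt =>
    exact ⟨fun _ _ _ h => h, fun _ _ _ h => h, fun _ _ h => h, fun _ _ _ => rfl, fun _ => rfl⟩

/-- An invariant state extended by loads, commits, keys and fetched instructions satisfies the
invariant if what is new does. -/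
theorem State.Inv.extend {P : Program D Reg Q n} {S S' : Set (Action n)} {s s' : State D Reg Q n}
    (h : Inv P S s) (hle : Le s s') (hprop : ∀ t t' i, .prop t t' i ∈ S' ↔ .prop t t' i ∈ S)
    (hprop' : s'.prop = s.prop)
    (mem_fetch : ∀ t i, .fetch t i ∈ S' ↔ i < s'.len t)
    (mem_commit : ∀ t i, .commit t i ∈ S' ↔ i ∈ (s'.thr t).committed)
    (mem_load : ∀ t i, .load t i ∈ S' ↔ (s'.thr t).loaded i ≠ none)
    (paths : s'.FollowsPaths P)
    (ld : ∀ t i y, (s.thr t).loaded i = none → (s'.thr t).loaded i = some y →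
      s.IsLoad t i ∧ ∃ a, s.getAddr t i = .val a ∧
      (y = .init a ∨ ∃ t' j, y = .st t' j ∧ s.IsStore t' j ∧ s.getAddr t' j = .val a ∧
      s.getValue t' j ≠ .bot))
    (com : ∀ t i, i ∉ (s.thr t).committed → i ∈ (s'.thr t).committed → s.CanCommit t i)
    (co_zero : ∀ t i, (i ∉ (s'.thr t).committed ∨ ¬ s'.IsStore t i) → s'.co (.st t i) = 0)
    (co_ne : ∀ t i, i ∈ (s'.thr t).committed → s'.IsStore t i → s'.co (.st t i) ≠ 0)
    (co_inj : ∀ t i t' i', i ∈ (s'.thr t).committed → s'.IsStore t i →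
      i' ∈ (s'.thr t').committed →
      s'.IsStore t' i' → s'.co (.st t i) = s'.co (.st t' i') → t = t' ∧ i = i') :
    Inv P S' s' := by
  have hemb := h.emb hle
  have hcl : ∀ t i, i ∈ (s'.thr t).committed → i < s.len t := fun t i hi => by
    by_cases hc : i ∈ (s.thr t).committed
    · exact h.com_lt _ _ hc
    · exact (com _ _ hc hi).fetched
  have haddr : ∀ t i, i ∈ (s'.thr t).committed → s.getAddr t i ≠ .bot := fun t i hi => by
    by_cases hc : i ∈ (s.thr t).committed
    · exact h.com_addr _ _ hc
    · exact (com _ _ hc hi).addr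
  have hval : ∀ t i, i ∈ (s'.thr t).committed → s.getValue t i ≠ .bot := fun t i hi => by
    by_cases hc : i ∈ (s.thr t).committed
    · exact h.com_val _ _ hc
    · exact (com _ _ hc hi).value
  refine ⟨mem_fetch, mem_commit, mem_load, paths, ?_, ?_, ?_, ?_, ?_, ?_, ?_, co_zero, co_ne,
    co_inj, ?_, ?_⟩
  · intro t i y hy
    obtain ⟨hl, a, ha, hc⟩ : s.IsLoad t i ∧ ∃ a, s.getAddr t i = .val a ∧
        (y = .init a ∨ ∃ t' j, y = .st t' j ∧ s.IsStore t' j ∧ s.getAddr t' j = .val a ∧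
        s.getValue t' j ≠ .bot) := by
      cases hs : (s.thr t).loaded i with
      | none => exact ld _ _ _ hs hy
      | some y' =>
        have := hle.ld _ _ _ hs
        rw [hy] at this
        cases this
        exact h.ld _ _ _ hs
    refine ⟨hle.isLoad hl, a, h.getAddr_eq_val hle ha, ?_⟩
    rcases hc with rfl | ⟨t', j, rfl, hst, haj, hv⟩
    · exact Or.inl rfl
    · refine Or.inr ⟨t', j, rfl, hle.isStore hst, h.getAddr_eq_val hle haj, ?_⟩
      rwa [hemb.getValue_eq hst.lt_len hv]
  · exact fun t i hi => (hcl t i hi).trans_le (hle.len_le t)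
  · intro t i hi
    rw [hemb.getAddr_eq (hcl t i hi) (haddr t i hi)]
    exact haddr t i hi
  · intro t i hi
    rw [hemb.getValue_eq (hcl t i hi) (hval t i hi)]
    exact hval t i hi
  · intro t i hi hl
    rw [← hemb.isLoad_iff (hcl t i hi)] at hl
    have : (s.thr t).loaded i ≠ none := by
      by_cases hc : i ∈ (s.thr t).committed
      · exact h.com_ld _ _ hc hl
      · exact (com _ _ hc hi).load hl
    obtain ⟨y, hy⟩ := Option.ne_none_iff_exists'.1 this
    simp [hle.ld _ _ _ hy]
  · intro t i hi hl
    rw [← hemb.isAssume_iff (hcl t i hi)] at hl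
    rw [hemb.getValue_eq (hcl t i hi) (hval t i hi)]
    by_cases hc : i ∈ (s.thr t).committed
    · exact h.com_assume _ _ hc hl
    · exact (com _ _ hc hi).assume hl
  · exact fun a => (hle.co_init a).trans (h.co_init a)
  · intro t t' i hm
    obtain ⟨hst, hc, ⟨a, ha⟩, hpos⟩ := h.prop_mem _ _ _ ((hprop _ _ _).1 hm)
    refine ⟨hle.isStore hst, hle.com _ _ hc, ⟨a, h.getAddr_eq_val hle ha⟩, ?_⟩
    rwa [hle.co _ _ hc]
  · intro t a
    have := h.isLast_mono hle (h.prop_last t a)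
    rw [hprop']
    refine ⟨?_, fun t' i hm ha => this.max t' i ((hprop _ _ _).1 hm) ha⟩
    rcases this.mem with hy | ⟨t', i, hy, hm, ha⟩
    · exact Or.inl hy
    · exact Or.inr ⟨t', i, hy, (hprop _ _ _).2 hm, ha⟩

end Semantics

/-! ### Transitions preserve the invariant -/

section Semantics

variable {D : Type u} {Reg : Type v} {Q : Type w} {n : ℕ}

open State

namespace State

section Updates

variable {s : State D Reg Q n} {t : Fin n} {i : ℕ}

@[simp] theorem len_addFetched (I : Instr D Reg Q) (t' : Fin n) :
    (s.addFetched t I).len t' = if t' = t then s.len t + 1 else s.len t' := by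
  by_cases h : t' = t
  · subst h
    simp [len, addFetched, setThr]
  · simp [len, addFetched, setThr, h]

@[simp] theorem committed_addFetched (I : Instr D Reg Q) (t' : Fin n) :
    ((s.addFetched t I).thr t').committed = (s.thr t').committed := by
  by_cases h : t' = t
  · subst h
    simp [addFetched, setThr]
  · simp [addFetched, setThr, h]

@[simp] theorem loaded_addFetched (I : Instr D Reg Q) (t' : Fin n) :
    ((s.addFetched t I).thr t').loaded = (s.thr t').loaded := by
  by_cases h : t' = t
  · subst h
    simp [addFetched, setThr]
  · simp [addFetched, setThr, h]

@[simp] theorem fetched_setLoaded (y : StoreId D n) (t' : Fin n) :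
    ((s.setLoaded t i y).thr t').fetched = (s.thr t').fetched := by
  by_cases h : t' = t
  · subst h
    simp [setLoaded, setThr]
  · simp [setLoaded, setThr, h]

@[simp] theorem committed_setLoaded (y : StoreId D n) (t' : Fin n) :
    ((s.setLoaded t i y).thr t').committed = (s.thr t').committed := by
  by_cases h : t' = t
  · subst h
    simp [setLoaded, setThr]
  · simp [setLoaded, setThr, h]

@[simp] theorem loaded_setLoaded (y : StoreId D n) (t' : Fin n) (i' : ℕ) :
    ((s.setLoaded t i y).thr t').loaded i' =
      if t' = t ∧ i' = i then some y else (s.thr t').loaded i' := by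
  by_cases h : t' = t
  · subst h
    simp [setLoaded, setThr, Function.update_apply]
  · simp [setLoaded, setThr, h]

@[simp] theorem co_setLoaded (y : StoreId D n) : (s.setLoaded t i y).co = s.co := rfl

@[simp] theorem fetched_addCommitted (t' : Fin n) :
    ((s.addCommitted t i).thr t').fetched = (s.thr t').fetched := by
  by_cases h : t' = t
  · subst h
    simp [addCommitted, setThr]
  · simp [addCommitted, setThr, h]

@[simp] theorem mem_committed_addCommitted (t' : Fin n) (i' : ℕ) :
    i' ∈ ((s.addCommitted t i).thr t').committed ↔
      (t' = t ∧ i' = i) ∨ i' ∈ (s.thr t').committed := by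
  by_cases h : t' = t
  · subst h
    simp [addCommitted, setThr]
  · simp [addCommitted, setThr, h]

@[simp] theorem loaded_addCommitted (t' : Fin n) :
    ((s.addCommitted t i).thr t').loaded = (s.thr t').loaded := by
  by_cases h : t' = t
  · subst h
    simp [addCommitted, setThr]
  · simp [addCommitted, setThr, h]

@[simp] theorem co_addCommitted : (s.addCommitted t i).co = s.co := rfl

@[simp] theorem thr_setCo (y : StoreId D n) (k : ℚ) : (s.setCo y k).thr = s.thr := rfl

open Classical in
theorem co_setCo (y z : StoreId D n) (k : ℚ) :
    (s.setCo y k).co z = if z = y then k else s.co z := by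
  simp [setCo, Function.update_apply]

@[simp] theorem co_setCo_st (t' : Fin n) (i' : ℕ) (k : ℚ) :
    (s.setCo (.st t i) k).co (.st t' i') = if t' = t ∧ i' = i then k else s.co (.st t' i') := by
  rw [co_setCo]
  by_cases h : t' = t ∧ i' = i
  · simp [h]
  · rw [if_neg h, if_neg]
    rintro ⟨⟩
    exact h ⟨rfl, rfl⟩

theorem setProp_prop_self (a : D) (y : StoreId D n) : (s.setProp t a y).prop t a = y := by
  simp [setProp]

theorem setProp_prop_ne {t' : Fin n} {a a' : D} {y : StoreId D n} (h : ¬ (t' = t ∧ a' = a)) :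
    (s.setProp t a y).prop t' a' = s.prop t' a' := by
  by_cases ht : t' = t
  · subst ht
    have : a' ≠ a := by simpa using h
    simp [setProp, this]
  · simp [setProp, ht]

theorem isStore_congr {s' : State D Reg Q n} (h : (s'.thr t).fetched = (s.thr t).fetched) :
    s'.IsStore t i ↔ s.IsStore t i := by
  simp [IsStore, cmdAt, instrAt, h]

theorem len_congr {s' : State D Reg Q n} (h : (s'.thr t).fetched = (s.thr t).fetched) :
    s'.len t = s.len t := by
  simp [len, h]

end Updates

section Congr

variable [Zero D] {s s' : State D Reg Q n}

theorem EvalsTo.congr (h : s'.thr = s.thr) {t : Fin n} {i : ℕ} {e : Expr D Reg} {d : D}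
    (he : s.EvalsTo t i e d) : s'.EvalsTo t i e d := by
  obtain ⟨thr, co, prop⟩ := s
  obtain ⟨thr', co', prop'⟩ := s'
  cases h
  induction he with
  | const => exact .const _ _ _
  | app t i k f args vals _ ih => exact .app _ _ _ _ _ _ ih
  | regInit t i r hr => exact .regInit _ _ _ hr
  | regAssign t i r j e d hj hc _ ih => exact .regAssign _ _ _ j e _ hj hc ih
  | regLoadInit t i r j e a hj hc hl => exact .regLoadInit _ _ _ j e a hj hc hl
  | regLoad t i r j e t' j' c' e' d hj hc hl hc' he' _ ih =>
    exact .regLoad _ _ _ j e t' j' c' e' _ hj hc hl hc' he' ih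

theorem argVal_congr (h : s'.thr = s.thr) (t : Fin n) (i : ℕ) (o : Option (Expr D Reg)) :
    s'.argVal t i o = s.argVal t i o := by
  cases o with
  | none => rfl
  | some e =>
    have : s'.evaluate t i e = s.evaluate t i e := Option.ext fun d => by
      rw [evaluate_eq_some_iff, evaluate_eq_some_iff]
      exact ⟨EvalsTo.congr h.symm, EvalsTo.congr h⟩
    simp [argVal, this]

theorem getAddr_congr (h : s'.thr = s.thr) (t : Fin n) (i : ℕ) :
    s'.getAddr t i = s.getAddr t i := by
  have : s'.cmdAt t i = s.cmdAt t i := by simp [cmdAt, instrAt, h]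
  rw [getAddr, this]
  exact argVal_congr h t i _

theorem getValue_congr (h : s'.thr = s.thr) (t : Fin n) (i : ℕ) :
    s'.getValue t i = s.getValue t i := by
  have : s'.cmdAt t i = s.cmdAt t i := by simp [cmdAt, instrAt, h]
  rw [getValue, this]
  exact argVal_congr h t i _

end Congr

theorem Le.setLoaded {s g : State D Reg Q n} (hle : Le s g) {t : Fin n} {i : ℕ} {y : StoreId D n}
    (hy : (g.thr t).loaded i = some y) : Le (s.setLoaded t i y) g := by
  refine ⟨fun t' i' I hI => hle.instr _ _ _ (by simpa [instrAt] using hI), fun t' i' y' hy' => ?_,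
    fun t' i' hi' => hle.com _ _ (by simpa using hi'),
    fun t' i' hi' => hle.co _ _ (by simpa using hi'), hle.co_init⟩
  rw [loaded_setLoaded] at hy'
  split_ifs at hy' with hi
  · rw [hi.1, hi.2, hy, hy']
  · exact hle.ld _ _ _ hy'

theorem FollowsPaths.congr {P : Program D Reg Q n} {s s' : State D Reg Q n}
    (h : s.FollowsPaths P)
    (hf : ∀ t, (s'.thr t).fetched = (s.thr t).fetched) : s'.FollowsPaths P := by
  simpa [FollowsPaths, instrAt, hf] using h

variable [Zero D] {P : Program D Reg Q n} {S : Set (Action n)} {s s' : State D Reg Q n}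

theorem Inv.co_prop_nonneg (h : Inv P S s) (t : Fin n) (a : D) : 0 ≤ s.co (s.prop t a) := by
  rcases (h.prop_last t a).mem with hy | ⟨t', i, hy, hm, -⟩
  · rw [hy, h.co_init]
  · rw [hy]
    exact (h.prop_mem _ _ _ hm).2.2.2.le

theorem Inv.step_load (h : Inv P S s) {t : Fin n} {i : ℕ} {a : D} {y : StoreId D n}
    (hle : Le s (s.setLoaded t i y)) (hl : s.IsLoad t i) (ha : s.getAddr t i = .val a)
    (hy : y = .init a ∨ ∃ t' j, y = .st t' j ∧ s.IsStore t' j ∧ s.getAddr t' j = .val a ∧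
      s.getValue t' j ≠ .bot) :
    Inv P (insert (.load t i) S) (s.setLoaded t i y) := by
  have hst : ∀ t' i', (s.setLoaded t i y).IsStore t' i' ↔ s.IsStore t' i' := fun t' i' =>
    isStore_congr (by simp)
  apply h.extend hle
  · simp
  · rfl
  · intro t' i'
    simp [h.mem_fetch, len_congr (s' := s.setLoaded t i y) (s := s)]
  · intro t' i'
    simp [h.mem_commit]
  · intro t' i'
    by_cases hi : t' = t ∧ i' = i
    · simp [hi]
    · simp [hi, h.mem_load]
  · exact h.paths.congr (by simp)
  · intro t' i' y' hn hy'
    by_cases hi : t' = t ∧ i' = i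
    · obtain ⟨rfl, rfl⟩ := hi
      simp only [loaded_setLoaded, and_self, if_true, Option.some.injEq] at hy'
      subst hy'
      exact ⟨hl, a, ha, hy⟩
    · rw [loaded_setLoaded, if_neg hi, hn] at hy'
      cases hy'
  · intro t' i' hn hc
    simp only [committed_setLoaded] at hc
    exact absurd hc hn
  · intro t' i'
    simpa [hst] using h.co_zero t' i'
  · intro t' i'
    simpa [hst] using h.co_ne t' i'
  · intro t₁ i₁ t₂ i₂
    simpa [hst] using h.co_inj t₁ i₁ t₂ i₂

/-- The invariant is preserved by the transitions. -/
theorem Inv.step (h : Inv P S s) {e : Event D Reg Q n} (ht : Trans P s e s') :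
    Inv P (insert e.action S) s' := by
  have hle := ht.le
  cases ht with
  | fetch t I hI hsrc =>
    have hst : ∀ t' i', i' < s.len t' → ((s.addFetched t I).IsStore t' i' ↔ s.IsStore t' i') :=
      fun t' i' hi => ((h.emb hle).isStore_iff hi).symm
    apply h.extend hle
    · simp [Event.action]
    · rfl
    · intro t' i'
      by_cases hi : t' = t
      · subst hi
        simp only [Event.action, Set.mem_insert_iff, Action.fetch.injEq, true_and, h.mem_fetch,
          len_addFetched, if_true]
        unfold len
        omega
      · simp [Event.action, h.mem_fetch, hi]
    · simp [h.mem_commit, Event.action]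
    · simp [h.mem_load, Event.action]
    · intro t' i' J hJ
      by_cases hi : t' = t
      · subst hi
        have hf : ((s.addFetched t' I).thr t').fetched = (s.thr t').fetched ++ [I] := by
          simp [addFetched, setThr]
        have hlt := lt_len_of_instrAt hJ
        simp only [len_addFetched, if_true] at hlt
        rw [instrAt, hf] at hJ
        rw [hf, List.take_append_of_le_length (Nat.lt_succ_iff.1 hlt)]
        rcases Nat.lt_succ_iff_lt_or_eq.1 hlt with hlt | rfl
        · rw [List.getElem?_append_left hlt] at hJ
          exact h.paths _ _ _ hJ
        · simp only [len, List.getElem?_concat_length, Option.some.injEq] at hJ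
          subst hJ
          refine ⟨hI, ?_⟩
          rw [len, List.take_length, hsrc]
      · have hf : ((s.addFetched t I).thr t').fetched = (s.thr t').fetched := by
          simp [addFetched, setThr, hi]
        rw [instrAt, hf] at hJ
        rw [hf]
        exact h.paths _ _ _ hJ
    · intro t' i' y hn hy
      simp [hn] at hy
    · intro t' i' hn hc
      simp only [committed_addFetched] at hc
      exact absurd hc hn
    · intro t' i' hc
      refine h.co_zero t' i' ?_
      by_cases hi : i' < s.len t'
      · simpa [hst _ _ hi] using hc
      · exact Or.inl fun hc => hi (h.com_lt _ _ hc)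
    · intro t' i' hc hs
      simp only [committed_addFetched] at hc
      exact h.co_ne t' i' hc ((hst _ _ (h.com_lt _ _ hc)).1 hs)
    · intro t₁ i₁ t₂ i₂ hc hs hc' hs'
      simp only [committed_addFetched] at hc hc'
      exact h.co_inj t₁ i₁ t₂ i₂ hc ((hst _ _ (h.com_lt _ _ hc)).1 hs)
        hc' ((hst _ _ (h.com_lt _ _ hc')).1 hs')
  | load t i a hload hnone ha =>
    refine h.step_load hle hload ha ?_
    rcases (h.prop_last t a).mem with hy | ⟨t', j, hy, hm, haj⟩
    · exact Or.inl hy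
    · obtain ⟨hst, hc, -⟩ := h.prop_mem _ _ _ hm
      exact Or.inr ⟨t', j, hy, hst, haj, h.com_val _ _ hc⟩
  | early t i a i' hload hnone ha hlt hst hmax ha' hv hc =>
    exact h.step_load hle hload ha (Or.inr ⟨t, i', rfl, hst, ha', hv⟩)
  | commit t i hcan hnst =>
    have hst : ∀ t' i', (s.addCommitted t i).IsStore t' i' ↔ s.IsStore t' i' := fun t' i' =>
      isStore_congr (by simp)
    apply h.extend hle
    · simp [Event.action]
    · rfl
    · intro t' i'
      simp [Event.action, h.mem_fetch, len_congr (s' := s.addCommitted t i) (s := s)]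
    · simp [Event.action, h.mem_commit]
    · simp [Event.action, h.mem_load]
    · exact h.paths.congr (by simp)
    · intro t' i' y hn hy
      simp [hn] at hy
    · intro t' i' hn hc
      rcases (mem_committed_addCommitted _ _).1 hc with ⟨rfl, rfl⟩ | hc
      · exact hcan
      · exact absurd hc hn
    · intro t' i' hc
      rw [hst, mem_committed_addCommitted] at hc
      exact h.co_zero t' i' (by tauto)
    · intro t' i' hc hs
      rw [hst] at hs
      rcases (mem_committed_addCommitted _ _).1 hc with ⟨rfl, rfl⟩ | hc
      · exact absurd hs hnst
      · exact h.co_ne _ _ hc hs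
    · intro t₁ i₁ t₂ i₂ hc hs hc' hs'
      rw [hst] at hs hs'
      rcases (mem_committed_addCommitted _ _).1 hc with ⟨rfl, rfl⟩ | hc
      · exact absurd hs hnst
      rcases (mem_committed_addCommitted _ _).1 hc' with ⟨rfl, rfl⟩ | hc'
      · exact absurd hs' hnst
      exact h.co_inj _ _ _ _ hc hs hc' hs'
  | commitStore t i key a hcan hs ha hkey =>
    have hst : ∀ t' i', ((s.addCommitted t i).setCo (.st t i) key).IsStore t' i' ↔
      s.IsStore t' i' := fun t' i' => isStore_congr (by simp)
    -- An index that has not been fetched has key `0`.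
    have hkey0 : key ≠ 0 := by
      intro h0
      refine hkey t (s.len t) ?_
      rw [h0]
      exact h.co_zero _ _ (Or.inl fun hc => absurd (h.com_lt _ _ hc) (lt_irrefl _))
    apply h.extend hle
    · simp [Event.action]
    · rfl
    · intro t' i'
      simp [Event.action, h.mem_fetch,
        len_congr (s' := (s.addCommitted t i).setCo (.st t i) key) (s := s)]
    · simp [Event.action, h.mem_commit]
    · simp [Event.action, h.mem_load]
    · exact h.paths.congr (by simp)
    · intro t' i' y hn hy
      simp [hn] at hy
    · intro t' i' hn hc
      rw [thr_setCo] at hc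
      rcases (mem_committed_addCommitted _ _).1 hc with ⟨rfl, rfl⟩ | hc
      · exact hcan
      · exact absurd hc hn
    · intro t' i' hc
      rw [hst, thr_setCo, mem_committed_addCommitted] at hc
      rw [co_setCo_st]
      by_cases hi : t' = t ∧ i' = i
      · obtain ⟨rfl, rfl⟩ := hi
        tauto
      · rw [if_neg hi]
        exact h.co_zero t' i' (by tauto)
    · intro t' i' hc hs
      rw [hst] at hs
      rw [thr_setCo] at hc
      rw [co_setCo_st]
      split_ifs with hi
      · exact hkey0
      · rcases (mem_committed_addCommitted _ _).1 hc with hi' | hc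
        · exact absurd hi' hi
        · exact h.co_ne _ _ hc hs
    · intro t₁ i₁ t₂ i₂ hc hs hc' hs'
      rw [hst] at hs hs'
      rw [thr_setCo] at hc hc'
      rw [co_setCo_st, co_setCo_st]
      split_ifs with hi hi' hi'
      · exact fun _ => ⟨hi.1.trans hi'.1.symm, hi.2.trans hi'.2.symm⟩
      · exact fun h' => absurd h'.symm (hkey _ _)
      · exact fun h' => absurd h' (hkey _ _)
      · rcases (mem_committed_addCommitted _ _).1 hc with hi₁ | hc
        · exact absurd hi₁ hi
        rcases (mem_committed_addCommitted _ _).1 hc' with hi₁ | hc'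
        · exact absurd hi₁ hi'
        exact h.co_inj _ _ _ _ hc hs hc' hs'
  | propagate t t' i' a hst hcom ha hlt =>
    have hpos : 0 < s.co (.st t' i') := (h.co_prop_nonneg t a).trans_lt hlt
    set s' := s.setProp t a (.st t' i') with hs'
    have hthr : s'.thr = s.thr := rfl
    have haddr := getAddr_congr hthr
    have hval := getValue_congr hthr
    refine ⟨?_, ?_, ?_, h.paths, ?_, h.com_lt, ?_, ?_, h.com_ld, ?_,
      h.co_init, h.co_zero, h.co_ne, h.co_inj, ?_, ?_⟩
    · exact fun _ _ => (by simp [Event.action] : _ ↔ _).trans <| h.mem_fetch _ _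
    · exact fun _ _ => (by simp [Event.action] : _ ↔ _).trans <| h.mem_commit _ _
    · exact fun _ _ => (by simp [Event.action] : _ ↔ _).trans <| h.mem_load _ _
    · simp only [haddr, hval]
      exact h.ld
    · simp only [haddr]
      exact h.com_addr
    · simp only [hval]
      exact h.com_val
    · simp only [hval]
      exact h.com_assume
    · intro t₁ t₂ i hm
      rcases Set.mem_insert_iff.1 hm with hm | hm
      · cases hm
        exact ⟨hst, hcom, ⟨a, (haddr _ _).trans ha⟩, hpos⟩
      · simp only [haddr]
        exact h.prop_mem _ _ _ hm
    · intro t₁ a₁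
      by_cases hta : t₁ = t ∧ a₁ = a
      · obtain ⟨rfl, rfl⟩ := hta
        refine ⟨?_, ?_⟩
        · rw [setProp_prop_self]
          exact Or.inr ⟨t', i', rfl, Set.mem_insert _ _, (haddr _ _).trans ha⟩
        · intro t₂ i₂ hm ha₂
          rw [haddr] at ha₂
          rw [setProp_prop_self]
          rcases Set.mem_insert_iff.1 hm with hm | hm
          · cases hm
            exact le_rfl
          · exact ((h.prop_last t₁ a₁).max _ _ hm ha₂).trans hlt.le
      · refine ⟨?_, ?_⟩
        · rw [setProp_prop_ne hta]
          rcases (h.prop_last t₁ a₁).mem with hy | ⟨t₂, i₂, hy, hm, ha₂⟩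
          · exact Or.inl hy
          · exact Or.inr ⟨t₂, i₂, hy, Set.mem_insert_of_mem _ hm, (haddr _ _).trans ha₂⟩
        · intro t₂ i₂ hm ha₂
          rw [haddr] at ha₂
          rw [setProp_prop_ne hta]
          rcases Set.mem_insert_iff.1 hm with hm | hm
          · cases hm
            have : s.getAddr t' i' = .val a₁ := ha₂
            rw [ha] at this
            cases this
            exact absurd ⟨rfl, rfl⟩ hta
          · exact (h.prop_last t₁ a₁).max _ _ hm ha₂

end State

end Semantics

/-! ### Executions -/

section Semantics

variable {D : Type u} {Reg : Type v} {Q : Type w} {n : ℕ} [Zero D]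

open State

/-- The loads among the instructions `X` of thread `t` belong to `S`. -/
def LoadsIn (g : State D Reg Q n) (S : Set (Action n)) (t : Fin n) (X : Set ℕ) : Prop :=
  ∀ j ∈ X, g.IsLoad t j → .load t j ∈ S

/-- After the actions in `S`, the load `(t, i)` from address `a` may be an early read from the store
`(t, i')`. -/
structure Early (g : State D Reg Q n) (S : Set (Action n)) (t : Fin n) (i : ℕ) (a : D)
    (i' : ℕ) : Prop where
  lt : i' < i
  store : g.IsStore t i'
  addr : g.getAddr t i' = .val a
  addrLoads : LoadsIn g S t (g.addrDeps t i')
  dataLoads : LoadsIn g S t (g.dataDeps t i')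
  between : ∀ j, i' < j → j < i → g.IsStore t j →
    g.getAddr t j ≠ .val a ∧ LoadsIn g S t (g.addrDeps t j)
  not_committed : .commit t i' ∉ S

/-- The action is enabled after the actions in `S`, in a run that leads to the state `g`. -/
def Ok (g : State D Reg Q n) (S : Set (Action n)) : Action n → Prop
  | .fetch t i => i < g.len t ∧ (∀ j < i, .fetch t j ∈ S) ∧ .fetch t i ∉ S
  | .load t i => g.IsLoad t i ∧ .fetch t i ∈ S ∧ .load t i ∉ S ∧ LoadsIn g S t (g.addrDeps t i) ∧
      ∃ a y, g.getAddr t i = .val a ∧ (g.thr t).loaded i = some y ∧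
        (g.IsLast S t a y ∨ ∃ i', y = .st t i' ∧ Early g S t i a i')
  | .commit t i => .fetch t i ∈ S ∧ .commit t i ∉ S ∧
      (∀ j ∈ g.addrDeps t i ∪ g.dataDeps t i ∪ g.ctrlDeps t i, .commit t j ∈ S) ∧
      (g.getAddr t i ≠ .top → ∀ j < i, g.getAddr t j ≠ .top → LoadsIn g S t (g.addrDeps t j) ∧
        (g.getAddr t j = g.getAddr t i → .commit t j ∈ S)) ∧
      (g.IsLoad t i → .load t i ∈ S)
  | .prop t t' i => g.IsStore t' i ∧ .commit t' i ∈ S ∧ ∀ t'' j, .prop t t'' j ∈ S →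
      g.getAddr t'' j = g.getAddr t' i → g.co (.st t'' j) < g.co (.st t' i)

/-- `g` is the final state of a run with the actions `es` from the initial state, up to the
propagated stores.  The keys of the stores are positive: each store is propagated to its own thread,
where the initial store, of key `0`, is visible first. -/
structure Execution (P : Program D Reg Q n) (g : State D Reg Q n) (es : List (Action n)) :
    Prop where
  ok : ∀ es₁ m es₂, es = es₁ ++ m :: es₂ → Ok g {e | e ∈ es₁} m
  own : ∀ es₁ t i es₂, es = es₁ ++ .commit t i :: es₂ → g.IsStore t i →
    ∃ es₃, es₂ = .prop t t i :: es₃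
  commit_mem : ∀ t i, i < g.len t → .commit t i ∈ es
  paths : g.FollowsPaths P
  com : ∀ t i, i ∈ (g.thr t).committed ↔ i < g.len t
  assume : ∀ t i, g.IsAssume t i → g.getValue t i ≠ .val 0
  co_init : ∀ a, g.co (.init a) = 0
  co_zero : ∀ t i, ¬ g.IsStore t i → g.co (.st t i) = 0
  co_pos : ∀ t i, g.IsStore t i → 0 < g.co (.st t i)
  co_inj : ∀ t i t' i', g.IsStore t i → g.IsStore t' i' →
    g.co (.st t i) = g.co (.st t' i') → t = t' ∧ i = i'
  isLoad : ∀ t i, (g.thr t).loaded i ≠ none → g.IsLoad t i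
  ld : ∀ t i i' x x', i' < i → g.IsLoad t i → g.IsLoad t i' → g.getAddr t i = g.getAddr t i' →
    g.LoadedKey t i x → g.LoadedKey t i' x' → x' ≤ x
  ld_st : ∀ t i i' x, i' < i → g.IsLoad t i → g.IsStore t i' → g.getAddr t i = g.getAddr t i' →
    g.LoadedKey t i x → g.co (.st t i') ≤ x

theorem Run.le {P : Program D Reg Q n} {s s' : State D Reg Q n} {σ : List (Event D Reg Q n)}
    (h : Run P s σ s') : Le s s' := by
  induction h with
  | nil => exact Le.refl _
  | cons s e s' σ s'' h _ ih => exact h.le.trans ih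

theorem Run.append_split {P : Program D Reg Q n} {s g : State D Reg Q n}
    {σ₁ σ₂ : List (Event D Reg Q n)} (h : Run P s (σ₁ ++ σ₂) g) :
    ∃ s', Run P s σ₁ s' ∧ Run P s' σ₂ g := by
  induction σ₁ generalizing s with
  | nil => exact ⟨s, .nil _, h⟩
  | cons e σ₁ ih =>
    cases h with
    | cons _ _ s' _ _ ht hr =>
      obtain ⟨s'', h₁, h₂⟩ := ih hr
      exact ⟨s'', .cons _ _ _ _ _ ht h₁, h₂⟩

theorem Run.inv {P : Program D Reg Q n} {S : Set (Action n)} {s s' : State D Reg Q n}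
    {σ : List (Event D Reg Q n)} (h : Run P s σ s') (hs : Inv P S s) :
    Inv P (S ∪ {e | e ∈ σ.map Event.action}) s' := by
  induction h generalizing S with
  | nil => simpa using hs
  | cons s e s' σ s'' h _ ih =>
    have := ih (hs.step h)
    convert this using 1
    ext m
    simp only [List.map_cons, List.mem_cons, Set.mem_union, Set.mem_ofPred_eq, Set.mem_insert_iff]
    tauto

theorem Run.inv_initial {P : Program D Reg Q n} {s : State D Reg Q n}
    {σ : List (Event D Reg Q n)} (h : Run P State.initial σ s) :
    Inv P {e | e ∈ σ.map Event.action} s := by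
  simpa using h.inv (State.inv_initial P)

section Extract

variable {P : Program D Reg Q n} {S : Set (Action n)} {s s' g : State D Reg Q n}

/-- Conversely to `State.Inv.getAddr_ne_bot`, a defined address shows that the loads it depends on have
been performed.  So `LoadsIn` expresses, in terms of the set of actions, that an address is known. -/
theorem State.Inv.loadsIn_addrDeps (h : Inv P S s) (hle : Le s g) {t : Fin n} {i : ℕ}
    (hi : i < s.len t) (ha : s.getAddr t i ≠ .bot) : LoadsIn g S t (g.addrDeps t i) := by
  have hemb := h.emb hle
  intro j hj hl
  have hji := lt_of_mem_addrDeps hj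
  rw [← hemb.addrDeps_eq hi] at hj
  rw [← hemb.isLoad_iff (by omega)] at hl
  obtain ⟨e, he, hj⟩ := hj
  obtain ⟨d, hd⟩ := argVal_ne_bot_iff.1 ha e he
  exact (h.mem_load _ _).2 (hd.loaded_ne_none hj hl)

theorem State.Inv.loadsIn_dataDeps (h : Inv P S s) (hle : Le s g) {t : Fin n} {i : ℕ}
    (hi : i < s.len t) (ha : s.getValue t i ≠ .bot) : LoadsIn g S t (g.dataDeps t i) := by
  have hemb := h.emb hle
  intro j hj hl
  have hji := lt_of_mem_dataDeps hj
  rw [← hemb.dataDeps_eq hi] at hj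
  rw [← hemb.isLoad_iff (by omega)] at hl
  obtain ⟨e, he, hj⟩ := hj
  obtain ⟨d, hd⟩ := argVal_ne_bot_iff.1 ha e he
  exact (h.mem_load _ _).2 (hd.loaded_ne_none hj hl)

theorem State.Inv.getAddr_ne_bot (h : Inv P S s) (hle : Le s g) {t : Fin n} {i : ℕ}
    (hi : i < s.len t) (ha : LoadsIn g S t (g.addrDeps t i)) : s.getAddr t i ≠ .bot := by
  have hemb := h.emb hle
  refine argVal_ne_bot_iff.2 fun e he => h.sourcesDefined.exists_evalsTo fun j hj hl => ?_
  have hji := hj.lt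
  refine (h.mem_load _ _).1 (ha j ?_ (hle.isLoad hl))
  rw [← hemb.addrDeps_eq hi]
  exact ⟨e, he, hj⟩

theorem State.Inv.getValue_ne_bot (h : Inv P S s) (hle : Le s g) {t : Fin n} {i : ℕ}
    (hi : i < s.len t) (ha : LoadsIn g S t (g.dataDeps t i)) : s.getValue t i ≠ .bot := by
  have hemb := h.emb hle
  refine argVal_ne_bot_iff.2 fun e he => h.sourcesDefined.exists_evalsTo fun j hj hl => ?_
  have hji := hj.lt
  refine (h.mem_load _ _).1 (ha j ?_ (hle.isLoad hl))
  rw [← hemb.dataDeps_eq hi]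
  exact ⟨e, he, hj⟩

theorem State.Inv.getAddr_top_iff (h : Inv P S s) (hle : Le s g) {t : Fin n} {i : ℕ}
    (hi : i < s.len t) : s.getAddr t i = .top ↔ g.getAddr t i = .top := by
  rw [getAddr_eq_top_iff, getAddr_eq_top_iff, (h.emb hle).cmd t i hi]

theorem State.Inv.ok_commit (h : Inv P S s) (hle : Le s g) {t : Fin n} {i : ℕ}
    (hcan : s.CanCommit t i) : Ok g S (.commit t i) := by
  have hemb := h.emb hle
  have hi : i < s.len t := hcan.fetched
  refine ⟨(h.mem_fetch _ _).2 hi, fun hc => hcan.not_committed ((h.mem_commit _ _).1 hc), ?_,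
    ?_, ?_⟩
  · intro j hj
    rw [← hemb.addrDeps_eq hi, ← hemb.dataDeps_eq hi, ← hemb.ctrlDeps_eq hi] at hj
    exact (h.mem_commit _ _).2 (hcan.deps hj)
  · intro htop j hj hjtop
    rw [Ne, ← h.getAddr_top_iff hle hi] at htop
    have hjl : j < s.len t := hj.trans hi
    have hb : s.getAddr t j ≠ .bot := fun hb =>
      h.com_addr _ _ (hcan.same_addr htop j hj (Or.inr hb)) hb
    refine ⟨h.loadsIn_addrDeps hle hjl hb, fun ha => (h.mem_commit _ _).2 ?_⟩
    rw [hemb.getAddr_eq hjl hb, hemb.getAddr_eq hi hcan.addr] at ha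
    exact hcan.same_addr htop j hj (Or.inl ha)
  · intro hl
    exact (h.mem_load _ _).2 (hcan.load ((hemb.isLoad_iff hi).2 hl))

/-- The transitions of a run satisfy the enabling condition. -/
theorem State.Inv.ok (h : Inv P S s) {e : Event D Reg Q n} (ht : Trans P s e s') (hg : Le s' g) :
    Ok g S e.action := by
  have hle := ht.le.trans hg
  have hemb := h.emb hle
  cases ht with
  | fetch t I hI hsrc =>
    refine ⟨?_, fun j hj => (h.mem_fetch _ _).2 hj, fun hm => ?_⟩
    · have := hg.len_le t
      simp only [len_addFetched, if_true] at this
      unfold len at *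
      omega
    · exact absurd ((h.mem_fetch _ _).1 hm) (lt_irrefl _)
  | load t i a hload hnone ha =>
    refine ⟨hle.isLoad hload, (h.mem_fetch _ _).2 hload.lt_len,
      fun hm => (h.mem_load _ _).1 hm hnone, h.loadsIn_addrDeps hle hload.lt_len (by simp [ha]), a,
      s.prop t a, h.getAddr_eq_val hle ha, hg.ld _ _ _ (by simp), Or.inl ?_⟩
    exact h.isLast_mono hle (h.prop_last t a)
  | early t i a i' hload hnone ha hlt hst hmax ha' hv hc =>
    refine ⟨hle.isLoad hload, (h.mem_fetch _ _).2 hload.lt_len,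
      fun hm => (h.mem_load _ _).1 hm hnone, h.loadsIn_addrDeps hle hload.lt_len (by simp [ha]), a,
      .st t i', h.getAddr_eq_val hle ha, hg.ld _ _ _ (by simp), Or.inr ⟨i', rfl, ?_⟩⟩
    refine ⟨hlt, hle.isStore hst, h.getAddr_eq_val hle ha',
      h.loadsIn_addrDeps hle hst.lt_len (by simp [ha']), h.loadsIn_dataDeps hle hst.lt_len hv, ?_,
      fun hm => hc ((h.mem_commit _ _).1 hm)⟩
    intro j hj hji hsj
    have hjl : j < s.len t := hji.trans hload.lt_len
    obtain ⟨h₁, h₂⟩ := hmax j hj hji ((hemb.isStore_iff hjl).2 hsj)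
    exact ⟨by rwa [hemb.getAddr_eq hjl h₂], h.loadsIn_addrDeps hle hjl h₂⟩
  | commit t i hcan hst => exact h.ok_commit hle hcan
  | commitStore t i key a hcan hst ha hkey => exact h.ok_commit hle hcan
  | propagate t t' i' a hst hcom ha hlt =>
    refine ⟨hle.isStore hst, (h.mem_commit _ _).2 hcom, fun t'' j hm haj => ?_⟩
    obtain ⟨hst', hc', ⟨a', ha'⟩, -⟩ := h.prop_mem _ _ _ hm
    rw [h.getAddr_eq_val hle ha', h.getAddr_eq_val hle ha] at haj
    cases haj
    rw [hle.co _ _ hc', hle.co _ _ hcom]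
    exact ((h.prop_last t _).max _ _ hm ha').trans_lt hlt

/-- Any event of a run labels a transition from a state that satisfies the invariant. -/
theorem Run.exists_step {σ₁ σ₂ : List (Event D Reg Q n)} {e : Event D Reg Q n}
    (h : Run P State.initial (σ₁ ++ e :: σ₂) g) :
    ∃ s s', Inv P {m | m ∈ σ₁.map Event.action} s ∧ Trans P s e s' ∧ Le s' g := by
  obtain ⟨s, h₁, h₂⟩ := h.append_split
  cases h₂ with
  | cons _ _ s' _ _ ht hr => exact ⟨s, s', h₁.inv_initial, ht, hr.le⟩

/-- The final state of a computation with the actions of the computation is an execution. -/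
theorem AcceptedAt.execution {σ : List (Event D Reg Q n)} (h : AcceptedAt P σ g) :
    Execution P g (σ.map Event.action) := by
  obtain ⟨hrun, hpc, hfin⟩ := h
  have hinv := hrun.inv_initial
  have hcom : ∀ t i, i ∈ (g.thr t).committed ↔ i < g.len t := hfin.comm
  have own : ∀ es₁ t i es₂, σ.map Event.action = es₁ ++ .commit t i :: es₂ → g.IsStore t i →
      ∃ es₃, es₂ = .prop t t i :: es₃ := by
    intro es₁ t i es₂ he hst
    obtain ⟨σ₁, l, rfl, rfl, hl⟩ := List.map_eq_append_iff.1 he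
    obtain ⟨e, σ₂, rfl, hm, rfl⟩ := List.map_eq_cons_iff.1 hl
    obtain ⟨s, s', hs, ht, hle⟩ := hrun.exists_step
    have hle' := ht.le.trans hle
    cases ht with
    | commit t i hcan hnst =>
      cases hm
      exact absurd ((hs.isStore_iff hle' hcan.fetched).2 hst) hnst
    | commitStore t i key a =>
      cases hm
      obtain ⟨σ₃, rfl⟩ := hpc σ₁ σ₂ t i key a rfl
      exact ⟨_, rfl⟩
    | _ => cases hm
  have commit_mem : ∀ t i, i < g.len t → .commit t i ∈ σ.map Event.action := fun t i hi =>
    (hinv.mem_commit t i).2 ((hcom t i).2 hi)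
  refine ⟨?_, own, commit_mem, hinv.paths, hcom, ?_, hinv.co_init,
    fun t i h => hinv.co_zero t i (Or.inr h), ?_, ?_, ?_, hfin.ld,
    hfin.ld_st⟩
  · intro es₁ m es₂ he
    obtain ⟨σ₁, l, rfl, rfl, hl⟩ := List.map_eq_append_iff.1 he
    obtain ⟨e, σ₂, rfl, rfl, rfl⟩ := List.map_eq_cons_iff.1 hl
    obtain ⟨s, s', hs, ht, hle⟩ := hrun.exists_step
    exact hs.ok ht hle
  · exact fun t i ha => hinv.com_assume t i ((hcom t i).2 ha.lt_len) ha
  · intro t i hst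
    obtain ⟨es₁, es₂, he⟩ := List.append_of_mem (commit_mem t i hst.lt_len)
    obtain ⟨es₃, rfl⟩ := own es₁ t i es₂ he hst
    exact (hinv.prop_mem t t i (by simp only [he]; simp)).2.2.2
  · exact fun t i t' i' h h' => hinv.co_inj t i t' i' ((hcom _ _).2 h.lt_len) h
      ((hcom _ _).2 h'.lt_len) h'
  · intro t i hl
    obtain ⟨y, hy⟩ := Option.ne_none_iff_exists'.1 hl
    exact (hinv.ld _ _ _ hy).1

end Extract

end Semantics

/-! ### Runs with given actions -/

section Semantics

variable {D : Type u} {Reg : Type v} {Q : Type w} {n : ℕ} [Zero D]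

open State

/-- The value of an argument; `0` if there is none. -/
def ArgVal.getD : ArgVal D → D
  | .val d => d
  | _ => 0

open Classical in
/-- The event with a given action in a run that leads to the state `g`.  The action `fetch t i` with
no fetched instruction `(t, i)` in `g` has no such event; its value here is arbitrary. -/
noncomputable def label (g : State D Reg Q n) : Action n → Event D Reg Q n
  | .fetch t i => match g.instrAt t i with
    | some I => .fetch t i I
    | none => .commit t i
  | .load t i => .load t i (g.getAddr t i).getD
  | .commit t i =>
    if g.IsStore t i then .commitStore t i (g.co (.st t i)) (g.getAddr t i).getD else .commit t i
  | .prop t t' i => .propagate t t' i (g.getAddr t' i).getD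

theorem inst_label (g : State D Reg Q n) (m : Action n) : (label g m).inst = m.inst := by
  cases m with
  | fetch t i => cases h : g.instrAt t i <;> simp [label, h, Event.inst, Action.inst]
  | load => rfl
  | commit t i => by_cases h : g.IsStore t i <;> simp [label, h, Event.inst, Action.inst]
  | prop => rfl

theorem isFetch_label {g : State D Reg Q n} {m : Action n} (h : (label g m).IsFetch) :
    ∃ t i, m = .fetch t i := by
  obtain ⟨t, i, I, h⟩ := h
  cases m with
  | fetch t i => exact ⟨t, i, rfl⟩
  | load => cases h
  | commit t i => by_cases h' : g.IsStore t i <;> simp [label, h'] at h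
  | prop => cases h

variable {P : Program D Reg Q n} {S : Set (Action n)} {s s' g : State D Reg Q n}
  {es : List (Action n)}

theorem action_label {m : Action n} (h : Ok g S m) : (label g m).action = m := by
  cases m with
  | fetch t i =>
    obtain ⟨I, hI⟩ := instrAt_eq_some_of_lt h.1
    simp [label, hI, Event.action]
  | load => rfl
  | commit t i => by_cases h : g.IsStore t i <;> simp [label, h, Event.action]
  | prop => rfl

theorem State.IsLast.unique {t : Fin n} {a : D} {y z : StoreId D n} (hy : g.IsLast S t a y)
    (hz : g.IsLast S t a z) (hinit : ∀ a, g.co (.init a) = 0)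
    (hpos : ∀ t t' i, .prop t t' i ∈ S → g.IsStore t' i ∧ 0 < g.co (.st t' i))
    (hinj : ∀ t i t' i', g.IsStore t i → g.IsStore t' i' →
      g.co (.st t i) = g.co (.st t' i') → t = t' ∧ i = i') : y = z := by
  rcases hy.mem with rfl | ⟨t₁, i₁, rfl, hm, ha⟩ <;> rcases hz.mem with rfl | ⟨t₂, i₂, rfl, hm', ha'⟩
  · rfl
  · have := hy.max _ _ hm' ha'
    rw [hinit] at this
    exact absurd (hpos _ _ _ hm').2 (not_lt.2 this)
  · have := hz.max _ _ hm ha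
    rw [hinit] at this
    exact absurd (hpos _ _ _ hm).2 (not_lt.2 this)
  · obtain ⟨rfl, rfl⟩ := hinj _ _ _ _ (hpos _ _ _ hm).1 (hpos _ _ _ hm').1
      (le_antisymm (hz.max _ _ hm ha) (hy.max _ _ hm' ha'))
    rfl

theorem Execution.exists_trans_fetch (hg : Execution P g es) (h : Inv P S s) (hle : Le s g)
    {t : Fin n} {i : ℕ} (hok : Ok g S (.fetch t i)) :
    ∃ s', Trans P s (label g (.fetch t i)) s' ∧ Le s' g := by
  obtain ⟨hi, hlt, hnot⟩ := hok
  have hlen : (s.thr t).fetched.length = i := by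
    change s.len t = i
    rw [h.mem_fetch] at hnot
    by_contra hne
    have : s.len t < i := by omega
    exact absurd ((h.mem_fetch _ _).1 (hlt _ this)) (lt_irrefl _)
  subst hlen
  obtain ⟨I, hI⟩ := instrAt_eq_some_of_lt hi
  refine ⟨s.addFetched t I, ?_, ?_⟩
  · have htake : (g.thr t).fetched.take (s.thr t).fetched.length = (s.thr t).fetched := by
      apply List.ext_getElem?
      intro k
      rw [List.getElem?_take]
      split_ifs with hk
      · obtain ⟨J, hJ⟩ := instrAt_eq_some_of_lt (s := s) (t := t) hk
        have := hle.instr _ _ _ hJ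
        unfold instrAt at this hJ
        rw [this, hJ]
      · rw [eq_comm, List.getElem?_eq_none_iff]
        omega
    obtain ⟨h₁, h₂⟩ := hg.paths _ _ _ hI
    rw [htake] at h₂
    simpa [label, hI] using Trans.fetch s t I h₁ h₂
  · refine ⟨fun t' i' J hJ => ?_, fun t' i' y hy => hle.ld _ _ _ (by simpa using hy),
      fun t' i' hc => hle.com _ _ (by simpa using hc),
      fun t' i' hc => hle.co _ _ (by simpa using hc), hle.co_init⟩
    have hlt := lt_len_of_instrAt hJ
    by_cases ht : t' = t
    · subst ht
      have hf : ((s.addFetched t' I).thr t').fetched = (s.thr t').fetched ++ [I] := by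
        simp [addFetched, setThr]
      simp only [len_addFetched, if_true] at hlt
      rw [instrAt, hf] at hJ
      rcases Nat.lt_succ_iff_lt_or_eq.1 hlt with hlt | rfl
      · rw [List.getElem?_append_left hlt] at hJ
        exact hle.instr _ _ _ hJ
      · simp only [len, List.getElem?_concat_length, Option.some.injEq] at hJ
        rw [← hJ]
        exact hI
    · exact hle.instr _ _ _ (by simpa [instrAt, addFetched, setThr, ht] using hJ)

theorem Execution.exists_trans_load (hg : Execution P g es) (h : Inv P S s) (hle : Le s g)
    {t : Fin n} {i : ℕ} (hok : Ok g S (.load t i)) :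
    ∃ s', Trans P s (label g (.load t i)) s' ∧ Le s' g := by
  have hemb := h.emb hle
  obtain ⟨hl, hf, hnot, hloads, a, y, ha, hy, hsrc⟩ := hok
  have hi := (h.mem_fetch _ _).1 hf
  have hb := h.getAddr_ne_bot hle hi hloads
  have ha' : s.getAddr t i = .val a := by rw [← hemb.getAddr_eq hi hb, ha]
  have hl' : s.IsLoad t i := (hemb.isLoad_iff hi).2 hl
  have hnone : (s.thr t).loaded i = none := by simpa [h.mem_load] using hnot
  refine ⟨s.setLoaded t i y, ?_, hle.setLoaded hy⟩
  have hlab : label g (.load t i) = .load t i a := by simp [label, ha, ArgVal.getD]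
  rw [hlab]
  rcases hsrc with hlast | ⟨i', rfl, he⟩
  · have : y = s.prop t a := by
      refine hlast.unique (h.isLast_mono hle (h.prop_last t a)) hg.co_init ?_ hg.co_inj
      intro t₁ t₂ j hm
      have := hle.isStore (h.prop_mem _ _ _ hm).1
      exact ⟨this, hg.co_pos _ _ this⟩
    rw [this]
    exact .load s t i a hl' hnone ha'
  · have hi' : i' < s.len t := he.lt.trans hi
    have hb' := h.getAddr_ne_bot hle hi' he.addrLoads
    refine .early s t i a i' hl' hnone ha' he.lt ((hemb.isStore_iff hi').2 he.store) ?_ ?_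
      (h.getValue_ne_bot hle hi' he.dataLoads) fun hc => he.not_committed ((h.mem_commit _ _).2 hc)
    · intro j hj hji hst
      have hjl : j < s.len t := hji.trans hi
      obtain ⟨h₁, h₂⟩ := he.between j hj hji ((hemb.isStore_iff hjl).1 hst)
      have hb := h.getAddr_ne_bot hle hjl h₂
      rw [hemb.getAddr_eq hjl hb] at h₁
      exact ⟨h₁, hb⟩
    · rw [← hemb.getAddr_eq hi' hb', he.addr]

theorem Execution.canCommit (hg : Execution P g es) (h : Inv P S s) (hle : Le s g)
    {t : Fin n} {i : ℕ} (hok : Ok g S (.commit t i)) : s.CanCommit t i := by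
  have hemb := h.emb hle
  obtain ⟨hf, hnot, hdeps, hsame, hload⟩ := hok
  have hi := (h.mem_fetch _ _).1 hf
  have hcl : ∀ j < i, .commit t j ∈ S → g.IsLoad t j → .load t j ∈ S := fun j hj hc hl =>
    (h.mem_load _ _).2 (h.com_ld _ _ ((h.mem_commit _ _).1 hc)
      ((hemb.isLoad_iff (hj.trans hi)).2 hl))
  have haddr : s.getAddr t i ≠ .bot := h.getAddr_ne_bot hle hi fun j hj hl =>
    hcl j (lt_of_mem_addrDeps hj) (hdeps j (Or.inl (Or.inl hj))) hl
  have hval : s.getValue t i ≠ .bot := h.getValue_ne_bot hle hi fun j hj hl =>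
    hcl j (lt_of_mem_dataDeps hj) (hdeps j (Or.inl (Or.inr hj))) hl
  refine ⟨hi, fun hc => hnot ((h.mem_commit _ _).2 hc), ?_, haddr, hval, ?_, ?_, ?_⟩
  · rw [hemb.addrDeps_eq hi, hemb.dataDeps_eq hi, hemb.ctrlDeps_eq hi]
    exact fun j hj => (h.mem_commit _ _).1 (hdeps j hj)
  · intro htop j hj hja
    have hjl : j < s.len t := hj.trans hi
    have hjtop : s.getAddr t j ≠ .top := by
      rcases hja with hja | hja
      · rwa [hja]
      · simp [hja]
    obtain ⟨h₁, h₂⟩ := hsame (by rwa [Ne, ← h.getAddr_top_iff hle hi]) j hj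
      (by rwa [Ne, ← h.getAddr_top_iff hle hjl])
    have hb := h.getAddr_ne_bot hle hjl h₁
    refine (h.mem_commit _ _).1 (h₂ ?_)
    rw [hemb.getAddr_eq hjl hb, hemb.getAddr_eq hi haddr]
    exact hja.resolve_right hb
  · exact fun hl => (h.mem_load _ _).1 (hload ((hemb.isLoad_iff hi).1 hl))
  · intro ha
    rw [← hemb.getValue_eq hi hval]
    exact hg.assume _ _ ((hemb.isAssume_iff hi).1 ha)

theorem Execution.exists_trans_commit (hg : Execution P g es) (h : Inv P S s) (hle : Le s g)
    {t : Fin n} {i : ℕ} (hok : Ok g S (.commit t i)) :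
    ∃ s', Trans P s (label g (.commit t i)) s' ∧ Le s' g := by
  have hemb := h.emb hle
  have hcan := hg.canCommit h hle hok
  have hi : i < s.len t := hcan.fetched
  have hcom : ∀ t' i', i' ∈ ((s.addCommitted t i).thr t').committed →
      i' ∈ (g.thr t').committed := by
    intro t' i' hc
    rcases (mem_committed_addCommitted _ _).1 hc with ⟨rfl, rfl⟩ | hc
    · exact (hg.com _ _).2 (hi.trans_le (hle.len_le _))
    · exact hle.com _ _ hc
  have hinstr : ∀ t' i' I, (s.addCommitted t i).instrAt t' i' = some I →
      g.instrAt t' i' = some I := fun t' i' I hI => hle.instr _ _ _ (by simpa [instrAt] using hI)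
  by_cases hst : g.IsStore t i
  · have hst' := (hemb.isStore_iff hi).2 hst
    obtain ⟨a, ha⟩ : ∃ a, s.getAddr t i = .val a := by
      cases ha : s.getAddr t i with
      | bot => exact absurd ha hcan.addr
      | top => exact absurd ha hst'.getAddr_ne_top
      | val a => exact ⟨a, rfl⟩
    have hlab : label g (.commit t i) = .commitStore t i (g.co (.st t i)) a := by
      simp [label, hst, h.getAddr_eq_val hle ha, ArgVal.getD]
    rw [hlab]
    refine ⟨_, .commitStore s t i _ a hcan hst' ha ?_, ?_⟩
    · intro t' i' heq
      by_cases hc : i' ∈ (s.thr t').committed ∧ s.IsStore t' i'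
      · rw [← hle.co _ _ hc.1] at heq
        obtain ⟨rfl, rfl⟩ := hg.co_inj _ _ _ _ (hle.isStore hc.2) hst heq
        exact hcan.not_committed hc.1
      · rw [h.co_zero _ _ (by tauto)] at heq
        exact absurd (hg.co_pos _ _ hst) (by rw [← heq]; exact lt_irrefl _)
    · refine ⟨hinstr, fun t' i' y hy => hle.ld _ _ _ (by simpa using hy), hcom,
        fun t' i' hc => ?_, fun a => ?_⟩
      · rw [co_setCo_st]
        split_ifs with hti
        · rw [hti.1, hti.2]
        · rcases (mem_committed_addCommitted _ _).1 hc with hc | hc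
          · exact absurd hc hti
          · exact hle.co _ _ hc
      · rw [co_setCo, if_neg (by simp)]
        exact hle.co_init a
  · have hst' := (hemb.isStore_iff hi).not.2 hst
    have hlab : label g (.commit t i) = .commit t i := by simp [label, hst]
    rw [hlab]
    refine ⟨_, .commit s t i hcan hst', hinstr, fun t' i' y hy => hle.ld _ _ _ (by simpa using hy),
      hcom, fun t' i' hc => ?_, hle.co_init⟩
    rcases (mem_committed_addCommitted _ _).1 hc with ⟨rfl, rfl⟩ | hc
    · rw [hg.co_zero _ _ hst, co_addCommitted, h.co_zero _ _ (Or.inr hst')]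
    · exact hle.co _ _ hc

theorem Execution.exists_trans_prop (hg : Execution P g es) (h : Inv P S s) (hle : Le s g)
    {t t' : Fin n} {i : ℕ} (hok : Ok g S (.prop t t' i)) :
    ∃ s', Trans P s (label g (.prop t t' i)) s' ∧ Le s' g := by
  have hemb := h.emb hle
  obtain ⟨hst, hc, hmax⟩ := hok
  have hc' := (h.mem_commit _ _).1 hc
  have hi := h.com_lt _ _ hc'
  have hst' := (hemb.isStore_iff hi).2 hst
  obtain ⟨a, ha⟩ : ∃ a, s.getAddr t' i = .val a := by
    cases ha : s.getAddr t' i with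
    | bot => exact absurd ha (h.com_addr _ _ hc')
    | top => exact absurd ha hst'.getAddr_ne_top
    | val a => exact ⟨a, rfl⟩
  have hag := h.getAddr_eq_val hle ha
  have hlab : label g (.prop t t' i) = .propagate t t' i a := by
    simp [label, hag, ArgVal.getD]
  rw [hlab]
  refine ⟨_, .propagate s t t' i a hst' hc' ha ?_, hle.instr, hle.ld, hle.com, hle.co,
    hle.co_init⟩
  rw [← hle.co _ _ hc']
  rcases (h.prop_last t a).mem with hy | ⟨t'', j, hy, hm, haj⟩
  · rw [hy, h.co_init]
    exact hg.co_pos _ _ hst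
  · rw [hy, ← hle.co _ _ (h.prop_mem _ _ _ hm).2.1]
    exact hmax _ _ hm (by rw [hag, h.getAddr_eq_val hle haj])

theorem Execution.exists_trans (hg : Execution P g es) (h : Inv P S s) (hle : Le s g)
    {m : Action n} (hok : Ok g S m) : ∃ s', Trans P s (label g m) s' ∧ Le s' g := by
  cases m with
  | fetch => exact hg.exists_trans_fetch h hle hok
  | load => exact hg.exists_trans_load h hle hok
  | commit => exact hg.exists_trans_commit h hle hok
  | prop => exact hg.exists_trans_prop h hle hok

/-- The actions of an execution are performed by a run, whose last state is a partial version of `g`. -/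
theorem Execution.exists_run (hg : Execution P g es) :
    ∃ s, Run P initial (es.map (label g)) s ∧ Inv P {m | m ∈ es} s ∧ Le s g := by
  suffices H : ∀ es₂ es₁ s, es = es₁ ++ es₂ → Inv P {m | m ∈ es₁} s → Le s g →
      ∃ s', Run P s (es₂.map (label g)) s' ∧ Inv P {m | m ∈ es} s' ∧ Le s' g by
    refine H es [] initial rfl ?_ ?_
    · simpa using inv_initial P
    · exact ⟨by simp [initial, instrAt], by simp [initial], by simp [initial], by simp [initial],
        fun a => by simp [initial, hg.co_init]⟩
  intro es₂
  induction es₂ with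
  | nil =>
    rintro es₁ s he h hle
    rw [List.append_nil] at he
    subst he
    exact ⟨s, .nil _, h, hle⟩
  | cons m es₂ ih =>
    intro es₁ s he h hle
    have hok := hg.ok es₁ m es₂ he
    obtain ⟨s', ht, hle'⟩ := hg.exists_trans h hle hok
    have hinv := h.step ht
    rw [action_label hok] at hinv
    obtain ⟨s'', hr, h'⟩ := ih (es₁ ++ [m]) s' (by simp [he]) (by
      convert hinv using 1
      ext x
      simp [or_comm]) hle'
    exact ⟨s'', .cons _ _ _ _ _ ht hr, h'⟩

end Semantics

/-! ### Executions are carried out by computations -/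

section Semantics

variable {D : Type u} {Reg : Type v} {Q : Type w} {n : ℕ} [Zero D]

open State

/-- States which agree up to the propagated stores have the same trace. -/
theorem State.trace_congr {s g : State D Reg Q n} (hinstr : s.instrAt = g.instrAt)
    (haddr : s.getAddr = g.getAddr) (hld : ∀ t, (s.thr t).loaded = (g.thr t).loaded)
    (hco : ∀ t i, s.co (.st t i) = g.co (.st t i)) : s.trace = g.trace := by
  have hnode : s.NodeOfStore = g.NodeOfStore := by
    ext x y
    constructor
    · rintro (⟨a⟩ | ⟨t, i, I, h⟩)
      · exact .init a
      · exact .st t i I (by rwa [← hinstr])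
    · rintro (⟨a⟩ | ⟨t, i, I, h⟩)
      · exact .init a
      · exact .st t i I (by rwa [hinstr])
  have hpo : s.ProgramOrder = g.ProgramOrder := by
    ext x y
    constructor
    · rintro ⟨t, i, I, I', h, h'⟩
      exact ⟨t, i, I, I', by rwa [← hinstr], by rwa [← hinstr]⟩
    · rintro ⟨t, i, I, I', h, h'⟩
      exact ⟨t, i, I, I', by rwa [hinstr], by rwa [hinstr]⟩
  have hcoh : s.CoherenceOrder = g.CoherenceOrder := by
    ext x y
    constructor
    · rintro (⟨t, i, I, t', i', I', h, h', hst, hst', ha, hlt⟩ | ⟨a, t', i', I', h', hst', ha⟩)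
      · exact .st t i I t' i' I' (by rwa [← hinstr]) (by rwa [← hinstr]) hst hst'
          (by rwa [← haddr]) (by rwa [← hco, ← hco])
      · exact .init a t' i' I' (by rwa [← hinstr]) hst' (by rwa [← haddr])
    · rintro (⟨t, i, I, t', i', I', h, h', hst, hst', ha, hlt⟩ | ⟨a, t', i', I', h', hst', ha⟩)
      · exact .st t i I t' i' I' (by rwa [hinstr]) (by rwa [hinstr]) hst hst'
          (by rwa [haddr]) (by rwa [hco, hco])
      · exact .init a t' i' I' (by rwa [hinstr]) hst' (by rwa [haddr])
  have hsrc : s.SourceOrder = g.SourceOrder := by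
    ext x y
    constructor
    · rintro ⟨z, t', i', I', h', hl, hx⟩
      exact .mk x z t' i' I' (by rwa [← hinstr]) (by rwa [← hld]) (by rwa [← hnode])
    · rintro ⟨z, t', i', I', h', hl, hx⟩
      exact .mk x z t' i' I' (by rwa [hinstr]) (by rwa [hld]) (by rwa [hnode])
  unfold trace
  rw [hnode, hpo, hcoh, hsrc]

namespace Execution

variable {P : Program D Reg Q n} {S : Set (Action n)} {s s' g : State D Reg Q n}
  {es : List (Action n)}

theorem propagatesAtCommit (hg : Execution P g es) :
    PropagatesAtCommit (es.map (label g)) := by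
  intro σ₁ σ₂ t i key a he
  obtain ⟨es₁, l, rfl, rfl, hl⟩ := List.map_eq_append_iff.1 he
  obtain ⟨m, es₂, rfl, hm, rfl⟩ := List.map_eq_cons_iff.1 hl
  have hm' : m = .commit t i := by
    have := action_label (hg.ok es₁ m es₂ rfl)
    rw [hm] at this
    exact this.symm
  subst hm'
  have hst : g.IsStore t i := by
    by_contra h
    simp [label, h] at hm
  obtain ⟨es₃, rfl⟩ := hg.own es₁ t i es₂ rfl hst
  simp only [label, hst, if_true, Event.commitStore.injEq, true_and] at hm
  exact ⟨es₃.map (label g), by simp [label, hm.2]⟩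

/-- An execution is carried out by a computation, with the same trace. -/
theorem acceptedAt (hg : Execution P g es) :
    ∃ s, AcceptedAt P (es.map (label g)) s ∧ s.trace = g.trace ∧ ∀ t, s.len t = g.len t := by
  obtain ⟨s, hrun, h, hle⟩ := hg.exists_run
  have hcomm : ∀ t i, i < g.len t → i ∈ (s.thr t).committed := fun t i hi =>
    (h.mem_commit _ _).1 (hg.commit_mem t i hi)
  have hlen : ∀ t, s.len t = g.len t := fun t => by
    refine le_antisymm (hle.len_le t) (not_lt.1 fun hlt => ?_)
    exact absurd (h.com_lt _ _ (hcomm t _ hlt)) (lt_irrefl _)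
  have hinstr : s.instrAt = g.instrAt := by
    ext1 t
    ext1 i
    cases hi : s.instrAt t i with
    | none => rw [eq_comm, instrAt_eq_none_iff, ← hlen, ← instrAt_eq_none_iff, hi]
    | some I => rw [hle.instr _ _ _ hi]
  have hcmd : s.cmdAt = g.cmdAt := by
    ext1 t
    ext1 i
    rw [cmdAt, cmdAt, hinstr]
  have hload : ∀ t i, s.IsLoad t i ↔ g.IsLoad t i := fun t i => by simp [IsLoad, hcmd]
  have hstore : ∀ t i, s.IsStore t i ↔ g.IsStore t i := fun t i => by simp [IsStore, hcmd]
  have haddr : s.getAddr = g.getAddr := by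
    ext1 t
    ext1 i
    by_cases hi : i < s.len t
    · exact ((h.emb hle).getAddr_eq hi (h.com_addr _ _ (hcomm t i (by rwa [← hlen])))).symm
    · have hi' := instrAt_eq_none_iff.2 (not_lt.1 hi)
      have h₁ : s.getAddr t i = .top := by simp [getAddr_eq_top_iff, cmdAt, hi']
      have h₂ : g.getAddr t i = .top := by simp [getAddr_eq_top_iff, cmdAt, ← hinstr, hi']
      rw [h₁, h₂]
  have hld : ∀ t, (s.thr t).loaded = (g.thr t).loaded := by
    intro t
    ext1 i
    by_cases hl : g.IsLoad t i
    · obtain ⟨y, hy⟩ := Option.ne_none_iff_exists'.1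
        (h.com_ld _ _ (hcomm t i hl.lt_len) ((hload _ _).2 hl))
      rw [hy, hle.ld _ _ _ hy]
    · have h₁ : (g.thr t).loaded i = none := by
        by_contra h'
        exact hl (hg.isLoad _ _ h')
      have h₂ : (s.thr t).loaded i = none := by
        by_contra h'
        obtain ⟨y, hy⟩ := Option.ne_none_iff_exists'.1 h'
        exact hl ((hload _ _).1 (h.ld _ _ _ hy).1)
      rw [h₁, h₂]
  have hco : ∀ t i, s.co (.st t i) = g.co (.st t i) := by
    intro t i
    by_cases hst : g.IsStore t i
    · exact (hle.co _ _ (hcomm t i hst.lt_len)).symm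
    · rw [hg.co_zero _ _ hst, h.co_zero _ _ (Or.inr (by rwa [hstore]))]
  have hkey : ∀ t i x, s.LoadedKey t i x → g.LoadedKey t i x := by
    rintro t i x ⟨y, hy, rfl⟩
    refine ⟨y, by rwa [← hld], ?_⟩
    cases y with
    | init a => exact hle.co_init a
    | st t' j => exact (hco _ _).symm
  refine ⟨s, ⟨hrun, hg.propagatesAtCommit, ?_, ?_, ?_⟩, trace_congr hinstr haddr hld hco, hlen⟩
  · exact fun t i => ⟨fun hi => h.com_lt _ _ hi, fun hi => hcomm t i (hi.trans_le (hle.len_le t))⟩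
  · intro t i i' x x' hlt hl hl' ha hx hx'
    rw [haddr] at ha
    exact hg.ld t i i' x x' hlt ((hload _ _).1 hl) ((hload _ _).1 hl') ha (hkey _ _ _ hx)
      (hkey _ _ _ hx')
  · intro t i i' x hlt hl hl' ha hx
    rw [haddr] at ha
    rw [hco]
    exact hg.ld_st t i i' x hlt ((hload _ _).1 hl) ((hstore _ _).1 hl') ha (hkey _ _ _ hx)

end Execution

end Semantics

/-! ### Numberings along the happens-before relation -/

section Lists

variable {α : Type*}

theorem exists_sorted_list {β : Type*} [LinearOrder β] (F : Finset α) {κ : α → β}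
    (hκ : Set.InjOn κ F) : ∃ L : List α, (∀ x, x ∈ L ↔ x ∈ F) ∧ L.Pairwise fun x y => κ x < κ y := by
  classical
  refine ⟨F.toList.insertionSort (fun x y => κ x ≤ κ y), fun x => by simp, ?_⟩
  have hnd : (F.toList.insertionSort (fun x y => κ x ≤ κ y)).Nodup :=
    (List.perm_insertionSort _ _).nodup_iff.2 F.nodup_toList
  have : Std.Total (fun x y => κ x ≤ κ y) := ⟨fun x y => le_total _ _⟩
  have : IsTrans α (fun x y => κ x ≤ κ y) := ⟨fun x y z => le_trans⟩
  have hs := List.pairwise_insertionSort (fun x y => κ x ≤ κ y) F.toList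
  refine (hs.and hnd).imp_of_mem fun {x y} hx hy h => lt_of_le_of_ne h.1 fun he => h.2 ?_
  exact hκ (by simpa using hx) (by simpa using hy) he

theorem mem_prefix_iff {R : α → α → Prop} (hR : ∀ x y, R x y → ¬ R y x) {L₁ L₂ : List α} {m : α}
    (h : (L₁ ++ m :: L₂).Pairwise R) (e : α) : e ∈ L₁ ↔ e ∈ L₁ ++ m :: L₂ ∧ R e m := by
  rw [List.pairwise_append, List.pairwise_cons] at h
  obtain ⟨-, ⟨h₂, -⟩, h₁⟩ := h
  constructor
  · exact fun he => ⟨by simp [he], h₁ e he m (by simp)⟩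
  · rintro ⟨he, hem⟩
    rcases List.mem_append.1 he with he | he
    · exact he
    · rcases List.mem_cons.1 he with rfl | he
      · exact absurd hem (hR _ _ hem)
      · exact absurd hem (hR _ _ (h₂ e he))

theorem eq_cons_of_pairwise {R : α → α → Prop} (hR : ∀ x y, R x y → ¬ R y x) {L₁ L₂ : List α}
    {c p : α} (h : (L₁ ++ c :: L₂).Pairwise R) (hp : p ∈ L₁ ++ c :: L₂) (hcp : R c p)
    (hb : ∀ e ∈ L₁ ++ c :: L₂, R c e → ¬ R e p) : ∃ L₃, L₂ = p :: L₃ := by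
  have hp₂ : p ∈ L₂ := by
    rcases List.mem_append.1 hp with hp | hp
    · exact absurd hcp (hR _ _ ((mem_prefix_iff hR h p).1 hp).2)
    · rcases List.mem_cons.1 hp with rfl | hp
      · exact absurd hcp (hR _ _ hcp)
      · exact hp
  cases L₂ with
  | nil => simp at hp₂
  | cons q L₃ =>
    rcases List.mem_cons.1 hp₂ with rfl | hp₃
    · exact ⟨L₃, rfl⟩
    · rw [List.pairwise_append, List.pairwise_cons, List.pairwise_cons] at h
      exact absurd (h.2.1.2.1 p hp₃) (hb q (by simp) (h.2.1.1 q (by simp)))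

/-- An acyclic relation on a finite set is embedded into the order of the natural numbers. -/
theorem exists_rank (F : Finset α) (R : α → α → Prop) (hR : ∀ x, ¬ Relation.TransGen R x x) :
    ∃ r : α → ℕ, Set.InjOn r F ∧ ∀ x ∈ F, ∀ y, R x y → r x < r y := by
  classical
  have : IsPartialOrder α (Relation.ReflTransGen R) :=
    { refl := fun _ => .refl
      trans := fun _ _ _ => .trans
      antisymm := fun x y h h' => by
        rcases Relation.reflTransGen_iff_eq_or_transGen.1 h with he | h
        · exact he.symm
        · exact absurd (h.trans_left h') (hR x) }
  obtain ⟨s, hs, hle⟩ := extend_partialOrder (Relation.ReflTransGen R)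
  have key : ∀ x ∈ F, ∀ y, s x y → x ≠ y →
      (F.filter fun z => s z x ∧ z ≠ x).card < (F.filter fun z => s z y ∧ z ≠ y).card := by
    intro x hx y hxy hne
    refine Finset.card_lt_card ((Finset.ssubset_iff_of_subset fun z hz => ?_).2 ⟨x, ?_, by simp⟩)
    · rw [Finset.mem_filter] at hz ⊢
      refine ⟨hz.1, hs.trans _ _ _ hz.2.1 hxy, ?_⟩
      rintro rfl
      exact hne (hs.antisymm _ _ hxy hz.2.1)
    · simp [hx, hxy, hne]
  refine ⟨fun x => (F.filter fun z => s z x ∧ z ≠ x).card, fun x hx y hy he => ?_,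
    fun x hx y hxy => key x hx y (hle _ _ (.single hxy)) ?_⟩
  · by_contra hne
    rcases hs.total x y with h | h
    · exact absurd he (key x hx y h hne).ne
    · exact absurd he (key y hy x h (Ne.symm hne)).ne'
  · rintro rfl
    exact hR x (.single hxy)

end Lists

section Semantics

variable {D : Type u} {Reg : Type v} {Q : Type w} {n : ℕ}

open State

/-- The fetched instructions. -/
def State.insts (g : State D Reg Q n) : Finset (Fin n × ℕ) :=
  Finset.univ.biUnion fun t => (Finset.range (g.len t)).image fun i => (t, i)

theorem State.mem_insts {g : State D Reg Q n} {x : Fin n × ℕ} : x ∈ g.insts ↔ x.2 < g.len x.1 := by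
  obtain ⟨t, i⟩ := x
  simp [insts]

variable [Zero D]

/-- A numbering of the instructions along which the happens-before relation increases. -/
structure Ranking (g : State D Reg Q n) (r : Fin n × ℕ → ℕ) : Prop where
  inj : ∀ t i t' i', i < g.len t → i' < g.len t' → r (t, i) = r (t', i') → t = t' ∧ i = i'
  po : ∀ t i j, i < j → j < g.len t → r (t, i) < r (t, j)
  src : ∀ t i t' j, i < g.len t → j < g.len t' → (g.thr t).loaded i = some (.st t' j) →
    r (t', j) < r (t, i)
  co : ∀ t i t' i', g.IsStore t i → g.IsStore t' i' → g.getAddr t i = g.getAddr t' i' →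
    g.co (.st t i) < g.co (.st t' i') → r (t, i) < r (t', i')
  cf_init : ∀ t i a t' i', i < g.len t → (g.thr t).loaded i = some (.init a) → g.IsStore t' i' →
    g.getAddr t' i' = .val a → r (t, i) < r (t', i')
  cf : ∀ t i t₁ i₁ t' i', i < g.len t → (g.thr t).loaded i = some (.st t₁ i₁) →
    g.IsStore t₁ i₁ → g.IsStore t' i' → g.getAddr t₁ i₁ = g.getAddr t' i' →
    g.co (.st t₁ i₁) < g.co (.st t' i') → r (t, i) < r (t', i')

/-- The number of an instruction plus one; `0` for the initial stores. -/
def nodeRank (r : Fin n × ℕ → ℕ) : Node D Reg Q n → ℕ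
  | .init _ => 0
  | .inst t i _ => r (t, i) + 1

theorem Ranking.not_cyclic {g : State D Reg Q n} {r : Fin n × ℕ → ℕ} (h : Ranking g r) :
    ¬ g.trace.Cyclic := by
  have key : ∀ x y, g.trace.HappensBefore x y → nodeRank r x < nodeRank r y := by
    rintro x y (hxy | hxy | hxy | ⟨z, hzx, hzy⟩)
    · obtain ⟨t, i, I, I', hI, hI'⟩ := hxy
      have := h.po t i (i + 1) (by omega) (lt_len_of_instrAt hI')
      simpa [nodeRank] using this
    · obtain ⟨t, i, I, t', i', I', hI, hI', hst, hst', ha, hlt⟩ | ⟨a, t', i', I', hI', hst', ha⟩ :=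
        hxy
      · have := h.co t i t' i' ((isStore_of_instrAt hI).2 hst) ((isStore_of_instrAt hI').2 hst') ha
          hlt
        simpa [nodeRank] using this
      · simp [nodeRank]
    · obtain ⟨z, t', i', I', hI', hl, hx⟩ := hxy
      obtain ⟨a⟩ | ⟨t, i, I, hI⟩ := hx
      · simp [nodeRank]
      · have := h.src _ _ _ _ (lt_len_of_instrAt hI') (lt_len_of_instrAt hI) hl
        simpa [nodeRank] using this
    · obtain ⟨y', t', i', I', hI', hl, hx⟩ := hzx
      obtain ⟨a⟩ | ⟨t, i, I, hI⟩ := hx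
      · obtain _ | ⟨a, t₂, i₂, I₂, hI₂, hst₂, ha⟩ := hzy
        have := h.cf_init _ _ _ t₂ i₂ (lt_len_of_instrAt hI') hl ((isStore_of_instrAt hI₂).2 hst₂)
          ha
        simpa [nodeRank] using this
      · obtain ⟨t, i, I, t₂, i₂, I₂, hI, hI₂, hst, hst', ha, hlt⟩ | _ := hzy
        have := h.cf _ _ _ _ t₂ i₂ (lt_len_of_instrAt hI') hl ((isStore_of_instrAt hI).2 hst)
          ((isStore_of_instrAt hI₂).2 hst') ha hlt
        simpa [nodeRank] using this
  rintro ⟨x, hx⟩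
  have : ∀ y, Relation.TransGen g.trace.HappensBefore x y → nodeRank r x < nodeRank r y := by
    intro y hy
    induction hy with
    | single h => exact key _ _ h
    | tail _ h ih => exact ih.trans (key _ _ h)
  exact lt_irrefl _ (this x hx)

/-- If the happens-before relation is acyclic, then some numbering increases along it. -/
theorem exists_ranking {g : State D Reg Q n} (h : ¬ g.trace.Cyclic) : ∃ r, Ranking g r := by
  let N : Fin n × ℕ → Node D Reg Q n := fun x =>
    match g.instrAt x.1 x.2 with
    | some I => .inst x.1 x.2 I
    | none => .init 0
  have hN : ∀ {t i I}, g.instrAt t i = some I → N (t, i) = .inst t i I := fun {t i I} hI => by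
    simp only [N, hI]
  obtain ⟨r, hinj, hr⟩ := exists_rank g.insts (fun x y => g.trace.HappensBefore (N x) (N y)) (by
    intro x hx
    refine h ⟨N x, ?_⟩
    exact Relation.TransGen.lift N (fun _ _ h => h) _ _ hx)
  have hr' : ∀ {t i I t' i' I'}, g.instrAt t i = some I → g.instrAt t' i' = some I' →
      g.trace.HappensBefore (.inst t i I) (.inst t' i' I') → r (t, i) < r (t', i') :=
    fun hI hI' hb => hr _ (mem_insts.2 (lt_len_of_instrAt hI)) _ (by rwa [hN hI, hN hI'])
  refine ⟨r, ?_, ?_, ?_, ?_, ?_, ?_⟩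
  · intro t i t' i' hi hi' he
    simpa using hinj (mem_insts.2 hi) (mem_insts.2 hi') he
  · intro t i j hij hj
    induction j, hij using Nat.le_induction with
    | base =>
      obtain ⟨I, hI⟩ := instrAt_eq_some_of_lt (show i < g.len t by omega)
      obtain ⟨I', hI'⟩ := instrAt_eq_some_of_lt hj
      exact hr' hI hI' (Or.inl (.mk t i I I' hI hI'))
    | succ j hij ih =>
      obtain ⟨I, hI⟩ := instrAt_eq_some_of_lt (show j < g.len t by omega)
      obtain ⟨I', hI'⟩ := instrAt_eq_some_of_lt hj
      exact (ih (by omega)).trans (hr' hI hI' (Or.inl (.mk t j I I' hI hI')))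
  · intro t i t' j hi hj hl
    obtain ⟨I, hI⟩ := instrAt_eq_some_of_lt hi
    obtain ⟨I', hI'⟩ := instrAt_eq_some_of_lt hj
    exact hr' hI' hI (Or.inr (Or.inr (Or.inl (.mk _ _ t i I hI hl (.st t' j I' hI')))))
  · intro t i t' i' hst hst' ha hlt
    obtain ⟨I, hI⟩ := instrAt_eq_some_of_lt hst.lt_len
    obtain ⟨I', hI'⟩ := instrAt_eq_some_of_lt hst'.lt_len
    exact hr' hI hI' (Or.inr (Or.inl (.st t i I t' i' I' hI hI' ((isStore_of_instrAt hI).1 hst)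
      ((isStore_of_instrAt hI').1 hst') ha hlt)))
  · intro t i a t' i' hi hl hst ha
    obtain ⟨I, hI⟩ := instrAt_eq_some_of_lt hi
    obtain ⟨I', hI'⟩ := instrAt_eq_some_of_lt hst.lt_len
    exact hr' hI hI' (Or.inr (Or.inr (Or.inr ⟨.init a, .mk _ _ t i I hI hl (.init a),
      .init a t' i' I' hI' ((isStore_of_instrAt hI').1 hst) ha⟩)))
  · intro t i t₁ i₁ t' i' hi hl hst hst' ha hlt
    obtain ⟨I, hI⟩ := instrAt_eq_some_of_lt hi
    obtain ⟨I₁, hI₁⟩ := instrAt_eq_some_of_lt hst.lt_len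
    obtain ⟨I', hI'⟩ := instrAt_eq_some_of_lt hst'.lt_len
    exact hr' hI hI' (Or.inr (Or.inr (Or.inr ⟨.inst t₁ i₁ I₁, .mk _ _ t i I hI hl
      (.st t₁ i₁ I₁ hI₁), .st t₁ i₁ I₁ t' i' I' hI₁ hI' ((isStore_of_instrAt hI₁).1 hst)
      ((isStore_of_instrAt hI').1 hst') ha hlt⟩)))

end Semantics

/-! ### Sequentially consistent computations from acyclic executions -/

section Semantics

variable {D : Type u} {Reg : Type v} {Q : Type w} {n : ℕ}

open State

/-- The place of an action among the actions of its instruction in an atomic execution. -/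
def Action.kind : Action n → ℕ
  | fetch _ _ => 0
  | load _ _ => 1
  | commit _ _ => 2
  | prop t t' _ => if t = t' then 3 else 4 + t

open Classical in
/-- The actions of an instruction in an atomic execution. -/
noncomputable def block (g : State D Reg Q n) (x : Fin n × ℕ) : List (Action n) :=
  if g.IsLoad x.1 x.2 then [.fetch x.1 x.2, .load x.1 x.2, .commit x.1 x.2]
  else if g.IsStore x.1 x.2 then
    .fetch x.1 x.2 :: .commit x.1 x.2 ::
      (x.1 :: (List.finRange n).filter fun t => t ≠ x.1).map fun t => .prop t x.1 x.2
  else [.fetch x.1 x.2, .commit x.1 x.2]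

/-- The actions of the fetched instructions, with all propagations of stores. -/
def Relevant (g : State D Reg Q n) : Action n → Prop
  | .fetch t i => i < g.len t
  | .load t i => g.IsLoad t i
  | .commit t i => i < g.len t
  | .prop _ t' i => g.IsStore t' i

theorem mem_block {g : State D Reg Q n} {x : Fin n × ℕ} (hx : x.2 < g.len x.1) {m : Action n} :
    m ∈ block g x ↔ m.inst = x ∧ Relevant g m := by
  obtain ⟨t, i⟩ := x
  by_cases hl : g.IsLoad t i
  · have hst := hl.not_isStore
    cases m <;> simp [block, hl, Action.inst, Relevant] <;> intros <;> subst_vars <;> simp_all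
  · by_cases hst : g.IsStore t i
    · cases m with
      | prop t₁ t₂ j =>
        simp only [block, hl, hst, if_true, if_false, Action.inst, Relevant]
        by_cases ht : t₁ = t
        · simp [ht]
          grind
        · simp [ht]
          grind
      | _ => simp [block, hl, hst, Action.inst, Relevant]; try (intros; subst_vars; simp_all)
    · cases m <;> simp [block, hl, hst, Action.inst, Relevant] <;> intros <;> subst_vars <;>
        simp_all

theorem pairwise_block (g : State D Reg Q n) (x : Fin n × ℕ) :
    (block g x).Pairwise fun e e' => e.kind < e'.kind := by
  unfold block
  split_ifs
  · simp [Action.kind]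
  · have h₁ : ∀ t, 2 < (Action.prop t x.1 x.2).kind := fun t => by
      simp only [Action.kind]
      split_ifs <;> omega
    refine List.pairwise_cons.2 ⟨?_, List.pairwise_cons.2 ⟨?_, ?_⟩⟩
    · intro e he
      rcases List.mem_cons.1 he with rfl | he
      · simp [Action.kind]
      · obtain ⟨t, -, rfl⟩ := List.mem_map.1 he
        have := h₁ t
        simp only [Action.kind] at this ⊢
        omega
    · intro e he
      obtain ⟨t, -, rfl⟩ := List.mem_map.1 he
      exact h₁ t
    · rw [List.pairwise_map, List.pairwise_cons]
      constructor
      · intro t ht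
        have : t ≠ x.1 := by simpa using ht
        simp only [Action.kind, if_true, this, if_false]
        omega
      · refine ((List.pairwise_lt_finRange n).filter _).imp_of_mem fun {t t'} ht ht' h => ?_
        have h₁ : t ≠ x.1 := by simpa using ht
        have h₂ : t' ≠ x.1 := by simpa using ht'
        simp only [Action.kind, h₁, h₂, if_false]
        exact Nat.add_lt_add_left h 4
  · simp [Action.kind]

variable [Zero D]

namespace Execution

variable {P : Program D Reg Q n} {g : State D Reg Q n} {es : List (Action n)}

theorem exists_ok (hg : Execution P g es) {m : Action n} (hm : m ∈ es) :
    ∃ es₁ es₂, es = es₁ ++ m :: es₂ ∧ Ok g {e | e ∈ es₁} m := by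
  obtain ⟨es₁, es₂, he⟩ := List.append_of_mem hm
  exact ⟨es₁, es₂, he, hg.ok _ _ _ he⟩

theorem load_mem (hg : Execution P g es) {t : Fin n} {i : ℕ} (h : g.IsLoad t i) :
    .load t i ∈ es := by
  obtain ⟨es₁, es₂, rfl, hok⟩ := hg.exists_ok (hg.commit_mem t i h.lt_len)
  exact List.mem_append_left _ (hok.2.2.2.2 h)

theorem fetch_mem (hg : Execution P g es) {t : Fin n} {i : ℕ} (h : i < g.len t) :
    .fetch t i ∈ es := by
  obtain ⟨es₁, es₂, rfl, hok⟩ := hg.exists_ok (hg.commit_mem t i h)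
  exact List.mem_append_left _ hok.1

theorem prop_self_mem (hg : Execution P g es) {t : Fin n} {i : ℕ} (h : g.IsStore t i) :
    .prop t t i ∈ es := by
  obtain ⟨es₁, es₂, he⟩ := List.append_of_mem (hg.commit_mem t i h.lt_len)
  obtain ⟨es₃, rfl⟩ := hg.own es₁ t i es₂ he h
  simp [he]

theorem isStore_of_prop_mem (hg : Execution P g es) {t t' : Fin n} {i : ℕ}
    (h : .prop t t' i ∈ es) : g.IsStore t' i := by
  obtain ⟨es₁, es₂, rfl, hok⟩ := hg.exists_ok h
  exact hok.1

/-- A load reads an initial store or a store which has been propagated to its thread at some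
time. -/
theorem load_source (hg : Execution P g es) {t : Fin n} {i : ℕ} (h : g.IsLoad t i) :
    ∃ a y, g.getAddr t i = .val a ∧ (g.thr t).loaded i = some y ∧ (y = .init a ∨
      ∃ t' j, y = .st t' j ∧ g.IsStore t' j ∧ g.getAddr t' j = .val a ∧ .prop t t' j ∈ es) := by
  obtain ⟨es₁, es₂, he, hok⟩ := hg.exists_ok (hg.load_mem h)
  obtain ⟨-, -, -, -, a, y, ha, hy, hsrc⟩ := hok
  refine ⟨a, y, ha, hy, ?_⟩
  rcases hsrc with hlast | ⟨i', rfl, hearly⟩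
  · rcases hlast.mem with hy | ⟨t', j, hy, hm, haj⟩
    · exact Or.inl hy
    · have hm' : .prop t t' j ∈ es := by
        rw [he]
        exact List.mem_append_left _ hm
      exact Or.inr ⟨t', j, hy, hg.isStore_of_prop_mem hm', haj, hm'⟩
  · exact Or.inr ⟨t, i', rfl, hearly.store, hearly.addr, hg.prop_self_mem hearly.store⟩

/-- A reordering of an execution in which all actions are enabled, possibly with further actions, is
an execution with the same final state. -/
theorem reorder (hg : Execution P g es) {L : List (Action n)}
    (ok : ∀ es₁ m es₂, L = es₁ ++ m :: es₂ → Ok g {e | e ∈ es₁} m)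
    (own : ∀ es₁ t i es₂, L = es₁ ++ .commit t i :: es₂ → g.IsStore t i →
      ∃ es₃, es₂ = .prop t t i :: es₃)
    (commit_mem : ∀ t i, i < g.len t → .commit t i ∈ L) : Execution P g L :=
  { hg with ok := ok, own := own, commit_mem := commit_mem }

end Execution

/-- The blocks of an atomic execution, with their data. -/
theorem atomicBlock_block {g : State D Reg Q n} {x : Fin n × ℕ} (hx : x.2 < g.len x.1) :
    AtomicBlock ((block g x).map (label g)) := by
  obtain ⟨t, i⟩ := x
  obtain ⟨I, hI⟩ := instrAt_eq_some_of_lt hx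
  by_cases hl : g.IsLoad t i
  · have hst := hl.not_isStore
    have := AtomicBlock.load (Q := Q) t i I (g.getAddr t i).getD ((isLoad_of_instrAt hI).1 hl)
    simpa [block, hl, hst, label, hI] using this
  · by_cases hst : g.IsStore t i
    · have := AtomicBlock.store (Q := Q) t i I (g.co (.st t i)) (g.getAddr t i).getD
        ((List.finRange n).filter fun t' => t' ≠ t) ((isStore_of_instrAt hI).1 hst)
        (by simp [(List.nodup_finRange n).filter]) (by
          intro t'
          by_cases h : t' = t <;> simp [h])
      simpa [block, hl, hst, label, hI, Function.comp_def] using this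
    · have := AtomicBlock.loc (Q := Q) t i I ((isLoad_of_instrAt hI).not.1 hl)
        ((isStore_of_instrAt hI).not.1 hst)
      simpa [block, hl, hst, label, hI] using this

/-- The order of the actions in the atomic execution along the numbering `r`. -/
def AtomicLT (r : Fin n × ℕ → ℕ) (e e' : Action n) : Prop :=
  r e.inst < r e'.inst ∨ (e.inst = e'.inst ∧ e.kind < e'.kind)

theorem AtomicLT.asymm {r : Fin n × ℕ → ℕ} (e e' : Action n) (h : AtomicLT r e e') :
    ¬ AtomicLT r e' e := by
  rintro (h' | ⟨h₁', h₂'⟩) <;> rcases h with h | ⟨h₁, h₂⟩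
  · omega
  · rw [h₁] at h'
    omega
  · rw [h₁'] at h
    omega
  · omega

namespace Execution

variable {P : Program D Reg Q n} {g : State D Reg Q n} {es : List (Action n)}

/-- When the instructions are executed atomically in the order of a ranking, every load finds the
store it reads from in memory. -/
theorem ok_atomic (hg : Execution P g es) {r : Fin n × ℕ → ℕ} (hr : Ranking g r) {m : Action n}
    (hm : Relevant g m) : Ok g {e | Relevant g e ∧ AtomicLT r e m} m := by
  have hpo : ∀ {e m : Action n} {t i j}, e.inst = (t, i) → m.inst = (t, j) → i < j →
      j < g.len t → AtomicLT r e m := fun he hm hij hj => by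
    left
    rw [he, hm]
    exact hr.po _ _ _ hij hj
  cases m with
  | fetch t i =>
    exact ⟨hm, fun j hj => ⟨hj.trans hm, hpo rfl rfl hj hm⟩, fun h => h.2.asymm _ _ h.2⟩
  | load t i =>
    have hi := IsLoad.lt_len hm
    refine ⟨hm, ⟨hi, Or.inr ⟨rfl, by simp [Action.kind]⟩⟩, fun h => h.2.asymm _ _ h.2,
      fun j hj hl => ⟨hl, hpo rfl rfl (lt_of_mem_addrDeps hj) hi⟩, ?_⟩
    obtain ⟨a, y, ha, hy, hsrc⟩ := hg.load_source hm
    refine ⟨a, y, ha, hy, Or.inl ⟨?_, ?_⟩⟩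
    · rcases hsrc with rfl | ⟨t', j, rfl, hst, haj, -⟩
      · exact Or.inl rfl
      · exact Or.inr ⟨t', j, rfl, ⟨hst, Or.inl (hr.src _ _ _ _ hi hst.lt_len hy)⟩, haj⟩
    · rintro t' j ⟨hst : g.IsStore t' j, hlt⟩ haj
      have hlt' : r (t', j) < r (t, i) := by
        rcases hlt with hlt | ⟨hlt, -⟩
        · exact hlt
        · cases hlt
          exact absurd hst (IsLoad.not_isStore hm)
      by_contra hco
      rw [not_le] at hco
      rcases hsrc with rfl | ⟨t₁, j₁, rfl, hst₁, ha₁, -⟩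
      · have := hr.cf_init t i a t' j hi hy hst haj
        omega
      · have := hr.cf t i t₁ j₁ t' j hi hy hst₁ hst (by rw [ha₁, haj]) hco
        omega
  | commit t i =>
    have hi : i < g.len t := hm
    have hC : ∀ j < i, Action.commit t j ∈ {e | Relevant g e ∧ AtomicLT r e (.commit t i)} :=
      fun j hj => ⟨hj.trans hi, hpo rfl rfl hj hi⟩
    refine ⟨⟨hi, Or.inr ⟨rfl, by simp [Action.kind]⟩⟩, fun h => h.2.asymm _ _ h.2, ?_, ?_, ?_⟩
    · rintro j ((hj | hj) | hj)
      · exact hC j (lt_of_mem_addrDeps hj)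
      · exact hC j (lt_of_mem_dataDeps hj)
      · exact hC j hj.1
    · exact fun _ j hj _ => ⟨fun k hk hl => ⟨hl, hpo rfl rfl ((lt_of_mem_addrDeps hk).trans hj) hi⟩,
        fun _ => hC j hj⟩
    · exact fun hl => ⟨hl, Or.inr ⟨rfl, by simp [Action.kind]⟩⟩
  | prop t t' i =>
    have hst : g.IsStore t' i := hm
    refine ⟨hst, ⟨hst.lt_len, Or.inr ⟨rfl, ?_⟩⟩, ?_⟩
    · simp only [Action.kind]
      split_ifs <;> omega
    · rintro t'' j ⟨hst' : g.IsStore t'' j, hlt⟩ ha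
      rcases hlt with hlt | ⟨hlt, hk⟩
      · rcases lt_trichotomy (g.co (.st t'' j)) (g.co (.st t' i)) with h | h | h
        · exact h
        · obtain ⟨rfl, rfl⟩ := hg.co_inj _ _ _ _ hst' hst h
          exact absurd hlt (lt_irrefl _)
        · have h₁ := hr.co _ _ _ _ hst hst' ha.symm h
          have h₂ : r (t'', j) < r (t', i) := hlt
          omega
      · cases hlt
        exact absurd hk (lt_irrefl _)

/-- An execution with an acyclic happens-before relation is that of an SC computation. -/
theorem exists_sc (hg : Execution P g es) {r : Fin n × ℕ → ℕ} (hr : Ranking g r) :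
    g.trace ∈ traces P (scComputations P) := by
  obtain ⟨xs, hxs, hpw⟩ := exists_sorted_list g.insts (κ := r) fun x hx y hy h => by
    obtain ⟨h₁, h₂⟩ := hr.inj x.1 x.2 y.1 y.2 (mem_insts.1 hx) (mem_insts.1 hy) h
    exact Prod.ext h₁ h₂
  set L := xs.flatMap (block g) with hL
  have hmem : ∀ m, m ∈ L ↔ Relevant g m := by
    intro m
    rw [hL, List.mem_flatMap]
    constructor
    · rintro ⟨x, hx, hm⟩
      exact ((mem_block (mem_insts.1 ((hxs x).1 hx))).1 hm).2
    · intro hm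
      have hlt : m.inst.2 < g.len m.inst.1 := by
        cases m with
        | fetch => exact hm
        | load => exact IsLoad.lt_len hm
        | commit => exact hm
        | prop => exact IsStore.lt_len hm
      exact ⟨m.inst, (hxs _).2 (mem_insts.2 hlt), (mem_block hlt).2 ⟨rfl, hm⟩⟩
  have hLpw : L.Pairwise (AtomicLT r) := by
    rw [hL, List.pairwise_flatMap]
    constructor
    · intro x hx
      have hlt := mem_insts.1 ((hxs x).1 hx)
      refine (pairwise_block g x).imp_of_mem fun {e e'} he he' h => Or.inr ⟨?_, h⟩
      rw [((mem_block hlt).1 he).1, ((mem_block hlt).1 he').1]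
    · refine hpw.imp_of_mem fun {x y} hx hy h e he e' he' => Or.inl ?_
      rwa [((mem_block (mem_insts.1 ((hxs x).1 hx))).1 he).1,
        ((mem_block (mem_insts.1 ((hxs y).1 hy))).1 he').1]
  have hex : Execution P g L := by
    refine hg.reorder ?_ ?_ fun t i hi => (hmem _).2 hi
    · intro es₁ m es₂ he
      have hm : Relevant g m := (hmem m).1 (by simp [he])
      have : {e | e ∈ es₁} = {e | Relevant g e ∧ AtomicLT r e m} := by
        ext e
        rw [Set.mem_ofPred_eq, Set.mem_ofPred_eq, ← hmem]
        rw [he] at hLpw ⊢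
        exact mem_prefix_iff AtomicLT.asymm hLpw e
      rw [this]
      exact hg.ok_atomic hr hm
    · intro es₁ t i es₂ he hst
      have hp : .prop t t i ∈ L := (hmem _).2 hst
      rw [he] at hLpw hp
      refine eq_cons_of_pairwise AtomicLT.asymm hLpw hp (Or.inr ⟨rfl, by simp [Action.kind]⟩) ?_
      rintro e - (h | ⟨h, hk⟩) (h' | ⟨h', hk'⟩)
      · simp only [Action.inst] at h h'
        omega
      · rw [h'] at h
        simp [Action.inst] at h
      · rw [← h] at h'
        simp [Action.inst] at h'
      · simp [Action.kind] at hk hk'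
        omega
  obtain ⟨s, hs, htr, -⟩ := hex.acceptedAt
  refine ⟨L.map (label g), ⟨⟨s, hs⟩, xs.map fun x => (block g x).map (label g), ?_, ?_⟩, s, hs, htr⟩
  · intro b hb
    obtain ⟨x, hx, rfl⟩ := List.mem_map.1 hb
    exact atomicBlock_block (mem_insts.1 ((hxs x).1 hx))
  · rw [hL, List.map_flatMap, List.flatMap_def]

end Execution

end Semantics

/-! ### Acyclicity of the traces of sequentially consistent computations -/

section Lists

theorem nodup_of_forall_split {α : Type*} {L : List α}
    (h : ∀ L₁ m L₂, L = L₁ ++ m :: L₂ → m ∉ L₁) : L.Nodup := by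
  induction L using List.reverseRecOn with
  | nil => exact List.nodup_nil
  | append_singleton L a ih =>
    rw [List.nodup_append]
    refine ⟨ih fun L₁ m L₂ he => h L₁ m (L₂ ++ [a]) (by simp [he]), by simp, ?_⟩
    intro b hb c hc hbc
    rw [List.mem_singleton] at hc
    subst hc hbc
    exact h L b [] rfl hb

/-- In a sequence of blocks, each of which starts with the fetch of its instruction, the
instructions are ordered by their blocks. -/
theorem exists_block_rank {n : ℕ} (bs : List (List (Action n)))
    (h : ∀ b ∈ bs, ∃ x : Fin n × ℕ, (∃ l, b = .fetch x.1 x.2 :: l) ∧ ∀ e ∈ b, e.inst = x)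
    (hnd : bs.flatten.Nodup) : ∃ r : Fin n × ℕ → ℕ,
      bs.flatten.Pairwise (fun e e' => r e.inst ≤ r e'.inst) ∧
      (∀ e ∈ bs.flatten, .fetch e.inst.1 e.inst.2 ∈ bs.flatten) ∧
      Set.InjOn r {x | .fetch x.1 x.2 ∈ bs.flatten} := by
  induction bs with
  | nil => exact ⟨fun _ => 0, by simp, by simp, by simp⟩
  | cons b bs ih =>
    obtain ⟨x₀, ⟨l, rfl⟩, hb⟩ := h b (by simp)
    rw [List.flatten_cons, List.nodup_append] at hnd
    obtain ⟨r, hpw, hf, hinj⟩ := ih (fun b hb => h b (by simp [hb])) hnd.2.1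
    have hnot : .fetch x₀.1 x₀.2 ∉ bs.flatten := fun hm => hnd.2.2 _ (by simp) _ hm rfl
    have hne : ∀ e ∈ bs.flatten, e.inst ≠ x₀ := by
      rintro e he rfl
      exact hnot (hf e he)
    refine ⟨fun x => if x = x₀ then 0 else r x + 1, ?_, ?_, ?_⟩
    · rw [List.flatten_cons, List.pairwise_append]
      refine ⟨?_, ?_, ?_⟩
      · refine List.pairwise_of_forall_mem_list fun e he e' he' => ?_
        simp [hb e he]
      · refine hpw.imp_of_mem fun {e e'} he he' hee' => ?_
        simp [hne e he, hne e' he', hee']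
      · intro e he e' he'
        simp [hb e he]
    · intro e he
      rw [List.flatten_cons, List.mem_append] at he ⊢
      rcases he with he | he
      · rw [hb e he]
        exact Or.inl (by simp)
      · exact Or.inr (hf e he)
    · intro x hx y hy hxy
      have key : ∀ z : Fin n × ℕ, z ≠ x₀ →
          Action.fetch z.1 z.2 ∈ (List.cons (Action.fetch x₀.1 x₀.2 :: l) bs).flatten →
          Action.fetch z.1 z.2 ∈ bs.flatten := by
        intro z hz hm
        rw [List.flatten_cons, List.mem_append] at hm
        exact hm.resolve_left fun hm => hz (hb _ hm)
      by_cases h₁ : x = x₀ <;> by_cases h₂ : y = x₀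
      · rw [h₁, h₂]
      · simp [h₁, h₂] at hxy
      · simp [h₁, h₂] at hxy
      · simp only [h₁, h₂, if_false, Nat.add_right_cancel_iff] at hxy
        exact hinj (key x h₁ hx) (key y h₂ hy) hxy

end Lists

section Semantics

variable {D : Type u} {Reg : Type v} {Q : Type w} {n : ℕ}

theorem AtomicBlock.exists_inst {b : List (Event D Reg Q n)} (h : AtomicBlock b) :
    ∃ x : Fin n × ℕ, (∃ l, b.map Event.action = .fetch x.1 x.2 :: l) ∧
      ∀ e ∈ b.map Event.action, e.inst = x := by
  cases h with
  | load t i I a hI => exact ⟨(t, i), ⟨_, rfl⟩, by simp [Event.action, Action.inst]⟩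
  | loc t i I hI hI' => exact ⟨(t, i), ⟨_, rfl⟩, by simp [Event.action, Action.inst]⟩
  | store t i I key a others hI =>
    refine ⟨(t, i), ⟨_, rfl⟩, ?_⟩
    simp [Event.action, Action.inst]

variable [Zero D]

open State

namespace Execution

variable {P : Program D Reg Q n} {g : State D Reg Q n} {es : List (Action n)}

/-- An action is enabled only if it has not been performed yet. -/
theorem nodup (hg : Execution P g es) : es.Nodup := by
  refine nodup_of_forall_split fun es₁ m es₂ he hm => ?_
  have hok := hg.ok es₁ m es₂ he
  cases m with
  | fetch => exact hok.2.2 hm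
  | load => exact hok.2.2.1 hm
  | commit => exact hok.2.1 hm
  | prop => exact absurd (hok.2.2 _ _ hm rfl) (lt_irrefl _)

/-- If the events of the instructions do not overlap and every store is propagated to all threads,
then the order of the instructions is a ranking. -/
theorem ranking_of_blocks (hg : Execution P g es) {r : Fin n × ℕ → ℕ}
    (hpw : es.Pairwise (fun e e' => r e.inst ≤ r e'.inst))
    (hinj : Set.InjOn r {x | .fetch x.1 x.2 ∈ es})
    (hall : ∀ t t' i, g.IsStore t' i → .prop t t' i ∈ es) : Ranking g r := by
  have hinj' : ∀ t i t' i', i < g.len t → i' < g.len t' → r (t, i) = r (t', i') →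
      t = t' ∧ i = i' := fun t i t' i' hi hi' h => by
    simpa using hinj (hg.fetch_mem hi : (t, i) ∈ {x | Action.fetch x.1 x.2 ∈ es})
      (hg.fetch_mem hi' : (t', i') ∈ {x | Action.fetch x.1 x.2 ∈ es}) h
  -- Instructions of the same thread are fetched in program order.
  have hpo : ∀ t i j, i < j → j < g.len t → r (t, i) < r (t, j) := by
    intro t i j hij hj
    obtain ⟨es₁, es₂, rfl, hok⟩ := hg.exists_ok (hg.fetch_mem hj)
    rw [List.pairwise_append] at hpw
    refine lt_of_le_of_ne (hpw.2.2 _ (hok.2.1 i hij) (.fetch t j) (by simp)) fun h => ?_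
    have := (hinj' _ _ _ _ (by omega) hj h).2
    omega
  have hne : ∀ {t i t' i'}, g.IsLoad t i → g.IsStore t' i' → r (t, i) ≠ r (t', i') := by
    intro t i t' i' hl hst h
    obtain ⟨rfl, rfl⟩ := hinj' _ _ _ _ hl.lt_len hst.lt_len h
    exact hl.not_isStore hst
  -- Loads read the last store in memory.
  have hload : ∀ t i y, (g.thr t).loaded i = some y → ∃ a es₁ es₂, es = es₁ ++ .load t i :: es₂ ∧
      g.getAddr t i = .val a ∧ g.IsLast {e | e ∈ es₁} t a y := by
    intro t i y hy
    have hl := hg.isLoad t i (by simp [hy])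
    obtain ⟨es₁, es₂, rfl, hok⟩ := hg.exists_ok (hg.load_mem hl)
    obtain ⟨-, -, -, -, a, y', ha, hy', hsrc⟩ := hok
    rw [hy] at hy'
    cases hy'
    refine ⟨a, es₁, es₂, rfl, ha, ?_⟩
    rcases hsrc with hlast | ⟨i', rfl, he⟩
    · exact hlast
    · have hlt := hpo t i' i he.lt hl.lt_len
      have hmem : .commit t i' ∈ es₂ := by
        have := hg.commit_mem t i' he.store.lt_len
        rcases List.mem_append.1 this with h | h
        · exact absurd h he.not_committed
        · simpa using h
      rw [List.pairwise_append, List.pairwise_cons] at hpw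
      have : r (t, i) ≤ r (t, i') := hpw.2.1.1 _ hmem
      omega
  -- What has not been propagated before a load comes later.
  have hcf : ∀ t i es₁ es₂ t' i', es = es₁ ++ .load t i :: es₂ → g.IsLoad t i → g.IsStore t' i' →
      .prop t t' i' ∉ es₁ → r (t, i) < r (t', i') := by
    rintro t i es₁ es₂ t' i' rfl hl hst hn
    have hmem : .prop t t' i' ∈ es₂ := by
      rcases List.mem_append.1 (hall t t' i' hst) with h | h
      · exact absurd h hn
      · simpa using h
    rw [List.pairwise_append, List.pairwise_cons] at hpw
    exact lt_of_le_of_ne (hpw.2.1.1 _ hmem) (hne hl hst)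
  refine ⟨hinj', hpo, ?_, ?_, ?_, ?_⟩
  · intro t i t' j hi hj hy
    have hl := hg.isLoad t i (by simp [hy])
    obtain ⟨a, es₁, es₂, rfl, ha, hlast⟩ := hload t i _ hy
    rcases hlast.mem with h | ⟨t₁, i₁, h, hm, -⟩
    · cases h
    · cases h
      have hst := hg.isStore_of_prop_mem (List.mem_append_left _ hm)
      rw [List.pairwise_append] at hpw
      exact lt_of_le_of_ne (hpw.2.2 _ hm (.load t i) (by simp)) (hne hl hst).symm
  · intro t i t' i' hst hst' ha hlt
    by_contra hr
    obtain ⟨es₁, es₂, rfl, hok⟩ := hg.exists_ok (hall t t i hst)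
    have hne' : ¬ (t = t' ∧ i = i') := by
      rintro ⟨rfl, rfl⟩
      exact lt_irrefl _ hlt
    rcases List.mem_append.1 (hall t t' i' hst') with h | h
    · have := hok.2.2 t' i' h ha.symm
      exact lt_asymm hlt this
    · rcases List.mem_cons.1 h with h | h
      · cases h
        exact hne' ⟨rfl, rfl⟩
      · rw [List.pairwise_append, List.pairwise_cons] at hpw
        have : r (t, i) ≤ r (t', i') := hpw.2.1.1 _ h
        exact hne' (hinj' _ _ _ _ hst.lt_len hst'.lt_len (by omega))
  · intro t i a t' i' hi hy hst ha
    have hl := hg.isLoad t i (by simp [hy])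
    obtain ⟨a', es₁, es₂, he, -, hlast⟩ := hload t i _ hy
    refine hcf t i es₁ es₂ t' i' he hl hst fun hm => ?_
    obtain rfl : a = a' := by
      rcases hlast.mem with h | ⟨t₁, i₁, h, -⟩
      · cases h
        rfl
      · cases h
    have := hlast.max t' i' hm ha
    rw [hg.co_init] at this
    exact absurd (hg.co_pos _ _ hst) (not_lt.2 this)
  · intro t i t₁ i₁ t' i' hi hy hst₁ hst ha hlt
    have hl := hg.isLoad t i (by simp [hy])
    obtain ⟨a', es₁, es₂, he, -, hlast⟩ := hload t i _ hy
    refine hcf t i es₁ es₂ t' i' he hl hst fun hm => ?_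
    rcases hlast.mem with h | ⟨t₂, i₂, h, -, ha₂⟩
    · cases h
    · cases h
      exact absurd (hlast.max t' i' hm (by rw [← ha, ha₂])) (not_le.2 hlt)

end Execution

/-- SC computations have acyclic happens-before relations. -/
theorem not_cyclic_of_sc {P : Program D Reg Q n} {T : Trace D Reg Q n}
    (h : T ∈ traces P (scComputations P)) : ¬ T.Cyclic := by
  obtain ⟨σ, ⟨-, bs, hbs, hσ⟩, g, hacc, rfl⟩ := h
  have hg := hacc.execution
  have hflat : σ.map Event.action = (bs.map (List.map Event.action)).flatten := by
    rw [hσ, List.map_flatten]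
  have hnd := hg.nodup
  rw [hflat] at hnd
  obtain ⟨r, hpw, -, hinj⟩ := exists_block_rank _ (by
    intro b hb
    obtain ⟨b, hb', rfl⟩ := List.mem_map.1 hb
    exact (hbs b hb').exists_inst) hnd
  rw [← hflat] at hpw hinj
  refine (hg.ranking_of_blocks hpw hinj ?_).not_cyclic
  intro t t' i hst
  obtain ⟨e, he, hea⟩ := List.mem_map.1 (hg.commit_mem t' i hst.lt_len)
  obtain ⟨k, a, rfl⟩ : ∃ k a, e = .commitStore t' i k a := by
    obtain ⟨σ₁, σ₂, hs⟩ := List.append_of_mem he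
    have hrun := hacc.1
    rw [hs] at hrun
    obtain ⟨s, s', hinv, ht, hle⟩ := hrun.exists_step
    have hle' := ht.le.trans hle
    cases ht with
    | commit t i hcan hnst =>
      cases hea
      exact absurd ((hinv.isStore_iff hle' hcan.fetched).2 hst) hnst
    | commitStore t i key a =>
      cases hea
      exact ⟨_, _, rfl⟩
    | _ => cases hea
  rw [hσ] at he
  obtain ⟨b, hb, heb⟩ := List.mem_flatten.1 he
  have hp : .propagate t t' i a ∈ b := by
    cases hbs b hb with
    | load => simp at heb
    | loc => simp at heb
    | store t₁ i₁ I key a₁ others hI hnd hall =>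
      simp at heb
      obtain ⟨rfl, rfl, rfl, rfl⟩ := heb
      have := hall t
      simp at this ⊢
      tauto
  refine List.mem_map.2 ⟨.propagate t t' i a, ?_, rfl⟩
  rw [hσ]
  exact List.mem_flatten.2 ⟨b, hb, hp⟩

end Semantics

/-! ### Deletion of an instruction -/

section Lists

theorem pairwise_idxOf {α : Type*} [DecidableEq α] {L : List α} (h : L.Nodup) :
    L.Pairwise fun x y => L.idxOf x < L.idxOf y := by
  rw [List.pairwise_iff_getElem]
  intro i j hi hj hij
  rwa [h.idxOf_getElem, h.idxOf_getElem]

end Lists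

section Semantics

variable {D : Type u} {Reg : Type v} {Q : Type w} {n : ℕ}

/-- The actions of `es` before `m`. -/
def preds (es : List (Action n)) (m : Action n) : Set (Action n) :=
  {e | e ∈ es ∧ es.idxOf e < es.idxOf m}

theorem idxOf_ne {es : List (Action n)} {e e' : Action n} (he : e ∈ es) (h : e ≠ e') :
    es.idxOf e ≠ es.idxOf e' := fun h' => h ((List.idxOf_inj he).1 h')

open State

namespace State

open Classical in
/-- The state `g` without the instruction `x`, the last one of its thread.  The loads of thread `t`
that read from `x` read from `y t` instead. -/
noncomputable def delete (g : State D Reg Q n) (x : Fin n × ℕ) (y : Fin n → StoreId D n) :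
    State D Reg Q n where
  thr t :=
    { fetched := if t = x.1 then (g.thr t).fetched.take x.2 else (g.thr t).fetched
      committed := {i | i < g.len t ∧ (t, i) ≠ x}
      loaded := fun i =>
        if (t, i) = x then none
        else if (g.thr t).loaded i = some (.st x.1 x.2) then some (y t)
        else (g.thr t).loaded i }
  co := Function.update g.co (.st x.1 x.2) 0
  prop := g.prop

variable {g : State D Reg Q n} {x : Fin n × ℕ} {y : Fin n → StoreId D n}

theorem loaded_delete {t : Fin n} {i : ℕ} (h : (t, i) ≠ x)
    (h' : (g.thr t).loaded i ≠ some (.st x.1 x.2)) :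
    ((g.delete x y).thr t).loaded i = (g.thr t).loaded i := by
  simp [delete, h, h']

theorem loaded_delete_of_eq {t : Fin n} {i : ℕ} (h : (t, i) ≠ x)
    (h' : (g.thr t).loaded i = some (.st x.1 x.2)) :
    ((g.delete x y).thr t).loaded i = some (y t) := by
  simp [delete, h, h']

theorem co_delete {z : StoreId D n} (h : z ≠ .st x.1 x.2) : (g.delete x y).co z = g.co z := by
  simp [delete, h]

theorem co_delete_st {t : Fin n} {i : ℕ} (h : (t, i) ≠ x) :
    (g.delete x y).co (.st t i) = g.co (.st t i) :=
  co_delete fun he => h (by cases he; rfl)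

theorem lt_len_delete_iff (hx : x.2 + 1 = g.len x.1) {t : Fin n} {i : ℕ} :
    i < (g.delete x y).len t ↔ i < g.len t ∧ (t, i) ≠ x := by
  obtain ⟨t₀, k⟩ := x
  unfold len at *
  by_cases ht : t = t₀
  · subst ht
    simp [delete] at hx ⊢
    omega
  · simp [delete, ht]

theorem fetched_take_delete {t : Fin n} {i : ℕ} (hi : i < (g.delete x y).len t) :
    ((g.delete x y).thr t).fetched.take i = (g.thr t).fetched.take i := by
  by_cases ht : t = x.1
  · subst ht
    simp only [len, delete, if_true, List.length_take] at hi
    simp only [delete, if_true, List.take_take]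
    rw [min_eq_left (by omega)]
  · simp [delete, ht]

theorem instrAt_delete {t : Fin n} {i : ℕ} (hi : i < (g.delete x y).len t) :
    (g.delete x y).instrAt t i = g.instrAt t i := by
  by_cases ht : t = x.1
  · subst ht
    simp only [len, delete, if_true, List.length_take] at hi
    simp only [instrAt, delete, if_true]
    rw [List.getElem?_take, if_pos (by omega)]
  · simp [instrAt, delete, ht]

theorem sameCmd_delete : SameCmd (g.delete x y).len g (g.delete x y) :=
  ⟨fun t i hi => by rw [cmdAt, cmdAt, instrAt_delete hi]⟩

theorem isLoad_delete_iff (hx : x.2 + 1 = g.len x.1) {t : Fin n} {i : ℕ} :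
    (g.delete x y).IsLoad t i ↔ g.IsLoad t i ∧ (t, i) ≠ x := by
  constructor
  · intro h
    have hi := h.lt_len
    exact ⟨(sameCmd_delete.isLoad_iff hi).2 h, ((lt_len_delete_iff hx).1 hi).2⟩
  · rintro ⟨h, h'⟩
    exact (sameCmd_delete.isLoad_iff ((lt_len_delete_iff hx).2 ⟨h.lt_len, h'⟩)).1 h

theorem isStore_delete_iff (hx : x.2 + 1 = g.len x.1) {t : Fin n} {i : ℕ} :
    (g.delete x y).IsStore t i ↔ g.IsStore t i ∧ (t, i) ≠ x := by
  constructor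
  · intro h
    have hi := h.lt_len
    exact ⟨(sameCmd_delete.isStore_iff hi).2 h, ((lt_len_delete_iff hx).1 hi).2⟩
  · rintro ⟨h, h'⟩
    exact (sameCmd_delete.isStore_iff ((lt_len_delete_iff hx).2 ⟨h.lt_len, h'⟩)).1 h

theorem isAssume_delete_iff (hx : x.2 + 1 = g.len x.1) {t : Fin n} {i : ℕ} :
    (g.delete x y).IsAssume t i ↔ g.IsAssume t i ∧ (t, i) ≠ x := by
  constructor
  · intro h
    have hi := h.lt_len
    exact ⟨(sameCmd_delete.isAssume_iff hi).2 h, ((lt_len_delete_iff hx).1 hi).2⟩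
  · rintro ⟨h, h'⟩
    exact (sameCmd_delete.isAssume_iff ((lt_len_delete_iff hx).2 ⟨h.lt_len, h'⟩)).1 h

end State

variable [Zero D]

/-- The instruction `x` is the last one of its thread, and all addresses and the conditions of all
conditionals can be computed from loads that do not depend on `x`: namely, from those performed in
some state `s`. -/
structure Deletable (g : State D Reg Q n) (x : Fin n × ℕ) : Prop where
  last : x.2 + 1 = g.len x.1
  support : ∃ s : State D Reg Q n, SameCmd g.len s g ∧
    (∀ t i y, i < g.len t → (s.thr t).loaded i = some y →
      (g.thr t).loaded i = some y ∧ y ≠ .st x.1 x.2) ∧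
    (∀ t i, i < g.len t → s.getAddr t i ≠ .bot) ∧
    ∀ t i, g.IsAssume t i → s.getValue t i ≠ .bot

namespace Execution

variable {P : Program D Reg Q n} {g : State D Reg Q n} {es : List (Action n)}

theorem ok_preds (hg : Execution P g es) {m : Action n} (hm : m ∈ es) :
    Ok g (preds es m) m := by
  obtain ⟨es₁, es₂, rfl, hok⟩ := hg.exists_ok hm
  convert hok using 1
  ext e
  have hpw := pairwise_idxOf hg.nodup
  exact (mem_prefix_iff (fun _ _ h => h.asymm) hpw e).symm

theorem idxOf_prop_self (hg : Execution P g es) {t : Fin n} {i : ℕ} (h : g.IsStore t i) :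
    es.idxOf (.prop t t i) = es.idxOf (.commit t i) + 1 := by
  have hnd := hg.nodup
  obtain ⟨es₁, es₂, he⟩ := List.append_of_mem (hg.commit_mem t i h.lt_len)
  obtain ⟨es₃, rfl⟩ := hg.own es₁ t i es₂ he h
  subst he
  rw [List.nodup_append] at hnd
  have h₁ : Action.commit t i ∉ es₁ := fun hm => hnd.2.2 _ hm _ (by simp) rfl
  have h₂ : Action.prop t t i ∉ es₁ := fun hm => hnd.2.2 _ hm _ (by simp) rfl
  rw [List.idxOf_append_of_notMem h₁, List.idxOf_append_of_notMem h₂]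
  simp

/-- The stores to an address are propagated to a thread in coherence order. -/
theorem idxOf_prop_lt_iff (hg : Execution P g es) {t t₁ t₂ : Fin n} {i₁ i₂ : ℕ}
    (h₁ : .prop t t₁ i₁ ∈ es) (h₂ : .prop t t₂ i₂ ∈ es) (ha : g.getAddr t₁ i₁ = g.getAddr t₂ i₂) :
    es.idxOf (.prop t t₁ i₁) < es.idxOf (.prop t t₂ i₂) ↔
      g.co (.st t₁ i₁) < g.co (.st t₂ i₂) := by
  constructor
  · exact fun h => (hg.ok_preds h₂).2.2 _ _ ⟨h₁, h⟩ ha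
  · intro h
    by_contra hn
    rcases Nat.lt_or_eq_of_le (not_lt.1 hn) with hn | hn
    · exact lt_asymm h ((hg.ok_preds h₁).2.2 _ _ ⟨h₂, hn⟩ ha.symm)
    · have := (List.idxOf_inj h₂).1 hn
      cases this
      exact lt_irrefl _ h

end Execution

theorem exists_isLast_list (g : State D Reg Q n) (L : List (Action n)) (t : Fin n) (a : D) :
    ∃ y, g.IsLast {e | e ∈ L} t a y := by
  induction L with
  | nil => exact ⟨.init a, Or.inl rfl, by simp⟩
  | cons m L ih =>
    obtain ⟨y, hmem, hmax⟩ := ih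
    by_cases hm : ∃ t' i, m = .prop t t' i ∧ g.getAddr t' i = .val a ∧ g.co y ≤ g.co (.st t' i)
    · obtain ⟨t', i, rfl, ha, hle⟩ := hm
      refine ⟨.st t' i, Or.inr ⟨t', i, rfl, by simp, ha⟩, fun t₁ i₁ hm₁ ha₁ => ?_⟩
      rcases List.mem_cons.1 hm₁ with h | h
      · cases h
        exact le_rfl
      · exact (hmax _ _ h ha₁).trans hle
    · refine ⟨y, ?_, fun t₁ i₁ hm₁ ha₁ => ?_⟩
      · rcases hmem with h | ⟨t', i, h, h', ha⟩
        · exact Or.inl h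
        · exact Or.inr ⟨t', i, h, List.mem_cons_of_mem _ h', ha⟩
      · rcases List.mem_cons.1 hm₁ with h | h
        · exact le_of_not_ge fun hle => hm ⟨t₁, i₁, h.symm, ha₁, hle⟩
        · exact hmax _ _ h ha₁

theorem exists_isLast (g : State D Reg Q n) (es : List (Action n)) (m : Action n) (t : Fin n)
    (a : D) : ∃ y, g.IsLast (preds es m) t a y := by
  obtain ⟨y, hy⟩ := exists_isLast_list g (es.filter fun e => es.idxOf e < es.idxOf m) t a
  refine ⟨y, ?_⟩
  convert hy using 1
  ext e
  simp [preds]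

/-- A store read by the loads of thread `t` that read from `x` when `x` is deleted: the store that
was visible to `t` before `x` was propagated to `t`. -/
def Substitute (g : State D Reg Q n) (es : List (Action n)) (x : Fin n × ℕ) (t : Fin n)
    (y : StoreId D n) : Prop :=
  ∀ a, g.getAddr x.1 x.2 = .val a → g.IsLast (preds es (.prop t x.1 x.2)) t a y

theorem exists_substitute (g : State D Reg Q n) (es : List (Action n)) (x : Fin n × ℕ)
    (t : Fin n) : ∃ y, Substitute g es x t y := by
  cases ha : g.getAddr x.1 x.2 with
  | val a =>
    obtain ⟨y, hy⟩ := exists_isLast g es (.prop t x.1 x.2) t a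
    refine ⟨y, fun a' ha' => ?_⟩
    rw [ha] at ha'
    cases ha'
    exact hy
  | _ => exact ⟨.init 0, fun a' ha' => by cases ha.symm.trans ha'⟩

namespace Execution

variable {P : Program D Reg Q n} {g : State D Reg Q n} {es : List (Action n)} {x : Fin n × ℕ}

theorem emb_of_sameCmd (hg : Execution P g es) {s : State D Reg Q n} (h : SameCmd g.len s g)
    (hld : ∀ t i y, i < g.len t → (s.thr t).loaded i = some y → (g.thr t).loaded i = some y) :
    Emb g.len s g := by
  refine ⟨h, hld, fun t i t' j hi hl => ?_⟩
  have hl' := hld _ _ _ hi hl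
  obtain ⟨a, y, -, hy, hsrc⟩ := hg.load_source (hg.isLoad t i (by simp [hl']))
  rw [hl'] at hy
  cases hy
  rcases hsrc with h | ⟨t₁, j₁, h, hst, -⟩
  · cases h
  · cases h
    exact hst.lt_len

/-- The addresses and the conditions are not affected by the deletion of `x`. -/
theorem delete_addr_value (hg : Execution P g es) (hx : Deletable g x) (y : Fin n → StoreId D n) :
    (∀ t i, i < (g.delete x y).len t → (g.delete x y).getAddr t i = g.getAddr t i) ∧
    (∀ t i, i < g.len t → g.getAddr t i ≠ .bot) ∧
    ∀ t i, (g.delete x y).IsAssume t i → (g.delete x y).getValue t i = g.getValue t i := by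
  obtain ⟨hlast, s, hcmd, hld, haddr, hval⟩ := hx
  have hlt := fun t i => lt_len_delete_iff (y := y) hlast (t := t) (i := i)
  have hemb := hg.emb_of_sameCmd hcmd fun t i z hi hl => (hld t i z hi hl).1
  have hemb' : Emb (g.delete x y).len s (g.delete x y) := by
    refine ⟨⟨fun t i hi => ?_⟩, fun t i z hi hl => ?_, fun t i t' j hi hl => ?_⟩
    · rw [hcmd.cmd _ _ ((hlt t i).1 hi).1, sameCmd_delete.cmd _ _ hi]
    · obtain ⟨h₁, h₂⟩ := hld _ _ _ ((hlt t i).1 hi).1 hl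
      rw [loaded_delete ((hlt t i).1 hi).2, h₁]
      rw [h₁]
      exact fun h => h₂ (Option.some.inj h)
    · obtain ⟨h₁, h₂⟩ := hld _ _ _ ((hlt t i).1 hi).1 hl
      refine (hlt _ _).2 ⟨hemb.bound _ _ _ _ ((hlt t i).1 hi).1 hl, ?_⟩
      rintro rfl
      exact h₂ rfl
  refine ⟨fun t i hi => ?_, fun t i hi => ?_, fun t i ha => ?_⟩
  · have hi' := ((hlt t i).1 hi).1
    rw [hemb'.getAddr_eq hi (haddr t i hi'), hemb.getAddr_eq hi' (haddr t i hi')]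
  · rw [hemb.getAddr_eq hi (haddr t i hi)]
    exact haddr t i hi
  · have hi := ha.lt_len
    have hi' := ((hlt t i).1 hi).1
    have hv := hval t i (((isAssume_delete_iff hlast).1 ha).1)
    rw [hemb'.getValue_eq hi hv, hemb.getValue_eq hi' hv]

/-- A load that reads from the last instruction of a thread reads it from memory. -/
theorem read_last (hg : Execution P g es) (hx : x.2 + 1 = g.len x.1) {t : Fin n} {i : ℕ}
    (h : (g.thr t).loaded i = some (.st x.1 x.2)) :
    g.IsLoad t i ∧ g.IsStore x.1 x.2 ∧ (t, i) ≠ x ∧ ∃ a, g.getAddr x.1 x.2 = .val a ∧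
      g.getAddr t i = .val a ∧ .prop t x.1 x.2 ∈ preds es (.load t i) ∧
      g.IsLast (preds es (.load t i)) t a (.st x.1 x.2) := by
  have hl := hg.isLoad t i (by simp [h])
  obtain ⟨-, -, -, -, a, y, ha, hy, hsrc⟩ := hg.ok_preds (hg.load_mem hl)
  rw [h] at hy
  cases hy
  rcases hsrc with hlast | ⟨i', hi', he⟩
  · rcases hlast.mem with hy | ⟨t', j, hy, hm, haj⟩
    · cases hy
    · cases hy
      have hst := hg.isStore_of_prop_mem hm.1
      refine ⟨hl, hst, ?_, a, haj, ha, hm, hlast⟩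
      rintro rfl
      exact hl.not_isStore hst
  · obtain ⟨t₀, k⟩ := x
    cases hi'
    have h₁ := he.lt
    have h₂ := hl.lt_len
    change k + 1 = g.len t₀ at hx
    change i < g.len t₀ at h₂
    omega

/-- The properties of the substitute for a store `x` that is read by a load of thread `t`. -/
theorem substitute_spec (hg : Execution P g es) {t : Fin n} {y : StoreId D n} {a : D}
    (hy : Substitute g es x t y) (ha : g.getAddr x.1 x.2 = .val a)
    (hst : g.IsStore x.1 x.2) (hp : .prop t x.1 x.2 ∈ es) :
    (y = .init a ∨ ∃ t' j, y = .st t' j ∧ g.IsStore t' j ∧ g.getAddr t' j = .val a) ∧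
    y ≠ .st x.1 x.2 ∧ 0 ≤ g.co y ∧ g.co y < g.co (.st x.1 x.2) ∧
    ∀ t' j, .prop t t' j ∈ es → g.getAddr t' j = .val a →
      g.co (.st t' j) < g.co (.st x.1 x.2) → g.co (.st t' j) ≤ g.co y := by
  have hlast := hy a ha
  have hmax : ∀ t' j, .prop t t' j ∈ es → g.getAddr t' j = .val a →
      g.co (.st t' j) < g.co (.st x.1 x.2) → g.co (.st t' j) ≤ g.co y := by
    intro t' j hm haj hlt
    refine hlast.max t' j ⟨hm, ?_⟩ haj
    exact (hg.idxOf_prop_lt_iff hm hp (by rw [haj, ha])).2 hlt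
  rcases hlast.mem with rfl | ⟨t', j, rfl, hm, haj⟩
  · refine ⟨Or.inl rfl, by simp, by rw [hg.co_init], ?_, hmax⟩
    rw [hg.co_init]
    exact hg.co_pos _ _ hst
  · have hst' := hg.isStore_of_prop_mem hm.1
    have hlt := (hg.idxOf_prop_lt_iff hm.1 hp (by rw [haj, ha])).1 hm.2
    refine ⟨Or.inr ⟨t', j, rfl, hst', haj⟩, ?_, (hg.co_pos _ _ hst').le, hlt, hmax⟩
    intro h
    rw [h] at hlt
    exact lt_irrefl _ hlt

/-- The enabling condition is preserved by the deletion of the instruction `x`. -/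
theorem ok_delete (hg : Execution P g es) (hx : Deletable g x) {y : Fin n → StoreId D n}
    (hy : ∀ t, Substitute g es x t (y t)) {m : Action n} (hm : m ∈ es) (hmx : m.inst ≠ x) :
    Ok (g.delete x y) {e | e ∈ preds es m ∧ e.inst ≠ x} m := by
  have hok := hg.ok_preds hm
  have hlast := hx.last
  have hlt := fun t i => lt_len_delete_iff (y := y) hlast (t := t) (i := i)
  have haddr := (hg.delete_addr_value hx y).1
  have hpo : ∀ {t i j}, j < i → i < g.len t → (t, j) ≠ x := by
    rintro t i j hj hi rfl
    simp only at hlast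
    omega
  have hcmd := sameCmd_delete (g := g) (x := x) (y := y)
  have hloads : ∀ {t i}, i < g.len t → (t, i) ≠ x → LoadsIn g (preds es m) t (g.addrDeps t i) →
      LoadsIn (g.delete x y) {e | e ∈ preds es m ∧ e.inst ≠ x} t
        ((g.delete x y).addrDeps t i) := by
    intro t i hi hxi h j hj hl
    rw [← hcmd.addrDeps_eq ((hlt t i).2 ⟨hi, hxi⟩)] at hj
    exact ⟨h j hj ((isLoad_delete_iff hlast).1 hl).1, ((isLoad_delete_iff hlast).1 hl).2⟩
  have hloads' : ∀ {t i}, i < g.len t → (t, i) ≠ x → LoadsIn g (preds es m) t (g.dataDeps t i) →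
      LoadsIn (g.delete x y) {e | e ∈ preds es m ∧ e.inst ≠ x} t
        ((g.delete x y).dataDeps t i) := by
    intro t i hi hxi h j hj hl
    rw [← hcmd.dataDeps_eq ((hlt t i).2 ⟨hi, hxi⟩)] at hj
    exact ⟨h j hj ((isLoad_delete_iff hlast).1 hl).1, ((isLoad_delete_iff hlast).1 hl).2⟩
  have haddr' : ∀ {t i}, g.IsStore t i → (t, i) ≠ x →
      (g.delete x y).getAddr t i = g.getAddr t i := fun hst hxi =>
    haddr _ _ ((hlt _ _).2 ⟨hst.lt_len, hxi⟩)
  cases m with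
  | fetch t i =>
    exact ⟨(hlt t i).2 ⟨hok.1, hmx⟩, fun j hj => ⟨hok.2.1 j hj, hpo hj hok.1⟩,
      fun h => hok.2.2 h.1⟩
  | load t i =>
    obtain ⟨hl, hf, hn, hdeps, a, z, ha, hz, hsrc⟩ := hok
    have hi := hl.lt_len
    refine ⟨(isLoad_delete_iff hlast).2 ⟨hl, hmx⟩, ⟨hf, hmx⟩, fun h => hn h.1,
      hloads hi hmx hdeps, a, ?_⟩
    rw [haddr _ _ ((hlt _ _).2 ⟨hi, hmx⟩)]
    by_cases hzx : z = .st x.1 x.2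
    · subst hzx
      obtain ⟨-, hst, -, a', hax, ha', hp, hlastx⟩ := hg.read_last hlast hz
      rw [ha] at ha'
      cases ha'
      refine ⟨y t, ha, loaded_delete_of_eq hmx hz, Or.inl ?_⟩
      have hspec := hg.substitute_spec (hy t) hax hst hp.1
      have hyl := hy t _ hax
      refine ⟨?_, ?_⟩
      · rcases hyl.mem with h | ⟨t', j, h, hm', haj⟩
        · exact Or.inl h
        · have hne : (t', j) ≠ x := by
            rintro rfl
            exact hspec.2.1 h
          refine Or.inr ⟨t', j, h, ⟨⟨hm'.1, hm'.2.trans hp.2⟩, hne⟩, ?_⟩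
          rw [haddr' (hg.isStore_of_prop_mem hm'.1) hne, haj]
      · rintro t' j ⟨hm', hne⟩ haj
        have hst' := hg.isStore_of_prop_mem hm'.1
        rw [haddr' hst' hne] at haj
        rw [co_delete_st hne, co_delete hspec.2.1]
        refine hspec.2.2.2.2 t' j hm'.1 haj (lt_of_le_of_ne (hlastx.max _ _ hm' haj) fun h => ?_)
        obtain ⟨rfl, rfl⟩ := hg.co_inj _ _ _ _ hst' hst h
        exact hne rfl
    · refine ⟨z, ha, ?_, ?_⟩
      · rw [loaded_delete hmx, hz]
        rw [hz]
        exact fun h => hzx (Option.some.inj h)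
      rcases hsrc with hzl | ⟨i', rfl, he⟩
      · refine Or.inl ⟨?_, ?_⟩
        · rcases hzl.mem with h | ⟨t', j, rfl, hm', haj⟩
          · exact Or.inl h
          · have hne : (t', j) ≠ x := by
              rintro rfl
              exact hzx rfl
            refine Or.inr ⟨t', j, rfl, ⟨hm', hne⟩, ?_⟩
            rw [haddr' (hg.isStore_of_prop_mem hm'.1) hne, haj]
        · rintro t' j ⟨hm', hne⟩ haj
          rw [haddr' (hg.isStore_of_prop_mem hm'.1) hne] at haj
          rw [co_delete_st hne, co_delete hzx]
          exact hzl.max _ _ hm' haj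
      · have hne := hpo he.lt hi
        refine Or.inr ⟨i', rfl, he.lt, (isStore_delete_iff hlast).2 ⟨he.store, hne⟩, ?_,
          hloads he.store.lt_len hne he.addrLoads, hloads' he.store.lt_len hne he.dataLoads, ?_,
          fun h => he.not_committed h.1⟩
        · rw [haddr' he.store hne, he.addr]
        · intro j hj hji hst
          obtain ⟨hst, hjx⟩ := (isStore_delete_iff hlast).1 hst
          rw [haddr' hst hjx]
          exact ⟨(he.between j hj hji hst).1, hloads hst.lt_len hjx (he.between j hj hji hst).2⟩
  | commit t i =>
    obtain ⟨hf, hn, hdeps, hsame, hl⟩ := hok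
    have hi : i < g.len t := (hg.ok_preds hf.1).1
    have hi' := (hlt t i).2 ⟨hi, hmx⟩
    refine ⟨⟨hf, hmx⟩, fun h => hn h.1, ?_, ?_, fun h =>
      ⟨hl ((isLoad_delete_iff hlast).1 h).1, hmx⟩⟩
    · intro j hj
      rw [← hcmd.addrDeps_eq hi', ← hcmd.dataDeps_eq hi', ← hcmd.ctrlDeps_eq hi'] at hj
      refine ⟨hdeps j hj, hpo ?_ hi⟩
      rcases hj with (hj | hj) | hj
      · exact lt_of_mem_addrDeps hj
      · exact lt_of_mem_dataDeps hj
      · exact hj.1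
    · intro htop j hj hjtop
      have hjx := hpo hj hi
      have hjl := hj.trans hi
      rw [haddr _ _ hi'] at htop ⊢
      rw [haddr _ _ ((hlt _ _).2 ⟨hjl, hjx⟩)] at hjtop ⊢
      obtain ⟨h₁, h₂⟩ := hsame htop j hj hjtop
      exact ⟨hloads hjl hjx h₁, fun h => ⟨h₂ h, hjx⟩⟩
  | prop t t' i =>
    obtain ⟨hst, hc, hmax⟩ := hok
    refine ⟨(isStore_delete_iff hlast).2 ⟨hst, hmx⟩, ⟨hc, hmx⟩, ?_⟩
    rintro t'' j ⟨hm', hne⟩ ha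
    rw [haddr' (hg.isStore_of_prop_mem hm'.1) hne, haddr' hst hmx] at ha
    rw [co_delete_st hne, co_delete_st hmx]
    exact hmax _ _ hm' ha

end Execution

end Semantics

/-! ### Executions after the deletion -/

section Semantics

variable {D : Type u} {Reg : Type v} {Q : Type w} {n : ℕ} [Zero D]

open State

/-- A numbering of the instructions in which `x` has the greatest number, and along which the
happens-before relation between the instructions other than `x` increases.  In `cf`, the store
`(t₁, i₁)` that is read may be `x`. -/
structure AlmostRanking (g : State D Reg Q n) (x : Fin n × ℕ) (r : Fin n × ℕ → ℕ) : Prop where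
  inj : ∀ t i t' i', i < g.len t → i' < g.len t' → r (t, i) = r (t', i') → t = t' ∧ i = i'
  top : ∀ t i, i < g.len t → (t, i) ≠ x → r (t, i) < r x
  po : ∀ t i j, i < j → j < g.len t → r (t, i) < r (t, j)
  src : ∀ t i t' j, (t, i) ≠ x → (t', j) ≠ x → i < g.len t → j < g.len t' →
    (g.thr t).loaded i = some (.st t' j) → r (t', j) < r (t, i)
  co : ∀ t i t' i', (t, i) ≠ x → (t', i') ≠ x → g.IsStore t i → g.IsStore t' i' →
    g.getAddr t i = g.getAddr t' i' → g.co (.st t i) < g.co (.st t' i') → r (t, i) < r (t', i')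
  cf_init : ∀ t i a t' i', (t, i) ≠ x → (t', i') ≠ x → i < g.len t →
    (g.thr t).loaded i = some (.init a) → g.IsStore t' i' →
    g.getAddr t' i' = .val a → r (t, i) < r (t', i')
  cf : ∀ t i t₁ i₁ t' i', (t, i) ≠ x → (t', i') ≠ x → i < g.len t →
    (g.thr t).loaded i = some (.st t₁ i₁) → g.IsStore t₁ i₁ → g.IsStore t' i' →
    g.getAddr t₁ i₁ = g.getAddr t' i' → g.co (.st t₁ i₁) < g.co (.st t' i') →
    r (t, i) < r (t', i')

namespace Execution

variable {P : Program D Reg Q n} {g : State D Reg Q n} {es : List (Action n)} {x : Fin n × ℕ}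

/-- The instruction `x` can be removed from the execution. -/
theorem delete (hg : Execution P g es) (hx : Deletable g x) {y : Fin n → StoreId D n}
    (hy : ∀ t, Substitute g es x t (y t)) :
    Execution P (g.delete x y) (es.filter fun e => e.inst ≠ x) := by
  have hlast := hx.last
  have hlt := fun t i => lt_len_delete_iff (y := y) hlast (t := t) (i := i)
  obtain ⟨haddr, -, hval⟩ := hg.delete_addr_value hx y
  have hpw : (es.filter fun e => e.inst ≠ x).Pairwise fun e e' => es.idxOf e < es.idxOf e' :=
    (pairwise_idxOf hg.nodup).filter _
  have hasymm : ∀ e e' : Action n, es.idxOf e < es.idxOf e' → ¬ es.idxOf e' < es.idxOf e :=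
    fun _ _ h => h.asymm
  -- The keys of the stores read by the loads, in terms of `g`.
  have hkey : ∀ t i v, (g.delete x y).IsLoad t i → (g.delete x y).LoadedKey t i v →
      ((g.thr t).loaded i = some (.st x.1 x.2) ∧ v = g.co (y t)) ∨
      ∃ z, (g.thr t).loaded i = some z ∧ z ≠ .st x.1 x.2 ∧ v = g.co z := by
    rintro t i v hl ⟨z, hz, rfl⟩
    have hxi := ((isLoad_delete_iff hlast).1 hl).2
    by_cases hr : (g.thr t).loaded i = some (.st x.1 x.2)
    · rw [loaded_delete_of_eq hxi hr] at hz
      cases hz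
      obtain ⟨-, hst, -, a, hax, -, hp, -⟩ := hg.read_last hlast hr
      exact Or.inl ⟨hr, co_delete (hg.substitute_spec (hy t) hax hst hp.1).2.1⟩
    · rw [loaded_delete hxi hr] at hz
      rw [hz] at hr
      have hzx : z ≠ .st x.1 x.2 := fun h => hr (by rw [h])
      exact Or.inr ⟨z, hz, hzx, co_delete hzx⟩
  constructor
  · intro es₁ m es₂ he
    have hm : m ∈ es.filter fun e => e.inst ≠ x := by
      rw [he]
      simp
    obtain ⟨hm', hmx⟩ := List.mem_filter.1 hm
    convert hg.ok_delete hx hy hm' (by simpa using hmx) using 1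
    ext e
    rw [he] at hpw
    refine (mem_prefix_iff hasymm hpw e).trans ?_
    rw [← he, List.mem_filter]
    simp only [preds, Set.mem_ofPred_eq, decide_eq_true_eq]
    tauto
  · intro es₁ t i es₂ he hst
    obtain ⟨hst, hxi⟩ := (isStore_delete_iff hlast).1 hst
    have hp : .prop t t i ∈ es.filter fun e => e.inst ≠ x :=
      List.mem_filter.2 ⟨hg.prop_self_mem hst, decide_eq_true hxi⟩
    rw [he] at hp hpw
    have hidx := hg.idxOf_prop_self hst
    exact eq_cons_of_pairwise hasymm hpw hp (by omega) fun e _ h => by omega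
  · intro t i hi
    obtain ⟨hi, hxi⟩ := (hlt t i).1 hi
    exact List.mem_filter.2 ⟨hg.commit_mem t i hi, decide_eq_true hxi⟩
  · intro t i I hI
    have hi := lt_len_of_instrAt hI
    rw [instrAt_delete hi] at hI
    rw [fetched_take_delete hi]
    exact hg.paths t i I hI
  · exact fun t i => (hlt t i).symm
  · intro t i ha
    rw [hval t i ha]
    exact hg.assume t i ((isAssume_delete_iff hlast).1 ha).1
  · intro a
    rw [co_delete (by simp)]
    exact hg.co_init a
  · intro t i hst
    by_cases hxi : (t, i) = x
    · subst hxi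
      simp [State.delete]
    · rw [co_delete_st hxi]
      exact hg.co_zero t i fun h => hst ((isStore_delete_iff hlast).2 ⟨h, hxi⟩)
  · intro t i hst
    obtain ⟨hst, hxi⟩ := (isStore_delete_iff hlast).1 hst
    rw [co_delete_st hxi]
    exact hg.co_pos t i hst
  · intro t i t' i' hst hst' h
    obtain ⟨hst, hxi⟩ := (isStore_delete_iff hlast).1 hst
    obtain ⟨hst', hxi'⟩ := (isStore_delete_iff hlast).1 hst'
    rw [co_delete_st hxi, co_delete_st hxi'] at h
    exact hg.co_inj _ _ _ _ hst hst' h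
  · intro t i hl
    by_cases hxi : (t, i) = x
    · simp [State.delete, hxi] at hl
    · refine (isLoad_delete_iff hlast).2 ⟨?_, hxi⟩
      by_cases hr : (g.thr t).loaded i = some (.st x.1 x.2)
      · exact hg.isLoad t i (by simp [hr])
      · rw [loaded_delete hxi hr] at hl
        exact hg.isLoad t i hl
  · intro t i i' v v' hii hl hl' ha hv hv'
    rw [haddr _ _ hl.lt_len, haddr _ _ hl'.lt_len] at ha
    have hgl := ((isLoad_delete_iff hlast).1 hl).1
    have hgl' := ((isLoad_delete_iff hlast).1 hl').1
    rcases hkey t i v hl hv with ⟨hr, rfl⟩ | ⟨z, hz, hzx, rfl⟩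
    · obtain ⟨-, hst, -, a, hax, hta, hp, -⟩ := hg.read_last hlast hr
      have hspec := hg.substitute_spec (hy t) hax hst hp.1
      rcases hkey t i' v' hl' hv' with ⟨hr', rfl⟩ | ⟨z', hz', hzx', rfl⟩
      · exact le_rfl
      · have hle := hg.ld t i i' _ _ hii hgl hgl' ha ⟨_, hr, rfl⟩ ⟨_, hz', rfl⟩
        obtain ⟨a', z₁, ha', hz₁, hsrc⟩ := hg.load_source hgl'
        rw [hz'] at hz₁
        cases hz₁
        rw [hta, ha'] at ha
        cases ha
        rcases hsrc with rfl | ⟨t₁, j₁, rfl, hst₁, ha₁, hp₁⟩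
        · rw [hg.co_init]
          exact hspec.2.2.1
        · refine hspec.2.2.2.2 _ _ hp₁ ha₁ (lt_of_le_of_ne hle fun h => hzx' ?_)
          obtain ⟨rfl, rfl⟩ := hg.co_inj _ _ _ _ hst₁ hst h
          rfl
    · rcases hkey t i' v' hl' hv' with ⟨hr', rfl⟩ | ⟨z', hz', hzx', rfl⟩
      · obtain ⟨-, hst, -, a, hax, hta, hp, -⟩ := hg.read_last hlast hr'
        have hspec := hg.substitute_spec (hy t) hax hst hp.1
        exact hspec.2.2.2.1.le.trans
          (hg.ld t i i' _ _ hii hgl hgl' ha ⟨_, hz, rfl⟩ ⟨_, hr', rfl⟩)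
      · exact hg.ld t i i' _ _ hii hgl hgl' ha ⟨_, hz, rfl⟩ ⟨_, hz', rfl⟩
  · intro t i i' v hii hl hl' ha hv
    rw [haddr _ _ hl.lt_len, haddr _ _ hl'.lt_len] at ha
    have hgl := ((isLoad_delete_iff hlast).1 hl).1
    obtain ⟨hgl', hxi'⟩ := (isStore_delete_iff hlast).1 hl'
    rw [co_delete_st hxi']
    rcases hkey t i v hl hv with ⟨hr, rfl⟩ | ⟨z, hz, hzx, rfl⟩
    · obtain ⟨-, hst, -, a, hax, hta, hp, -⟩ := hg.read_last hlast hr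
      have hspec := hg.substitute_spec (hy t) hax hst hp.1
      have hle := hg.ld_st t i i' _ hii hgl hgl' ha ⟨_, hr, rfl⟩
      refine hspec.2.2.2.2 _ _ (hg.prop_self_mem hgl') (by rw [← ha, hta])
        (lt_of_le_of_ne hle fun h => hxi' ?_)
      obtain ⟨rfl, rfl⟩ := hg.co_inj _ _ _ _ hgl' hst h
      rfl
    · exact hg.ld_st t i i' _ hii hgl hgl' ha ⟨_, hz, rfl⟩

/-- If the happens-before relation is acyclic after the deletion of `x`, then it was acyclic up to `x`.
For a load that reads from `x`, conflict arcs to other stores remain conflict arcs, since its new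
source precedes `x` in the coherence order. -/
theorem almostRanking_of_delete (hg : Execution P g es) (hx : Deletable g x)
    {y : Fin n → StoreId D n} (hy : ∀ t, Substitute g es x t (y t)) {r : Fin n × ℕ → ℕ}
    (hr : Ranking (g.delete x y) r) : ∃ r', AlmostRanking g x r' := by
  have hlast := hx.last
  have hlt := fun t i => lt_len_delete_iff (y := y) hlast (t := t) (i := i)
  obtain ⟨haddr, -, -⟩ := hg.delete_addr_value hx y
  have haddr' : ∀ {t i}, g.IsStore t i → (t, i) ≠ x →
      (g.delete x y).getAddr t i = g.getAddr t i := fun hst hxi =>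
    haddr _ _ ((hlt _ _).2 ⟨hst.lt_len, hxi⟩)
  have hpo : ∀ {t i j}, j < i → i < g.len t → (t, j) ≠ x := by
    rintro t i j hj hi rfl
    change j + 1 = g.len t at hlast
    omega
  -- The number of `x` exceeds all others.
  set N := g.insts.sup r + 1 with hN
  have hrN : ∀ t i, i < g.len t → r (t, i) < N := fun t i hi =>
    Nat.lt_succ_of_le (Finset.le_sup (f := r) (mem_insts.2 hi))
  set r' : Fin n × ℕ → ℕ := Function.update r x N with hr'
  have hrx : r' x = N := by simp [hr']
  have hrne : ∀ {t i}, (t, i) ≠ x → r' (t, i) = r (t, i) := fun h => by simp [hr', h]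
  refine ⟨r', ?_, ?_, ?_, ?_, ?_, ?_, ?_⟩
  · intro t i t' i' hi hi' h
    by_cases h₁ : (t, i) = x <;> by_cases h₂ : (t', i') = x
    · have := h₁.trans h₂.symm
      simpa using this
    · rw [h₁, hrx, hrne h₂] at h
      exact absurd h (hrN _ _ hi').ne'
    · rw [h₂, hrx, hrne h₁] at h
      exact absurd h (hrN _ _ hi).ne
    · rw [hrne h₁, hrne h₂] at h
      exact hr.inj _ _ _ _ ((hlt _ _).2 ⟨hi, h₁⟩) ((hlt _ _).2 ⟨hi', h₂⟩) h
  · intro t i hi h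
    rw [hrx, hrne h]
    exact hrN _ _ hi
  · intro t i j hij hj
    have hi := hpo hij hj
    rw [hrne hi]
    by_cases h : (t, j) = x
    · rw [h, hrx]
      exact hrN _ _ (hij.trans hj)
    · rw [hrne h]
      exact hr.po _ _ _ hij ((hlt _ _).2 ⟨hj, h⟩)
  · intro t i t' j hxi hxj hi hj hl
    rw [hrne hxi, hrne hxj]
    refine hr.src _ _ _ _ ((hlt _ _).2 ⟨hi, hxi⟩) ((hlt _ _).2 ⟨hj, hxj⟩) ?_
    rw [loaded_delete hxi, hl]
    rw [hl]
    rintro ⟨⟩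
    exact hxj rfl
  · intro t i t' i' hxi hxi' hst hst' ha hco
    rw [hrne hxi, hrne hxi']
    refine hr.co _ _ _ _ ((isStore_delete_iff hlast).2 ⟨hst, hxi⟩)
      ((isStore_delete_iff hlast).2 ⟨hst', hxi'⟩) ?_ ?_
    · rw [haddr' hst hxi, haddr' hst' hxi', ha]
    · rwa [co_delete_st hxi, co_delete_st hxi']
  · intro t i a t' i' hxi hxi' hi hl hst ha
    rw [hrne hxi, hrne hxi']
    refine hr.cf_init t i a _ _ ((hlt _ _).2 ⟨hi, hxi⟩) ?_
      ((isStore_delete_iff hlast).2 ⟨hst, hxi'⟩) (by rw [haddr' hst hxi', ha])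
    rw [loaded_delete hxi, hl]
    simp [hl]
  · intro t i t₁ i₁ t' i' hxi hxi' hi hl hst₁ hst ha hco
    rw [hrne hxi, hrne hxi']
    have hst' : (g.delete x y).IsStore t' i' := (isStore_delete_iff hlast).2 ⟨hst, hxi'⟩
    by_cases h₁ : (t₁, i₁) = x
    · subst h₁
      obtain ⟨-, -, -, a, hax, -, hp, -⟩ := hg.read_last hlast hl
      obtain ⟨hmem, hne, -, hlt', -⟩ := hg.substitute_spec (hy t) hax hst₁ hp.1
      have hl' := loaded_delete_of_eq (y := y) hxi hl
      have ha' : (g.delete (t₁, i₁) y).getAddr t' i' = .val a := by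
        rw [haddr' hst hxi', ← ha]
        exact hax
      rcases hmem with h | ⟨t₂, i₂, h, hst₂, ha₂⟩
      · rw [h] at hl'
        exact hr.cf_init _ _ a _ _ ((hlt _ _).2 ⟨hi, hxi⟩) hl' hst' ha'
      · rw [h] at hl' hlt' hne
        have h₂ : (t₂, i₂) ≠ (t₁, i₁) := by
          rintro ⟨⟩
          exact hne rfl
        refine hr.cf _ _ _ _ _ _ ((hlt _ _).2 ⟨hi, hxi⟩) hl'
          ((isStore_delete_iff hlast).2 ⟨hst₂, h₂⟩) hst' ?_ ?_
        · rw [haddr' hst₂ h₂, ha', ha₂]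
        · rw [co_delete_st h₂, co_delete_st hxi']
          exact hlt'.trans hco
    · refine hr.cf _ _ t₁ i₁ _ _ ((hlt _ _).2 ⟨hi, hxi⟩) ?_
        ((isStore_delete_iff hlast).2 ⟨hst₁, h₁⟩) hst' ?_ ?_
      · rw [loaded_delete hxi, hl]
        rw [hl]
        rintro ⟨⟩
        exact h₁ rfl
      · rw [haddr' hst₁ h₁, haddr' hst hxi', ha]
      · rwa [co_delete_st h₁, co_delete_st hxi']

end Execution

end Semantics

/-! ### The normal form -/

/-- The action is a fetch. -/
def Action.isFetch {n : ℕ} : Action n → Bool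
  | fetch _ _ => true
  | _ => false

section Semantics

variable {D : Type u} {Reg : Type v} {Q : Type w} {n : ℕ}

/-- The number of the part of the normal form to which an action is assigned: the part `0` for
fetches; for other actions, one more than the number of preceding actions of `x` other than its
fetch.  Thus each of these actions of `x` is the last one of its part. -/
def stage (es : List (Action n)) (x : Fin n × ℕ) (e : Action n) : ℕ :=
  if e.isFetch then 0
  else (es.filter fun c => c.inst = x ∧ c.isFetch = false ∧ es.idxOf c < es.idxOf e).length + 1

/-- The order of the actions in the normal form: by parts, within a part by the numbering `r` of the
instructions, and for each instruction as in `es`. -/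
def NormalLT (es : List (Action n)) (x : Fin n × ℕ) (r : Fin n × ℕ → ℕ) (e e' : Action n) : Prop :=
  stage es x e < stage es x e' ∨ (stage es x e = stage es x e' ∧
    (r e.inst < r e'.inst ∨ (r e.inst = r e'.inst ∧ es.idxOf e < es.idxOf e')))

theorem NormalLT.asymm {es : List (Action n)} {x : Fin n × ℕ} {r : Fin n × ℕ → ℕ}
    (e e' : Action n) (h : NormalLT es x r e e') : ¬ NormalLT es x r e' e := by
  unfold NormalLT at *
  omega

theorem stage_fetch {es : List (Action n)} {x : Fin n × ℕ} {e : Action n} (h : e.isFetch = true) :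
    stage es x e = 0 := by
  simp [stage, h]

theorem stage_pos {es : List (Action n)} {x : Fin n × ℕ} {e : Action n} (h : e.isFetch = false) :
    0 < stage es x e := by
  simp [stage, h]

theorem stage_mono {es : List (Action n)} {x : Fin n × ℕ} {e e' : Action n}
    (he : e.isFetch = false) (he' : e'.isFetch = false) (h : es.idxOf e ≤ es.idxOf e') :
    stage es x e ≤ stage es x e' := by
  simp only [stage, he, he', Bool.false_eq_true, if_false, Nat.add_le_add_iff_right]
  refine (List.monotone_filter_right es fun c hc => ?_).length_le
  simp only [decide_eq_true_eq] at hc ⊢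
  exact ⟨hc.1, hc.2.1, by omega⟩

theorem stage_lt {es : List (Action n)} {x : Fin n × ℕ} {c e : Action n} (hc : c ∈ es)
    (hcx : c.inst = x) (hcf : c.isFetch = false) (he : e.isFetch = false)
    (h : es.idxOf c < es.idxOf e) : stage es x c < stage es x e := by
  simp only [stage, hcf, he, Bool.false_eq_true, if_false, Nat.add_lt_add_iff_right]
  have hsub : (es.filter fun c' => c'.inst = x ∧ c'.isFetch = false ∧
      es.idxOf c' < es.idxOf c).Sublist
      (es.filter fun c' => c'.inst = x ∧ c'.isFetch = false ∧ es.idxOf c' < es.idxOf e) := by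
    refine List.monotone_filter_right es fun c hc => ?_
    simp only [decide_eq_true_eq] at hc ⊢
    exact ⟨hc.1, hc.2.1, by omega⟩
  refine lt_of_le_of_ne hsub.length_le fun hl => ?_
  have hmem : c ∈ es.filter fun c' => c'.inst = x ∧ c'.isFetch = false ∧
      es.idxOf c' < es.idxOf e := by
    simp [hc, hcx, hcf, h]
  rw [← hsub.eq_of_length hl] at hmem
  simp at hmem

theorem before_iff_of_pairwise {τ : List (Event D Reg Q n)} {f : Event D Reg Q n → ℕ}
    (h : τ.Pairwise fun e e' => f e ≤ f e') {e₁ e₂ : Event D Reg Q n} (h₁ : e₁ ∈ τ) (h₂ : e₂ ∈ τ)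
    (hne : f e₁ ≠ f e₂) : Before τ e₁ e₂ ↔ f e₁ < f e₂ := by
  constructor
  · rintro ⟨τ₁, τ₂, τ₃, rfl⟩
    rw [List.pairwise_append, List.pairwise_cons] at h
    exact lt_of_le_of_ne (h.2.1.1 e₂ (by simp)) hne
  · intro hlt
    obtain ⟨τ₁, τ₂, rfl⟩ := List.append_of_mem h₁
    rw [List.pairwise_append] at h
    rcases List.mem_append.1 h₂ with h₂ | h₂
    · have := h.2.2 _ h₂ e₁ (by simp)
      omega
    · rcases List.mem_cons.1 h₂ with rfl | h₂
      · exact absurd rfl hne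
      · obtain ⟨τ₃, τ₄, rfl⟩ := List.append_of_mem h₂
        exact ⟨τ₁, τ₃, τ₄, rfl⟩

variable [Zero D]

open State

namespace Execution

variable {P : Program D Reg Q n} {g : State D Reg Q n} {es : List (Action n)} {x : Fin n × ℕ}
  {r : Fin n × ℕ → ℕ}

theorem lt_len_of_mem (hg : Execution P g es) {m : Action n} (hm : m ∈ es) :
    m.inst.2 < g.len m.inst.1 := by
  have hok := hg.ok_preds hm
  cases m with
  | fetch => exact hok.1
  | load => exact hok.1.lt_len
  | commit => exact (hg.ok_preds hok.1.1).1
  | prop => exact hok.1.lt_len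

/-- There are at most `n + 1` actions of `x` other than its fetch: the commit, and either a load or the
propagations to the `n` threads. -/
theorem stage_lt_degree (hg : Execution P g es) (e : Action n) : stage es x e < n + 3 := by
  unfold stage
  split_ifs
  · omega
  refine Nat.succ_lt_succ (Nat.lt_succ_of_le ?_)
  rw [← List.toFinset_card_of_nodup (hg.nodup.filter _)]
  obtain ⟨t₀, k⟩ := x
  have hn : 0 < n := t₀.pos
  by_cases hl : g.IsLoad t₀ k
  · refine (Finset.card_le_card (t := {.load t₀ k, .commit t₀ k}) fun c hc => ?_).trans
      ((Finset.card_le_two).trans (by omega))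
    rw [List.mem_toFinset, List.mem_filter] at hc
    obtain ⟨hc, hcd⟩ := hc
    simp only [decide_eq_true_eq] at hcd
    obtain ⟨hcx, hcf, -⟩ := hcd
    cases c with
    | fetch => cases hcf
    | load => cases hcx; simp
    | commit => cases hcx; simp
    | prop =>
      cases hcx
      exact absurd (hg.isStore_of_prop_mem hc) hl.not_isStore
  · refine (Finset.card_le_card
      (t := insert (.commit t₀ k) (Finset.univ.image fun t => .prop t t₀ k)) fun c hc => ?_).trans
      ((Finset.card_insert_le _ _).trans (Nat.add_le_add_right (Finset.card_image_le.trans ?_) 1))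
    · rw [List.mem_toFinset, List.mem_filter] at hc
      obtain ⟨hc, hcd⟩ := hc
      simp only [decide_eq_true_eq] at hcd
      obtain ⟨hcx, hcf, -⟩ := hcd
      cases c with
      | fetch => cases hcf
      | load =>
        cases hcx
        exact absurd (hg.ok_preds hc).1 hl
      | commit => cases hcx; simp
      | prop => cases hcx; simp
    · simp

/-- The normal form does not change the order of actions of the same instruction, of actions that
are ordered by the ranking, and of the actions of `x` and what follows them. -/
theorem normalLT_of_idxOf_lt {e e' : Action n} (hem : e ∈ es)
    (he : e.isFetch = false) (he' : e'.isFetch = false) (h : es.idxOf e < es.idxOf e')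
    (hr : e.inst = x ∨ r e.inst < r e'.inst ∨ e.inst = e'.inst) : NormalLT es x r e e' := by
  have := stage_mono (x := x) he he' h.le
  rcases hr with hr | hr | hr
  · exact Or.inl (stage_lt hem hr he he' h)
  · unfold NormalLT
    omega
  · unfold NormalLT
    rw [hr]
    omega

/-- If the normal form changes the order of two actions, then they are not actions of `x`, and the
new order agrees with the ranking. -/
theorem idxOf_lt_or_of_normalLT (hg : Execution P g es) (hr : AlmostRanking g x r)
    {e e' : Action n} (hem : e ∈ es) (hem' : e' ∈ es) (he : e.isFetch = false)
    (he' : e'.isFetch = false) (h : NormalLT es x r e' e) :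
    es.idxOf e' < es.idxOf e ∨ (e.inst ≠ x ∧ e'.inst ≠ x ∧ r e'.inst < r e.inst) := by
  by_contra hn
  push Not at hn
  obtain ⟨hn₁, hn₂⟩ := hn
  have hne : e ≠ e' := by
    rintro rfl
    exact h.asymm _ _ h
  have hlt : es.idxOf e < es.idxOf e' := lt_of_le_of_ne hn₁ (idxOf_ne hem hne)
  refine h.asymm _ _ (normalLT_of_idxOf_lt hem he he' hlt ?_)
  by_contra hcon
  push Not at hcon
  obtain ⟨h₁, h₂, h₃⟩ := hcon
  have hl := hg.lt_len_of_mem hem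
  have hl' := hg.lt_len_of_mem hem'
  have hx' : e'.inst ≠ x := by
    intro h'
    have := hr.top _ _ hl h₁
    rw [← h'] at this
    exact absurd this (not_lt.2 h₂)
  have hle := hn₂ h₁ hx'
  obtain ⟨h₄, h₅⟩ := hr.inj _ _ _ _ hl hl' (le_antisymm hle h₂)
  exact h₃ (Prod.ext h₄ h₅)

/-- No action of `x` occurs between the commit of a store and its propagation to its own thread. -/
theorem stage_prop_self (hg : Execution P g es) {t : Fin n} {i : ℕ} (hst : g.IsStore t i)
    (hx : (t, i) ≠ x) : stage es x (.prop t t i) = stage es x (.commit t i) := by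
  simp only [stage, show (Action.prop t t i).isFetch = false from rfl,
    show (Action.commit t i).isFetch = false from rfl, Bool.false_eq_true, if_false,
    Nat.add_right_cancel_iff]
  congr 1
  refine List.filter_congr fun c hc => ?_
  rw [hg.idxOf_prop_self hst, decide_eq_decide]
  refine and_congr_right fun hcx => and_congr_right fun _ => ?_
  have : es.idxOf c ≠ es.idxOf (.commit t i) := idxOf_ne hc fun h => hx (by rw [← hcx, h]; rfl)
  omega

/-- The reordered actions are enabled. -/
theorem ok_normal (hg : Execution P g es) (hr : AlmostRanking g x r) {m : Action n} (hm : m ∈ es) :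
    Ok g {e | e ∈ es ∧ NormalLT es x r e m} m := by
  have hok := hg.ok_preds hm
  have hirr : ∀ e, ¬ NormalLT es x r e e := fun e h => h.asymm _ _ h
  have hfetch : ∀ {t i m}, i < g.len t → m.isFetch = false →
      Action.fetch t i ∈ {e | e ∈ es ∧ NormalLT es x r e m} := fun hi hm =>
    ⟨hg.fetch_mem hi, Or.inl (by rw [stage_fetch rfl]; exact stage_pos hm)⟩
  -- Preceding actions of instructions of the same thread that come first in program order.
  have hpo : ∀ {e m : Action n} {t i j}, e ∈ preds es m → e.isFetch = false →
      m.isFetch = false → e.inst = (t, j) → m.inst = (t, i) → j < i → i < g.len t →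
      e ∈ {e | e ∈ es ∧ NormalLT es x r e m} := by
    intro e m t i j he hef hmf hei hmi hji hi
    refine ⟨he.1, normalLT_of_idxOf_lt he.1 hef hmf he.2 (Or.inr (Or.inl ?_))⟩
    rw [hei, hmi]
    exact hr.po _ _ _ hji hi
  have hsame : ∀ {e m : Action n}, e ∈ preds es m → e.isFetch = false →
      m.isFetch = false → e.inst = m.inst → e ∈ {e | e ∈ es ∧ NormalLT es x r e m} :=
    fun he hef hmf hem => ⟨he.1, normalLT_of_idxOf_lt he.1 hef hmf he.2 (Or.inr (Or.inr hem))⟩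
  cases m with
  | fetch t i =>
    refine ⟨hok.1, fun j hj => ⟨(hok.2.1 j hj).1, Or.inr ⟨?_, Or.inl ?_⟩⟩, fun h => hirr _ h.2⟩
    · rw [stage_fetch rfl, stage_fetch rfl]
    · exact hr.po _ _ _ hj hok.1
  | load t i =>
    obtain ⟨hl, -, -, hdeps, a, y, ha, hy, hsrc⟩ := hok
    have hi := hl.lt_len
    have hdeps' : ∀ {k}, k ≤ i → LoadsIn g (preds es (.load t i)) t (g.addrDeps t k) →
        LoadsIn g {e | e ∈ es ∧ NormalLT es x r e (.load t i)} t (g.addrDeps t k) :=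
      fun hk h j hj hjl => hpo (h j hj hjl) rfl rfl rfl rfl ((lt_of_mem_addrDeps hj).trans_le hk) hi
    refine ⟨hl, hfetch hi rfl, fun h => hirr _ h.2, hdeps' le_rfl hdeps, a, y, ha, hy, ?_⟩
    rcases hsrc with hlast | ⟨i', rfl, he⟩
    · refine Or.inl ⟨?_, ?_⟩
      · rcases hlast.mem with h | ⟨t', j, rfl, hp, haj⟩
        · exact Or.inl h
        · refine Or.inr ⟨t', j, rfl, ⟨hp.1, normalLT_of_idxOf_lt hp.1 rfl rfl hp.2 ?_⟩, haj⟩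
          have hst := hg.isStore_of_prop_mem hp.1
          by_cases h₁ : (t', j) = x
          · exact Or.inl h₁
          refine Or.inr (Or.inl ?_)
          by_cases h₂ : (t, i) = x
          · have := hr.top _ _ hst.lt_len h₁
            rw [← h₂] at this
            exact this
          · exact hr.src _ _ _ _ h₂ h₁ hi hst.lt_len hy
      · rintro t' j ⟨hp, hlt⟩ haj
        have hst := hg.isStore_of_prop_mem hp
        rcases hg.idxOf_lt_or_of_normalLT hr hm hp rfl rfl hlt with h | ⟨h₁, h₂, h₃⟩
        · exact hlast.max _ _ ⟨hp, h⟩ haj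
        · by_contra hco
          rw [not_le] at hco
          rcases hlast.mem with rfl | ⟨t₁, i₁, rfl, hp₁, ha₁⟩
          · exact lt_asymm h₃ (hr.cf_init _ _ _ _ _ h₁ h₂ hi hy hst haj)
          · exact lt_asymm h₃ (hr.cf _ _ _ _ _ _ h₁ h₂ hi hy (hg.isStore_of_prop_mem hp₁.1) hst
              (by rw [ha₁, haj]) hco)
    · have hcm := hg.commit_mem t i' he.store.lt_len
      by_cases hc : NormalLT es x r (.commit t i') (.load t i)
      · -- The store is now committed before the load, which reads it from memory.
        have hpos : es.idxOf (.load t i) < es.idxOf (.commit t i') := by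
          refine lt_of_le_of_ne (not_lt.1 fun h => he.not_committed ⟨hcm, h⟩) ?_
          exact idxOf_ne hm (by simp)
        obtain ⟨h₁, h₂, h₃⟩ := (hg.idxOf_lt_or_of_normalLT hr hm hcm rfl rfl hc).resolve_left
          hpos.asymm
        have hps := hg.prop_self_mem he.store
        refine Or.inl ⟨Or.inr ⟨t, i', rfl, ⟨hps, ?_⟩, he.addr⟩, ?_⟩
        · have hstage := hg.stage_prop_self he.store h₂
          have h₃' : r (Action.prop t t i').inst < r (Action.load t i).inst := h₃
          unfold NormalLT at hc ⊢
          omega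
        · rintro t' j ⟨hp, hlt⟩ haj
          have hst := hg.isStore_of_prop_mem hp
          by_contra hco
          rw [not_le] at hco
          have hpp := (hg.idxOf_prop_lt_iff hps hp (by rw [he.addr, haj])).2 hco
          have hidx := hg.idxOf_prop_self he.store
          rcases hg.idxOf_lt_or_of_normalLT hr hm hp rfl rfl hlt with h | ⟨h₁, h₂, h₃⟩
          · omega
          · exact lt_asymm h₃ (hr.cf _ _ _ _ _ _ h₁ h₂ hi hy he.store hst (by rw [he.addr, haj]) hco)
      · refine Or.inr ⟨i', rfl, he.lt, he.store, he.addr, hdeps' he.lt.le he.addrLoads, ?_, ?_,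
          fun h => hc h.2⟩
        · exact fun j hj hjl => hpo (he.dataLoads j hj hjl) rfl rfl rfl rfl
            ((lt_of_mem_dataDeps hj).trans he.lt) hi
        · intro j hj hji hst
          obtain ⟨h₁, h₂⟩ := he.between j hj hji hst
          exact ⟨h₁, hdeps' hji.le h₂⟩
  | commit t i =>
    obtain ⟨hf, -, hdeps, haddr, hl⟩ := hok
    have hi : i < g.len t := (hg.ok_preds hf.1).1
    refine ⟨hfetch hi rfl, fun h => hirr _ h.2, ?_, ?_, fun h => hsame (hl h) rfl rfl rfl⟩
    · intro j hj
      refine hpo (hdeps j hj) rfl rfl rfl rfl ?_ hi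
      rcases hj with (hj | hj) | hj
      · exact lt_of_mem_addrDeps hj
      · exact lt_of_mem_dataDeps hj
      · exact hj.1
    · intro htop j hj hjtop
      obtain ⟨h₁, h₂⟩ := haddr htop j hj hjtop
      exact ⟨fun k hk hkl => hpo (h₁ k hk hkl) rfl rfl rfl rfl ((lt_of_mem_addrDeps hk).trans hj) hi,
        fun h => hpo (h₂ h) rfl rfl rfl rfl hj hi⟩
  | prop t t' i =>
    obtain ⟨hst, hc, hmax⟩ := hok
    refine ⟨hst, hsame hc rfl rfl rfl, ?_⟩
    rintro t'' j ⟨hp, hlt⟩ haj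
    have hst' := hg.isStore_of_prop_mem hp
    rcases hg.idxOf_lt_or_of_normalLT hr hm hp rfl rfl hlt with h | ⟨h₁, h₂, h₃⟩
    · exact hmax _ _ ⟨hp, h⟩ haj
    · rcases lt_trichotomy (g.co (.st t'' j)) (g.co (.st t' i)) with h | h | h
      · exact h
      · obtain ⟨rfl, rfl⟩ := hg.co_inj _ _ _ _ hst' hst h
        exact absurd h₃ (lt_irrefl _)
      · exact absurd h₃ (hr.co _ _ _ _ h₁ h₂ hst hst' haj.symm h).asymm

/-- If the happens-before relation is acyclic up to the instruction `x`, then there is a computation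
in normal form with the same trace. -/
theorem exists_normalForm (hg : Execution P g es) (hr : AlmostRanking g x r) :
    ∃ σ s, AcceptedAt P σ s ∧ InNormalForm (n + 3) σ ∧ s.trace = g.trace := by
  have hkey : ∀ j : Fin (n + 3), ∃ L : List (Action n),
      (∀ e, e ∈ L ↔ e ∈ es ∧ stage es x e = j) ∧ L.Pairwise fun e e' =>
        toLex (r e.inst, es.idxOf e) < toLex (r e'.inst, es.idxOf e') := by
    intro j
    obtain ⟨L, hL, hpw⟩ := exists_sorted_list (es.toFinset.filter fun e => stage es x e = j)
      (κ := fun e => toLex (r e.inst, es.idxOf e)) (by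
        intro e he e' he' h
        have h' : es.idxOf e = es.idxOf e' := congrArg (fun p => (ofLex p).2) h
        have hm : e ∈ es := by simpa using (Finset.mem_filter.1 he).1
        exact (List.idxOf_inj hm).1 h')
    exact ⟨L, fun e => by simp [hL], hpw⟩
  choose part hpart hpw using hkey
  set L := (List.ofFn part).flatten with hL
  have hmem : ∀ e, e ∈ L ↔ e ∈ es := by
    intro e
    rw [hL, List.mem_flatten]
    constructor
    · rintro ⟨l, hl, he⟩
      obtain ⟨j, rfl⟩ := (List.mem_ofFn' _ _).1 hl
      exact ((hpart j e).1 he).1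
    · intro he
      exact ⟨_, (List.mem_ofFn' _ _).2 ⟨⟨stage es x e, hg.stage_lt_degree e⟩, rfl⟩,
        (hpart _ e).2 ⟨he, rfl⟩⟩
  have hLpw : L.Pairwise (NormalLT es x r) := by
    rw [hL, List.pairwise_flatten]
    constructor
    · intro l hl
      obtain ⟨j, rfl⟩ := (List.mem_ofFn' _ _).1 hl
      refine (hpw j).imp_of_mem fun {e e'} he he' h => Or.inr ⟨?_, ?_⟩
      · rw [((hpart j e).1 he).2, ((hpart j e').1 he').2]
      · simpa [Prod.Lex.toLex_lt_toLex] using h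
    · rw [List.pairwise_ofFn]
      intro j j' hjj e he e' he'
      left
      rw [((hpart j e).1 he).2, ((hpart j' e').1 he').2]
      exact hjj
  have hex : Execution P g L := by
    refine hg.reorder ?_ ?_ fun t i hi => (hmem _).2 (hg.commit_mem t i hi)
    · intro es₁ m es₂ he
      have hm : m ∈ es := (hmem m).1 (by simp [he])
      have : {e | e ∈ es₁} = {e | e ∈ es ∧ NormalLT es x r e m} := by
        ext e
        rw [Set.mem_ofPred_eq, Set.mem_ofPred_eq, ← hmem]
        rw [he] at hLpw ⊢
        exact mem_prefix_iff NormalLT.asymm hLpw e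
      rw [this]
      exact hg.ok_normal hr hm
    · intro es₁ t i es₂ he hst
      have hcm := hg.commit_mem t i hst.lt_len
      have hps := hg.prop_self_mem hst
      have hidx := hg.idxOf_prop_self hst
      have hp := (hmem _).2 hps
      have hes : ∀ e, e ∈ es₁ ++ .commit t i :: es₂ → e ∈ es := fun e h => (hmem e).1 (by rwa [he])
      rw [he] at hLpw hp
      refine eq_cons_of_pairwise NormalLT.asymm hLpw hp
        (normalLT_of_idxOf_lt hcm rfl rfl (by omega) (Or.inr (Or.inr rfl))) ?_
      intro e hem h₁ h₂
      have hem' := hes e hem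
      have hef : e.isFetch = false := by
        cases hf : e.isFetch
        · rfl
        · have h₀ := stage_fetch (es := es) (x := x) hf
          have h₃ := stage_pos (es := es) (x := x) (e := .commit t i) rfl
          unfold NormalLT at h₁
          omega
      by_cases hx : (t, i) = x
      · have h₃ := (hg.idxOf_lt_or_of_normalLT hr hem' hcm hef rfl h₁).resolve_right
          fun h => h.2.1 hx
        have h₄ := (hg.idxOf_lt_or_of_normalLT hr hps hem' rfl hef h₂).resolve_right
          fun h => h.1 hx
        omega
      · have hstage := hg.stage_prop_self hst hx
        have h₃ : r (Action.commit t i).inst = r (Action.prop t t i).inst := rfl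
        unfold NormalLT at h₁ h₂
        omega
  obtain ⟨s, hs, htr, -⟩ := hex.acceptedAt
  refine ⟨L.map (label g), s, hs, ⟨fun j => (part j).map (label g), ?_, ?_, ?_⟩, htr⟩
  · rw [hL, List.map_flatten, List.map_ofFn]
    rfl
  · intro j hj e he hf
    obtain ⟨m, hm, rfl⟩ := List.mem_map.1 he
    obtain ⟨t, i, rfl⟩ := isFetch_label hf
    have := ((hpart j _).1 hm).2
    rw [stage_fetch rfl] at this
    omega
  · -- Within each part the order of different instructions is that of their numbers.
    have key : ∀ (j : Fin (n + 3)) (e₁ e₂ : Event D Reg Q n), e₁.inst ≠ e₂.inst →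
        e₁ ∈ (part j).map (label g) → e₂ ∈ (part j).map (label g) →
        (Before ((part j).map (label g)) e₁ e₂ ↔ r e₁.inst < r e₂.inst) := by
      intro j e₁ e₂ hne h₁ h₂
      refine before_iff_of_pairwise (f := fun e => r e.inst) ?_ h₁ h₂ fun h => ?_
      · rw [List.pairwise_map]
        refine (hpw j).imp fun {e e'} h => ?_
        rw [inst_label, inst_label]
        rw [Prod.Lex.toLex_lt_toLex] at h
        rcases h with h | h
        · exact h.le
        · exact h.1.le
      · obtain ⟨m₁, hm₁, rfl⟩ := List.mem_map.1 h₁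
        obtain ⟨m₂, hm₂, rfl⟩ := List.mem_map.1 h₂
        rw [inst_label, inst_label] at hne h
        obtain ⟨h₃, h₄⟩ := hr.inj _ _ _ _ (hg.lt_len_of_mem ((hpart j _).1 hm₁).1)
          (hg.lt_len_of_mem ((hpart j _).1 hm₂).1) h
        exact hne (Prod.ext h₃ h₄)
    intro j j' e₁ e₂ e₁' e₂' h₁ h₂ hne m₁ m₂ m₁' m₂'
    rw [key j e₁ e₂ hne m₁ m₂, key j' e₁' e₂' (by rwa [← h₁, ← h₂]) m₁' m₂', h₁, h₂]

end Execution

end Semantics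

/-! ### Deletable instructions -/

section Semantics

variable {D : Type u} {Reg : Type v} {Q : Type w} {n : ℕ} [Zero D]

open State

variable {P : Program D Reg Q n} {g : State D Reg Q n} {σ : List (Event D Reg Q n)}

/-- The state of a computation just before an action. -/
theorem AcceptedAt.exists_inv_preds (h : AcceptedAt P σ g) {m : Action n}
    (hm : m ∈ σ.map Event.action) : ∃ s, Inv P (preds (σ.map Event.action) m) s ∧ Le s g := by
  have hg := h.execution
  obtain ⟨es₁, es₂, he⟩ := List.append_of_mem hm
  have hpw := pairwise_idxOf hg.nodup
  obtain ⟨σ₁, l, rfl, rfl, hl⟩ := List.map_eq_append_iff.1 he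
  obtain ⟨e, σ₂, rfl, rfl, rfl⟩ := List.map_eq_cons_iff.1 hl
  obtain ⟨s, s', hs, ht, hle⟩ := h.1.exists_step
  refine ⟨s, ?_, ht.le.trans hle⟩
  convert hs using 1
  ext m
  rw [he] at hpw ⊢
  exact (mem_prefix_iff (fun _ _ h => h.asymm) hpw m).symm

/-- Every computation with an instruction has a deletable one.  If the last instruction of some
thread is not read by any load, it is deletable.  Otherwise all of these are stores; the one that is
committed last is deletable, since at this point all addresses and all conditions are known. -/
theorem AcceptedAt.exists_deletable (h : AcceptedAt P σ g) (hne : ∃ t, 0 < g.len t) :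
    ∃ x, Deletable g x := by
  have hg := h.execution
  set es := σ.map Event.action with hes
  by_cases hread : ∃ x : Fin n × ℕ, x.2 + 1 = g.len x.1 ∧
      ∀ t i, (g.thr t).loaded i ≠ some (.st x.1 x.2)
  · obtain ⟨x, hx, hread⟩ := hread
    have hinv := h.1.inv_initial
    refine ⟨x, hx, g, ⟨fun _ _ _ => rfl⟩, fun t i y _ hl => ⟨hl, ?_⟩,
      fun t i hi => hinv.com_addr t i ((hg.com t i).2 hi),
      fun t i ha => hinv.com_val t i ((hg.com t i).2 ha.lt_len)⟩
    rintro rfl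
    exact hread _ _ hl
  push Not at hread
  have hstore : ∀ {t k}, k + 1 = g.len t → g.IsStore t k ∧ g.getAddr t k ≠ .top := by
    intro t k hk
    obtain ⟨t', i, hl⟩ := hread (t, k) hk
    obtain ⟨-, hst, -, a, ha, -⟩ := hg.read_last hk hl
    refine ⟨hst, ?_⟩
    rw [ha]
    simp
  obtain ⟨t₀, ht₀, hmax⟩ := Finset.exists_max_image (Finset.univ.filter fun t => 0 < g.len t)
    (fun t => es.idxOf (.commit t (g.len t - 1))) (by
      obtain ⟨t, ht⟩ := hne
      exact ⟨t, by simpa using ht⟩)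
  simp only [Finset.mem_filter, Finset.mem_univ, true_and] at ht₀ hmax
  obtain ⟨k, hk⟩ : ∃ k, k + 1 = g.len t₀ := ⟨g.len t₀ - 1, by omega⟩
  have hmem := hg.commit_mem t₀ k (by omega)
  obtain ⟨s, hs, hle⟩ := h.exists_inv_preds hmem
  rw [← hes] at hs
  -- The actions before the commit of the last instruction of any thread have been performed in `s`.
  have hpreds : ∀ {t l}, l + 1 = g.len t →
      preds es (.commit t l) ⊆ preds es (.commit t₀ k) := by
    intro t l hl e he
    have := hmax t (by omega)
    rw [← hk, ← hl, Nat.add_sub_cancel, Nat.add_sub_cancel] at this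
    exact ⟨he.1, he.2.trans_le this⟩
  have hlast : ∀ {t i}, i < g.len t → ∃ l, l + 1 = g.len t ∧ i ≤ l ∧
      Ok g (preds es (.commit t l)) (.commit t l) := fun {t i} hi =>
    ⟨g.len t - 1, by omega, by omega, hg.ok_preds (hg.commit_mem t _ (by omega))⟩
  have hlen : ∀ {t i}, i < g.len t → i < s.len t := by
    intro t i hi
    obtain ⟨l, hl, hil, hok⟩ := hlast hi
    exact hil.trans_lt ((hs.mem_fetch t l).1 (hpreds hl hok.1))
  refine ⟨(t₀, k), hk, s, ⟨fun t i hi => ((hs.emb hle).cmd t i (hlen hi))⟩,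
    fun t i y _ hl => ⟨hle.ld _ _ _ hl, ?_⟩, fun t i hi => ?_, fun t i ha => ?_⟩
  · rintro rfl
    obtain ⟨-, -, -, a, -, -, hp, -⟩ := hg.read_last (x := (t₀, k)) hk (hle.ld _ _ _ hl)
    have h₁ : Action.load t i ∈ preds es (.commit t₀ k) := (hs.mem_load t i).2 (by simp [hl])
    have h₂ := (hg.ok_preds hp.1).2.1
    exact lt_irrefl _ ((h₂.2.trans hp.2).trans h₁.2)
  · refine hs.getAddr_ne_bot hle (hlen hi) ?_
    obtain ⟨l, hl, hil, -, -, hdeps, haddr, -⟩ := hlast hi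
    by_cases htop : g.getAddr t i = .top
    · rw [getAddr_eq_top_iff] at htop
      rintro j ⟨e, he, -⟩
      rw [htop] at he
      cases he
    rcases hil.lt_or_eq with hil | rfl
    · exact fun j hj hjl => hpreds hl ((haddr (hstore hl).2 i hil htop).1 j hj hjl)
    · intro j hj hjl
      have hc := hdeps j (Or.inl (Or.inl hj))
      have hld := (hg.ok_preds hc.1).2.2.2.2 hjl
      exact hpreds hl ⟨hld.1, hld.2.trans hc.2⟩
  · obtain ⟨l, hl, hil, -, -, hdeps, -⟩ := hlast ha.lt_len
    have hil : i < l := lt_of_le_of_ne hil (by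
      rintro rfl
      exact ha.not_isStore (hstore hl).1)
    exact hs.com_val t i ((hs.mem_commit t i).1 (hpreds hl (hdeps i (Or.inr ⟨hil, ha⟩))))

end Semantics

/-! ### Robustness and normal forms -/

section Semantics

variable {D : Type u} {Reg : Type v} {Q : Type w} {n : ℕ} [Zero D]

open State

variable {P : Program D Reg Q n}

/-- Deletion of instructions from a computation with cyclic happens-before relation leads to a
computation whose happens-before relation becomes acyclic by the next deletion. -/
theorem AcceptedAt.exists_almostRanking {g : State D Reg Q n} {σ : List (Event D Reg Q n)}
    (h : AcceptedAt P σ g) (hcyc : g.trace.Cyclic) :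
    ∃ (g' : State D Reg Q n) (σ' : List (Event D Reg Q n)) (x : Fin n × ℕ) (r : Fin n × ℕ → ℕ),
      AcceptedAt P σ' g' ∧ g'.trace.Cyclic ∧ AlmostRanking g' x r := by
  induction hN : ∑ t, g.len t using Nat.strong_induction_on generalizing g σ with
  | _ N ih =>
    subst hN
    have hne : ∃ t, 0 < g.len t := by
      -- Without instructions, there are no arcs.
      by_contra hempty
      push Not at hempty
      have hlen : ∀ {t i}, ¬ i < g.len t := fun {t i} hi => by
        have := hempty t
        omega
      refine Ranking.not_cyclic (g := g) (r := fun _ => 0) ⟨?_, ?_, ?_, ?_, ?_, ?_⟩ hcyc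
      · exact fun _ _ _ _ hi => absurd hi hlen
      · exact fun _ _ _ _ hi => absurd hi hlen
      · exact fun _ _ _ _ hi => absurd hi hlen
      · exact fun _ _ _ _ hst => absurd hst.lt_len hlen
      · exact fun _ _ _ _ _ hi => absurd hi hlen
      · exact fun _ _ _ _ _ _ hi => absurd hi hlen
    obtain ⟨x, hx⟩ := h.exists_deletable hne
    have hg := h.execution
    choose y hy using exists_substitute g (σ.map Event.action) x
    obtain ⟨s, hs, htr, hslen⟩ := (hg.delete hx hy).acceptedAt
    by_cases hscyc : s.trace.Cyclic
    · refine ih _ (Finset.sum_lt_sum (fun t _ => ?_) ⟨x.1, Finset.mem_univ _, ?_⟩) hs hscyc rfl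
      · rw [hslen]
        by_contra hlt
        exact lt_irrefl _ ((lt_len_delete_iff hx.last).1 (not_le.1 hlt)).1
      · rw [hslen, ← hx.last]
        by_contra hlt
        have := (lt_len_delete_iff (t := x.1) (i := x.2) (y := y) hx.last).1 (by omega)
        exact this.2 rfl
    · rw [htr] at hscyc
      obtain ⟨r, hr⟩ := exists_ranking hscyc
      obtain ⟨r', hr'⟩ := hg.almostRanking_of_delete hx hy hr
      exact ⟨g, σ, x, r', h, hcyc, hr'⟩

/-- A program is robust if and only if there is no computation in normal form with a cyclic
happens-before relation.  The number of threads is `n`. -/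
theorem robust_iff : Robust P ↔
    ¬ ∃ σ ∈ powerComputations P, InNormalForm (n + 3) σ ∧ HasCyclicHB P σ := by
  constructor
  · rintro hrob ⟨σ, hσ, -, T, hT, hcyc⟩
    exact not_cyclic_of_sc (hrob ⟨σ, hσ, hT⟩) hcyc
  · rintro hno T ⟨σ, -, g, hg, rfl⟩
    by_cases hcyc : g.trace.Cyclic
    · obtain ⟨g', σ', x, r, hg', hcyc', hr⟩ := hg.exists_almostRanking hcyc
      obtain ⟨τ, s, hs, hnf, htr⟩ := hg'.execution.exists_normalForm hr
      exact absurd ⟨τ, ⟨s, hs⟩, hnf, _, ⟨s, hs, rfl⟩, by rwa [htr]⟩ hno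
    · obtain ⟨r, hr⟩ := exists_ranking hcyc
      exact hg.execution.exists_sc hr

end Semantics

end PowerModel

theorem mainTheorem1 {D : Type*} {Reg : Type*} {Q : Type*} [Finite D] [Zero D] [Finite Reg]
    [Finite Q] (n : ℕ) (P : PowerModel.Program D Reg Q n) :
    PowerModel.Robust P ↔
      ¬ ∃ σ ∈ PowerModel.powerComputations P,
        PowerModel.InNormalForm (n + 3) σ ∧ PowerModel.HasCyclicHB P σ := by
  exact PowerModel.robust_iff
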